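/- Let $p,n\ge 1$, $\alpha_1,\dots,\alpha_n>0$, $\alpha=\sum_k\alpha_k$, let $\Sigma_1,\dots,\Sigma_n$ be real symmetric positive definite $p\times p$ matrices and $\Delta_1,\dots,\Delta_n$ real, not necessarily symmetric, $p\times p$ matrices all of whose eigenvalues are real and non-negative. Write $|M|$ for the determinant, $\|M\|$ for the spectral norm, $\operatorname{etr}(M)=\exp(\operatorname{tr}M)$, and $I$ for the identity matrix. There is an integrable function $f$ on $(0,\infty)^p$ (the density of a finite real measure) with $$\int_{(0,\infty)^p}e^{-\sum_j t_jx_j}f(x)\,dx=\prod_{k=1}^n|I+\Sigma_kT|^{-\alpha_k}\operatorname{etr}\bigl(-\Sigma_kT(I+\Sigma_kT)^{-1}\Delta_k\bigr),\qquad T=\operatorname{diag}(t_1,\dots,t_p),\ t_1,\dots,t_p\ge0 .$$ For every such $f$ put $F(x)=\int_0^{x_1}\!\cdots\int_0^{x_p}f(\xi)\,d\xi$ for $x_1,\dots,x_p\ge 0$. Generators. For $a>0$ let $g_a(x)=e^{-x}x^{a-1}/\Gamma(a)$, $G_a(x)=\int_0^xg_a$, $G^{(m)}_{a+m}(x)=\int_0^x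 g^{(m)}_{a+m}$ ($g^{(m)}$ the $m$-th derivative), $H_{a,m}(x)=\int_0^x(-1)^m\binom{a-1+m}{m}^{-1}L_m^{(a-1)}(2\xi)g_a(\xi)\,d\xi$ with the generalized Laguerre polynomials $L_m^{(a-1)}$, and $G_a(x,y)=\sum_{m\ge0}G_{a+m}(x)y^m$, a series that converges for all $x\ge 0$, $y\in\mathbb C$. Define $$\text{(a)}\quad F_\alpha(x,y)=\sum_{m\ge0}G^{(m)}_{\alpha+m}(x)y^m=\tfrac1{1-y}\,G_\alpha\bigl(x,\tfrac{y}{y-1}\bigr),\quad |y|<1;$$ $$\text{(b)}\quad F_\alpha(x,y)=G_\alpha(x,y),\quad y\in\mathbb C;$$ $$\text{(c)}\quad F_\alpha(x,y)=\sum_{m\ge0}H_{\alpha,m}(x)y^m=\tfrac1{1+y}\,G_\alpha\bigl(x,\tfrac{2y}{y+1}\bigr),\quad |y|<1,$$ where the series converge and have the stated sums for $x\ge0$ and the indicated $y$. For $v>0$ and $r>0$ let $y_j=re^{i\varphi_j}$, $Y=\operatorname{diag}(y_1,\dots,y_p)$, $\mathcal C_p=(-\pi,\pi]^p$, and, for given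 matrices $B_k,D_k$ and a sign $\pm$, $$K=\prod_{k=1}^n\operatorname{etr}\bigl(\pm(Y+B_k)^{-1}D_k\bigr)\,|I+B_kY^{-1}|^{-\alpha_k},$$ where $|I+N|^{-\alpha_k}$, $\|N\|<1$, is the analytic branch that equals $1$ at $N=0$ (the product of the principal powers of the eigenvalues of $I+N$). Then for all $x\in[0,\infty)^p$, the integrands below being integrable: (28) If $B_k=v\Sigma_k-I$, $D_k=\Delta_k(I+B_k)$, $F_\alpha$ is from (a), the sign in $K$ is $-$, and $\max_k\|B_k\|<r<1$, then $$F(x)=(2\pi)^{-p}\int_{\mathcal C_p}K\prod_{j=1}^pF_\alpha(vx_j,y_j)\,d\varphi .$$ Moreover $\max_k\|B_k\|<1$ if $v<2/\max_k\|\Sigma_k\|$. (29) If $B_k=(v\Sigma_k)^{-1}-I$, $D_k=(I+B_k)\Delta_k$, $F_\alpha$ is from (b), the sign in $K$ is $+$, and $\max_k\|B_k\|<r$, then $$F(x)=\Bigl(\prod_{k=1}^n\operatorname{etr}(-\Delta_k)|I+B_k|^{\alpha_k}\Bigr)(2\pi)^{-p}\int_{\mathcal C_p}K\prod_{j=1}^pF_\alpha(vx_j,y_j)\,d\varphi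 .$$ Moreover $\max_k\|B_k\|<1$ if $v>\tfrac12\max_k\|\Sigma_k^{-1}\|$. (30) If $B_k=2(I+v\Sigma_k)^{-1}-I$, $D_k=\tfrac12(I+B_k)\Delta_k(I-B_k)$, $F_\alpha$ is from (c), the sign in $K$ is $+$, and $\max_k\|B_k\|<r<1$, then $$F(x)=\Bigl(\prod_{k=1}^n\operatorname{etr}\bigl(-\tfrac12\Delta_k(I-B_k)\bigr)|I+B_k|^{\alpha_k}\Bigr)(2\pi)^{-p}\int_{\mathcal C_p}K\prod_{j=1}^pF_\alpha(vx_j,y_j)\,d\varphi .$$ Moreover $\max_k\|B_k\|<1$ for every $v>0$. Special case. Let $X$ be a random $p\times m$ matrix with independent columns, the $i$-th one $\mathcal N_p(\mu_i,\Sigma)$-distributed, $\Sigma$ positive definite, $M=(\mu_1,\dots,\mu_m)$, and let $A$ be a symmetric positive semidefinite $m\times m$ matrix of rank $q\ge1$ with $T'AT=\operatorname{diag}(\lambda_1,\dots,\lambda_m)$, $T$ orthogonal, $\lambda_1\ge\dots\ge\lambda_m$. Then for $x\in[0,\infty)^p$ the probability that $\bigl(\tfrac12XAX'\bigr)_{jj}\le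 x_j$ for all $j$ equals $F(x)$ for the $q$ admissible parameters $\alpha_k=\tfrac12$, $\Sigma_k=\lambda_k\Sigma$, $\Delta_k=\tfrac12\mu_k^*\mu_k^{*\prime}\Sigma^{-1}$, $k=1,\dots,q$, where $\mu_k^*$ is the $k$-th column of $MT$; so it is given by each of the three integrals. -/

import Mathlib

open MeasureTheory ProbabilityTheory

noncomputable section

namespace GammaConv

/-! ### Matrices -/

/-- Spectral norm of a real square matrix. -/
def specNorm {p : ℕ} (M : Matrix (Fin p) (Fin p) ℝ) : ℝ :=
  ‖Matrix.toEuclideanCLM (𝕜 := ℝ) M‖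

/-- A real, not necessarily symmetric, matrix all of whose (complex) eigenvalues are real and
non-negative. -/
def NonnegEigenvalues {p : ℕ} (M : Matrix (Fin p) (Fin p) ℝ) : Prop :=
  ∀ z ∈ spectrum ℂ (M.map Complex.ofReal), 0 ≤ z.re ∧ z.im = 0

/-- The power `|M| ^ a` of the determinant of a complex matrix: the product of the principal
`a`-th powers of the eigenvalues of `M`, counted with algebraic multiplicity. On the matrices
without eigenvalues in `(-∞, 0]`, in particular on `{I + N : ‖N‖ < 1}`, this is the analytic branch
of the power of the determinant with value `1` at `I` (the principal power of the determinant
itself is discontinuous there when the dimension is at least `3`). -/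
def detPow {p : ℕ} (M : Matrix (Fin p) (Fin p) ℂ) (a : ℝ) : ℂ :=
  (M.charpoly.roots.map (fun z => z ^ (a : ℂ))).prod

/-! ### The function with the given Laplace transform -/

/-- The open orthant `(0, ∞)^p`. -/
def orthant (p : ℕ) : Set (Fin p → ℝ) := Set.univ.pi fun _ => Set.Ioi 0

/-- The Laplace transform `∏ₖ |I + Σₖ T|^(-αₖ) etr(-Σₖ T (I + Σₖ T)⁻¹ Δₖ)`, `T = diag t`. -/
def laplaceTarget {p n : ℕ} (α : Fin n → ℝ) (S D : Fin n → Matrix (Fin p) (Fin p) ℝ)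
    (t : Fin p → ℝ) : ℝ :=
  ∏ k, (1 + S k * Matrix.diagonal t).det ^ (-α k) *
    Real.exp (-(S k * Matrix.diagonal t * (1 + S k * Matrix.diagonal t)⁻¹ * D k).trace)

/-- `f` is the density on `(0, ∞)^p` of a finite real (signed) measure with Laplace transform
`laplaceTarget α S D`. -/
structure IsConvolutionDensity {p n : ℕ} (α : Fin n → ℝ)
    (S D : Fin n → Matrix (Fin p) (Fin p) ℝ) (f : (Fin p → ℝ) → ℝ) : Prop where
  integrable : IntegrableOn f (orthant p)
  laplace : ∀ t : Fin p → ℝ, (∀ j, 0 ≤ t j) →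
    ∫ x in orthant p, Real.exp (-∑ j, t j * x j) * f x = laplaceTarget α S D t

/-- The function `F(x) = ∫_[0,x] f`. -/
def boxIntegral {p : ℕ} (f : (Fin p → ℝ) → ℝ) (x : Fin p → ℝ) : ℝ :=
  ∫ ξ in Set.univ.pi (fun j => Set.Ioc 0 (x j)), f ξ

/-! ### The generators -/

/-- The standard gamma density `g_a`. -/
def gDens (a : ℝ) : ℝ → ℝ := gammaPDFReal a 1

/-- The standard gamma distribution function `G_a(x)`, `x ≥ 0`. -/
def gCdf (a x : ℝ) : ℝ := ∫ ξ in (0 : ℝ)..x, gDens a ξ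

/-- `G^{(n)}_{a+n}(x)`, the integral over `[0,x]` of the `n`-th derivative of `g_{a+n}`. -/
def gDerivCdf (a : ℝ) (n : ℕ) (x : ℝ) : ℝ :=
  ∫ ξ in (0 : ℝ)..x, iteratedDeriv n (gDens (a + n)) ξ

/-- The generalized Laguerre polynomial `L_n^{(a)}(x)`. -/
def laguerre (n : ℕ) (a x : ℝ) : ℝ :=
  ∑ i ∈ Finset.range (n + 1),
    (-1) ^ i * Ring.choose ((n : ℝ) + a) (n - i) * x ^ i / (i.factorial : ℝ)

/-- `h_{a,n}(x) = (-1)^n binom(a-1+n, n)⁻¹ L_n^{(a-1)}(2x) g_a(x)`. -/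
def hDens (a : ℝ) (n : ℕ) (x : ℝ) : ℝ :=
  (-1) ^ n * (Ring.choose (a - 1 + n) n)⁻¹ * laguerre n (a - 1) (2 * x) * gDens a x

/-- `H_{a,n}(x) = ∫_0^x h_{a,n}`. -/
def hCdf (a : ℝ) (n : ℕ) (x : ℝ) : ℝ := ∫ ξ in (0 : ℝ)..x, hDens a n ξ

/-- First generator `∑ G^{(n)}_{a+n}(x) yⁿ`, `|y| < 1`. -/
def genA (a x : ℝ) (y : ℂ) : ℂ := ∑' n : ℕ, (gDerivCdf a n x : ℂ) * y ^ n

/-- Second generator `G_a(x,y) = ∑ G_{a+n}(x) yⁿ`, `y ∈ ℂ`. -/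
def genB (a x : ℝ) (y : ℂ) : ℂ := ∑' n : ℕ, (gCdf (a + n) x : ℂ) * y ^ n

/-- Third generator `∑ H_{a,n}(x) yⁿ`, `|y| < 1`. -/
def genC (a x : ℝ) (y : ℂ) : ℂ := ∑' n : ℕ, (hCdf a n x : ℂ) * y ^ n

/-! ### The integrals over the cube -/

/-- The cube `(-π, π]^p`. -/
def cube (p : ℕ) : Set (Fin p → ℝ) := Set.univ.pi fun _ => Set.Ioc (-Real.pi) Real.pi

/-- `y_j = r e^{i φ_j}`. -/
def circ {p : ℕ} (r : ℝ) (φ : Fin p → ℝ) (j : Fin p) : ℂ :=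
  (r : ℂ) * Complex.exp (Complex.I * (φ j : ℂ))

/-- `K(y) = ∏ₖ etr(s (Y + Bₖ)⁻¹ Dₖ) |I + Bₖ Y⁻¹|^(-αₖ)`, `Y = diag y`, with the sign `s = ±1`. -/
def kernelK {p n : ℕ} (s : ℂ) (α : Fin n → ℝ) (B D : Fin n → Matrix (Fin p) (Fin p) ℝ)
    (y : Fin p → ℂ) : ℂ :=
  ∏ k, Complex.exp
      (s * ((Matrix.diagonal y + (B k).map Complex.ofReal)⁻¹ * (D k).map Complex.ofReal).trace) *
    detPow (1 + (B k).map Complex.ofReal * (Matrix.diagonal y)⁻¹) (-α k)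

/-- The integrand `K(y) ∏_j F(v x_j, y_j)` at `y_j = r e^{i φ_j}`, for a generator `F`. -/
def integrand {p n : ℕ} (gen : ℝ → ℂ → ℂ) (s : ℂ) (α : Fin n → ℝ)
    (B D : Fin n → Matrix (Fin p) (Fin p) ℝ) (v r : ℝ) (x φ : Fin p → ℝ) : ℂ :=
  kernelK s α B D (circ r φ) * ∏ j, gen (v * x j) (circ r φ j)

/-- `B = v Σ - I`. -/
def matBA {p : ℕ} (v : ℝ) (S : Matrix (Fin p) (Fin p) ℝ) : Matrix (Fin p) (Fin p) ℝ :=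
  v • S - 1

/-- `B = (v Σ)⁻¹ - I`. -/
def matBB {p : ℕ} (v : ℝ) (S : Matrix (Fin p) (Fin p) ℝ) : Matrix (Fin p) (Fin p) ℝ :=
  (v • S)⁻¹ - 1

/-- `B = 2 (I + v Σ)⁻¹ - I`. -/
def matBC {p : ℕ} (v : ℝ) (S : Matrix (Fin p) (Fin p) ℝ) : Matrix (Fin p) (Fin p) ℝ :=
  (2 : ℝ) • (1 + v • S)⁻¹ - 1

end GammaConv

end

open GammaConv

noncomputable section

namespace GammaConv

/-! ### The gamma densities and their generating series -/

/-! Everything is decided on the side of Laplace transforms. Put z = (1 + t/v)⁻¹. The density series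
v ∑ g_{a+m}(vξ) yᵐ has transform z^a / (1 - z y), a geometric series (`integral_exp_mul_gSeries`).
By Euler's transformation of power series (`hasSum_sum_choose`) each of the three generators has the
form c(y) G_a(x, h(y)), and c, h are such that c(y) / (1 - z h(y)) = 1 / (1 - u y) with u = 1 - z,
z, 2z - 1 respectively.

Hence the mixture `mixDensity` of products of such series over the torus |y_j| = r, weighted by K,
has as transform ∏ z_j^a times the torus integral of K ∏ (1 - u_j y_j)⁻¹. In the variable w = 1/y
the product is a Cauchy kernel, and K is holomorphic on |w_j| < 1/r because ‖B_k‖ < r. So the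
integral is (2π)^p times K at w = u (`PolydiscHolo.integral_cube`). The power of the determinant in
K is holomorphic because the sum of log(1 + eigenvalue) is a power series in the traces tr(Nᵐ)
(`detPow_one_add`).

On the matrix side T Z = v(I - Z) gives H (I + ΣT) Z = I + B U, where U = diag(u), H = I in the
first case and H = I + B in the others. This turns the prescribed transform into C ∏ z_j^α K(u), α =
∑ α_k (`laplaceTarget_eq_of_factorization`). The density f and the mixture therefore have equal
transforms for all large t and agree almost everywhere (`ae_eq_of_laplace_of_ge`, by
Stone–Weierstrass). Fubini over the box gives the formula. If r < 1 in the second case, the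
transform of the mixture is known for all t ≥ 0, which yields existence of f.

For the special case the columns of X are rotated by T: they stay independent Gaussian with
covariance Σ (`gaussian_orthogonal_mix`), the diagonal of XAX' becomes a weighted sum of their
squared components, and a Gaussian integral computes its transform. The same uniqueness theorem
identifies its law with f. -/

lemma gDens_of_pos {b ξ : ℝ} (hξ : 0 < ξ) :
    gDens b ξ = (Real.Gamma b)⁻¹ * (ξ ^ (b - 1) * Real.exp (-ξ)) := by
  simp [gDens, gammaPDFReal, hξ.le]; ring

lemma gDens_nonneg {b : ℝ} (hb : 0 < b) (ξ : ℝ) : 0 ≤ gDens b ξ :=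
  gammaPDFReal_nonneg hb one_pos ξ

lemma measurable_gDens (b : ℝ) : Measurable (gDens b) := measurable_gammaPDFReal b 1

lemma gDens_add_one {b : ℝ} (hb : 0 < b) (ξ : ℝ) : gDens (b + 1) ξ = ξ / b * gDens b ξ := by
  unfold gDens gammaPDFReal
  split_ifs with h
  · rcases h.eq_or_lt with rfl | h
    · simp [hb.ne']
    · rw [Real.Gamma_add_one hb.ne', show b + 1 - 1 = (b - 1) + 1 by ring,
        Real.rpow_add_one h.ne']
      have := (Real.Gamma_pos_of_pos hb).ne'
      field_simp
      simp
  · simp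

lemma integrableOn_exp_mul_gDens {b t : ℝ} (hb : 0 < b) (ht : 0 ≤ t) :
    IntegrableOn (fun ξ => Real.exp (-(t * ξ)) * gDens b ξ) (Set.Ioi 0) := by
  have h := (Real.GammaIntegral_convergent hb).const_mul (Real.Gamma b)⁻¹
  refine Integrable.mono' h ?_ ?_
  · exact ((by fun_prop : Measurable fun ξ : ℝ => Real.exp (-(t * ξ))).mul
      (measurable_gDens b)).aestronglyMeasurable
  · refine (ae_restrict_mem measurableSet_Ioi).mono fun ξ (hξ : 0 < ξ) => ?_
    rw [Real.norm_of_nonneg (mul_nonneg (Real.exp_pos _).le (gDens_nonneg hb _)), gDens_of_pos hξ,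
      mul_comm (Real.exp (-ξ))]
    have h1 : Real.exp (-(t * ξ)) ≤ 1 := Real.exp_le_one_iff.2 (by nlinarith)
    have h2 : 0 ≤ (Real.Gamma b)⁻¹ * (ξ ^ (b - 1) * Real.exp (-ξ)) := by
      have := Real.Gamma_pos_of_pos hb
      positivity
    nlinarith

lemma integral_exp_mul_gDens {b t : ℝ} (hb : 0 < b) (ht : 0 ≤ t) :
    ∫ ξ in Set.Ioi 0, Real.exp (-(t * ξ)) * gDens b ξ = (1 + t)⁻¹ ^ b := by
  have h : ∀ ξ ∈ Set.Ioi (0 : ℝ), Real.exp (-(t * ξ)) * gDens b ξ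
      = (Real.Gamma b)⁻¹ * (ξ ^ (b - 1) * Real.exp (-((1 + t) * ξ))) := fun ξ hξ => by
    rw [gDens_of_pos hξ, add_mul, neg_add, Real.exp_add, one_mul]; ring
  rw [setIntegral_congr_fun measurableSet_Ioi h, integral_const_mul,
    Real.integral_rpow_mul_exp_neg_mul_Ioi hb (by linarith)]
  have := (Real.Gamma_pos_of_pos hb).ne'
  field_simp

lemma integrableOn_gDens {b : ℝ} (hb : 0 < b) : IntegrableOn (gDens b) (Set.Ioi 0) := by
  simpa using integrableOn_exp_mul_gDens hb le_rfl

lemma intervalIntegrable_gDens {b x : ℝ} (hb : 0 < b) (hx : 0 ≤ x) :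
    IntervalIntegrable (gDens b) volume 0 x := by
  rw [intervalIntegrable_iff_integrableOn_Ioc_of_le hx]
  exact (integrableOn_gDens hb).mono_set Set.Ioc_subset_Ioi_self

lemma gCdf_nonneg {b x : ℝ} (hb : 0 < b) (hx : 0 ≤ x) : 0 ≤ gCdf b x :=
  intervalIntegral.integral_nonneg hx fun _ _ => gDens_nonneg hb _

/-- Chernoff's bound: e^{t(x - ξ)} ≥ 1 for ξ ≤ x. -/
lemma gCdf_le {b x t : ℝ} (hb : 0 < b) (hx : 0 ≤ x) (ht : 0 ≤ t) :
    gCdf b x ≤ Real.exp (t * x) * (1 + t)⁻¹ ^ b := by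
  rw [gCdf, intervalIntegral.integral_of_le hx, ← integral_exp_mul_gDens hb ht,
    ← integral_const_mul]
  have hi : IntegrableOn (fun ξ => Real.exp (t * x) * (Real.exp (-(t * ξ)) * gDens b ξ))
      (Set.Ioi 0) := (integrableOn_exp_mul_gDens hb ht).const_mul (Real.exp (t * x))
  refine (setIntegral_mono_on ((integrableOn_gDens hb).mono_set Set.Ioc_subset_Ioi_self)
    (hi.mono_set Set.Ioc_subset_Ioi_self) measurableSet_Ioc fun ξ hξ => ?_).trans
    (setIntegral_mono_set hi (ae_of_all _ fun ξ => ?_) Set.Ioc_subset_Ioi_self.eventuallyLE)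
  · rw [← mul_assoc, ← Real.exp_add]
    have : 1 ≤ Real.exp (t * x + -(t * ξ)) := Real.one_le_exp (by nlinarith [hξ.2])
    nlinarith [gDens_nonneg hb ξ]
  · have := gDens_nonneg hb ξ
    simp only [Pi.zero_apply]
    positivity

lemma summable_gCdf_mul_pow {a x : ℝ} (ha : 0 < a) (hx : 0 ≤ x) {ρ : ℝ} (hρ : 0 ≤ ρ) :
    Summable fun m : ℕ => gCdf (a + m) x * ρ ^ m := by
  -- Chernoff's bound with t = ρ dominates the series by a geometric one of ratio ρ / (1 + ρ).
  have hq : ρ * (1 + ρ)⁻¹ < 1 := by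
    rw [← div_eq_mul_inv, div_lt_one (by linarith)]; linarith
  refine Summable.of_nonneg_of_le (fun m => ?_) (fun m => ?_)
    ((summable_geometric_of_lt_one (by positivity) hq).mul_left
      (Real.exp (ρ * x) * (1 + ρ)⁻¹ ^ a))
  · exact mul_nonneg (gCdf_nonneg (by positivity) hx) (by positivity)
  · refine (mul_le_mul_of_nonneg_right (gCdf_le (t := ρ) (by positivity) hx hρ)
      (by positivity)).trans_eq ?_
    rw [Real.rpow_add (by positivity), Real.rpow_natCast, mul_pow]
    ring

lemma summable_genB {a x : ℝ} (ha : 0 < a) (hx : 0 ≤ x) (y : ℂ) :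
    Summable fun m : ℕ => (gCdf (a + m) x : ℂ) * y ^ m := by
  refine Summable.of_norm ((summable_gCdf_mul_pow ha hx (norm_nonneg y)).congr fun m => ?_)
  rw [norm_mul, norm_pow, Complex.norm_of_nonneg (gCdf_nonneg (by positivity) hx)]

/-- The generating series `∑ g_{a+m}(ξ) yᵐ` of the gamma densities. -/
def gSeries (a ξ : ℝ) (y : ℂ) : ℂ := ∑' m : ℕ, (gDens (a + m) ξ : ℂ) * y ^ m

/-- The series `gSeries` at a real argument. -/
def gSeriesReal (a ξ ρ : ℝ) : ℝ := ∑' m : ℕ, gDens (a + m) ξ * ρ ^ m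

lemma summable_gSeriesReal {a : ℝ} (ha : 0 < a) (ξ ρ : ℝ) :
    Summable fun m : ℕ => gDens (a + m) ξ * ρ ^ m := by
  refine summable_of_ratio_norm_eventually_le (r := 1 / 2) (by norm_num) ?_
  filter_upwards [Filter.eventually_ge_atTop ⌈2 * |ξ * ρ|⌉₊] with m hm
  have hm' : 2 * |ξ * ρ| ≤ m := (Nat.le_ceil _).trans (by exact_mod_cast hm)
  have hpos : 0 < a + m := by positivity
  have e : gDens (a + ((m + 1 : ℕ) : ℝ)) ξ * ρ ^ (m + 1)
      = (ξ * ρ / (a + m)) * (gDens (a + m) ξ * ρ ^ m) := by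
    rw [show a + ((m + 1 : ℕ) : ℝ) = (a + m) + 1 by push_cast; ring, gDens_add_one hpos, pow_succ]
    ring
  rw [e, norm_mul]
  refine mul_le_mul_of_nonneg_right ?_ (norm_nonneg _)
  rw [Real.norm_eq_abs, abs_div, abs_of_pos hpos, div_le_iff₀ hpos]
  linarith

lemma summable_norm_gSeries {a : ℝ} (ha : 0 < a) (ξ : ℝ) (y : ℂ) :
    Summable fun m : ℕ => ‖(gDens (a + m) ξ : ℂ) * y ^ m‖ := by
  refine (summable_gSeriesReal ha ξ ‖y‖).congr fun m => ?_
  rw [norm_mul, norm_pow, Complex.norm_of_nonneg (gDens_nonneg (by positivity) ξ)]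

lemma norm_gSeries_le {a : ℝ} (ha : 0 < a) (ξ : ℝ) {y : ℂ} {ρ : ℝ} (hy : ‖y‖ ≤ ρ) :
    ‖gSeries a ξ y‖ ≤ gSeriesReal a ξ ρ := by
  refine (norm_tsum_le_tsum_norm (summable_norm_gSeries ha ξ y)).trans
    ((summable_norm_gSeries ha ξ y).tsum_le_tsum (fun m => ?_) (summable_gSeriesReal ha ξ ρ))
  rw [norm_mul, norm_pow, Complex.norm_of_nonneg (gDens_nonneg (by positivity) ξ)]
  have := gDens_nonneg (b := a + m) (by positivity) ξ
  gcongr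

lemma measurable_gSeries_comp {X : Type*} [MeasurableSpace X] {a : ℝ} (ha : 0 < a)
    {k : X → ℝ} {h : X → ℂ} (hk : Measurable k) (hh : Measurable h) :
    Measurable fun x => gSeries a (k x) (h x) := by
  refine measurable_of_tendsto_metrizable
    (f := fun N x => ∑ m ∈ Finset.range N, (gDens (a + m) (k x) : ℂ) * h x ^ m) (fun N => ?_) ?_
  · refine Finset.measurable_fun_sum _ fun m _ => ?_
    exact (Complex.measurable_ofReal.comp ((measurable_gDens _).comp hk)).mul (hh.pow_const m)
  · rw [tendsto_pi_nhds]
    intro x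
    exact (summable_norm_gSeries ha (k x) (h x)).of_norm.hasSum.tendsto_sum_nat

/-- Termwise integration: the m-th term contributes (1 + t)^{-(a+m)} yᵐ. The bound on y makes the
resulting geometric series converge absolutely, which also justifies the exchange. -/
lemma integral_exp_mul_gSeries {a t : ℝ} (ha : 0 < a) (ht : 0 ≤ t) {y : ℂ}
    (hy : ‖y‖ < 1 + t) :
    ∫ ξ in Set.Ioi 0, Complex.exp (-(t * ξ : ℝ)) * gSeries a ξ y
      = (((1 + t)⁻¹ ^ a : ℝ) : ℂ) * (1 - ((1 + t)⁻¹ : ℝ) * y)⁻¹ := by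
  have hz : ‖(((1 + t)⁻¹ : ℝ) : ℂ) * y‖ < 1 := by
    rw [norm_mul, Complex.norm_of_nonneg (by positivity), inv_mul_lt_one₀ (by positivity)]
    exact hy
  have hint : ∀ m : ℕ, IntegrableOn (fun ξ : ℝ =>
      ((Real.exp (-(t * ξ)) * gDens (a + m) ξ : ℝ) : ℂ) * y ^ m) (Set.Ioi 0) := fun m =>
    ((integrableOn_exp_mul_gDens (b := a + m) (by positivity) ht).ofReal).mul_const _
  have hval : ∀ m : ℕ, ∫ ξ in Set.Ioi (0 : ℝ),
      ((Real.exp (-(t * ξ)) * gDens (a + m) ξ : ℝ) : ℂ) * y ^ m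
        = (((1 + t)⁻¹ ^ a : ℝ) : ℂ) * ((((1 + t)⁻¹ : ℝ) : ℂ) * y) ^ m := fun m => by
    rw [integral_mul_const, integral_complex_ofReal, integral_exp_mul_gDens (by positivity) ht,
      Real.rpow_add (by positivity), Real.rpow_natCast, mul_pow]
    push_cast
    ring
  have hnorm : ∀ m : ℕ, ∫ ξ in Set.Ioi (0 : ℝ),
      ‖((Real.exp (-(t * ξ)) * gDens (a + m) ξ : ℝ) : ℂ) * y ^ m‖
        = (1 + t)⁻¹ ^ a * ((1 + t)⁻¹ * ‖y‖) ^ m := fun m => by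
    have : ∀ ξ : ℝ, ‖((Real.exp (-(t * ξ)) * gDens (a + m) ξ : ℝ) : ℂ) * y ^ m‖
        = (Real.exp (-(t * ξ)) * gDens (a + m) ξ) * ‖y‖ ^ m := fun ξ => by
      rw [norm_mul, norm_pow, Complex.norm_of_nonneg
        (mul_nonneg (Real.exp_pos _).le (gDens_nonneg (by positivity) ξ))]
    simp_rw [this]
    rw [integral_mul_const, integral_exp_mul_gDens (by positivity) ht,
      Real.rpow_add (by positivity), Real.rpow_natCast, mul_pow]
    ring
  have h := integral_tsum_of_summable_integral_norm hint (by
    simp_rw [hnorm]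
    rw [norm_mul, Complex.norm_of_nonneg (by positivity)] at hz
    exact (summable_geometric_of_lt_one (by positivity) hz).mul_left _)
  simp_rw [hval] at h
  rw [tsum_mul_left, tsum_geometric_of_norm_lt_one hz] at h
  rw [h]
  refine integral_congr_ae (ae_of_all _ fun ξ => ?_)
  simp only [gSeries]
  rw [← tsum_mul_left]
  congr 1 with m
  push_cast
  ring

lemma gSeries_ofReal (a ξ ρ : ℝ) : gSeries a ξ ρ = (gSeriesReal a ξ ρ : ℂ) := by
  simp only [gSeries, gSeriesReal, Complex.ofReal_tsum]
  push_cast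
  rfl

lemma integrableOn_exp_mul_gSeriesReal {a t ρ : ℝ} (ha : 0 < a) (ht : 0 ≤ t) (hρ : 0 ≤ ρ)
    (hρt : ρ < 1 + t) :
    IntegrableOn (fun ξ => Real.exp (-(t * ξ)) * gSeriesReal a ξ ρ) (Set.Ioi 0) := by
  have h := integral_exp_mul_gSeries (y := ρ) ha ht
    (by rwa [Complex.norm_of_nonneg hρ])
  -- A non-integrable function has integral 0 by convention, so the nonzero value just computed
  -- proves integrability.
  have h1 : ∫ ξ in Set.Ioi 0, Real.exp (-(t * ξ)) * gSeriesReal a ξ ρ ≠ 0 := by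
    intro h0
    have : ∫ ξ in Set.Ioi (0 : ℝ), Complex.exp (-(t * ξ : ℝ)) * gSeries a ξ ρ = 0 := by
      have h5 := congrArg Complex.ofReal h0
      rw [← integral_complex_ofReal] at h5
      simpa [gSeries_ofReal] using h5
    rw [h] at this
    have hz : (1 + t)⁻¹ * ρ < 1 := by rwa [inv_mul_lt_one₀ (by positivity)]
    have h2 : (1 - ((1 + t)⁻¹ * ρ)) ≠ 0 := by linarith
    have h3 : ((1 + t)⁻¹ ^ a : ℝ) ≠ 0 := by positivity
    have : (1 + t)⁻¹ ^ a * (1 - ((1 + t)⁻¹ * ρ))⁻¹ = 0 := by exact_mod_cast this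
    rcases mul_eq_zero.1 this with h4 | h4
    · exact h3 h4
    · exact h2 (inv_eq_zero.1 h4)
  exact not_imp_comm.1 integral_undef h1

lemma integral_gSeries_Ioc {a x : ℝ} (ha : 0 < a) (hx : 0 ≤ x) (y : ℂ) :
    ∫ ξ in Set.Ioc 0 x, gSeries a ξ y = genB a x y := by
  have hint : ∀ m : ℕ, IntegrableOn (fun ξ : ℝ => (gDens (a + m) ξ : ℂ) * y ^ m)
      (Set.Ioc 0 x) := fun m =>
    (((integrableOn_gDens (b := a + m) (by positivity)).mono_set
      Set.Ioc_subset_Ioi_self).ofReal).mul_const _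
  have h := integral_tsum_of_summable_integral_norm hint (by
    refine (summable_gCdf_mul_pow ha hx (norm_nonneg y)).congr fun m => ?_
    rw [gCdf, intervalIntegral.integral_of_le hx, ← integral_mul_const]
    congr 1 with ξ
    rw [norm_mul, norm_pow, Complex.norm_of_nonneg (gDens_nonneg (by positivity) ξ)])
  rw [genB]
  change ∫ ξ in Set.Ioc 0 x, ∑' m : ℕ, (gDens (a + m) ξ : ℂ) * y ^ m = _
  rw [← h]
  congr 1 with m
  rw [integral_mul_const, integral_complex_ofReal, gCdf, intervalIntegral.integral_of_le hx]

/-! ### The three generators -/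

/-- Euler's transformation. Summing binom(l + k, k) c_k w^{k+l} over l first gives c_k w^k / (1 -
w)^{k+1}; summing along the antidiagonals k + l = m gives the left-hand series. The hypothesis `hc`
is exactly absolute summability of the double series. -/
lemma hasSum_sum_choose {c : ℕ → ℂ} {w : ℂ} (hw : ‖w‖ < 1)
    (hc : Summable fun k => ‖c k‖ * (‖w‖ / (1 - ‖w‖)) ^ k) :
    HasSum (fun m : ℕ => (∑ k ∈ Finset.range (m + 1), (m.choose k : ℂ) * c k) * w ^ m)
      (1 / (1 - w) * ∑' k, c k * (w / (1 - w)) ^ k) := by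
  obtain ⟨F, hF⟩ : ∃ F : ℕ × ℕ → ℂ, ∀ k l,
      F (k, l) = c k * w ^ k * (((l + k).choose k : ℂ) * w ^ l) :=
    ⟨fun q => c q.1 * w ^ q.1 * (((q.2 + q.1).choose q.1 : ℂ) * w ^ q.2), fun _ _ => rfl⟩
  have hw1 : (1 : ℂ) - w ≠ 0 := by
    intro h
    rw [← sub_eq_zero.1 h, norm_one] at hw
    exact lt_irrefl _ hw
  have hcol : ∀ k, HasSum (fun l => F (k, l)) (c k * w ^ k * (1 / (1 - w) ^ (k + 1))) := fun k => by
    simp_rw [hF]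
    exact (hasSum_choose_mul_geometric_of_norm_lt_one k hw).mul_left _
  have hsum : Summable F := by
    refine Summable.of_norm ((summable_prod_of_nonneg fun _ => norm_nonneg _).2 ⟨fun k => ?_, ?_⟩)
    · have := (hasSum_choose_mul_geometric_of_norm_lt_one k
        (by rwa [norm_norm] : ‖‖w‖‖ < 1)).summable.mul_left ‖c k * w ^ k‖
      refine this.congr fun l => ?_
      simp [hF]
    · have h1 : ∀ k, ∑' l, ‖F (k, l)‖ = ‖c k * w ^ k‖ * (1 / (1 - ‖w‖) ^ (k + 1)) := fun k => by
        rw [← tsum_choose_mul_geometric_of_norm_lt_one k (by rwa [norm_norm] : ‖‖w‖‖ < 1),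
          ← tsum_mul_left]
        congr 1 with l
        simp [hF]
      simp_rw [h1]
      refine (hc.mul_left (1 / (1 - ‖w‖))).congr fun k => ?_
      rw [norm_mul, norm_pow, div_pow, pow_succ]
      field_simp
  have hval : ∑' q, F q = 1 / (1 - w) * ∑' k, c k * (w / (1 - w)) ^ k := by
    rw [hsum.tsum_prod, ← tsum_mul_left]
    congr 1 with k
    rw [(hcol k).tsum_eq, div_pow, pow_succ]
    field_simp
  rw [← hval]
  have h1 := (Finset.HasAntidiagonal.sigmaAntidiagonalEquivProd (A := ℕ) |>.hasSum_iff (f := F)).2 hsum.hasSum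
  have h2 := h1.sigma (g := fun m => ∑ q ∈ Finset.HasAntidiagonal.antidiagonal m, F q)
    fun m => (Finset.HasAntidiagonal.antidiagonal m).hasSum F
  convert h2 using 1
  funext m
  rw [Finset.sum_mul, Finset.Nat.sum_antidiagonal_eq_sum_range_succ_mk]
  refine Finset.sum_congr rfl fun k hk => ?_
  have hk : k ≤ m := Nat.lt_succ_iff.1 (Finset.mem_range.1 hk)
  simp only [hF, Nat.sub_add_cancel hk]
  conv_lhs => rw [← Nat.add_sub_cancel' hk, pow_add, Nat.add_sub_cancel' hk]
  ring

lemma hasDerivAt_gDens {b ξ : ℝ} (hb : 0 < b) (hξ : 0 < ξ) :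
    HasDerivAt (gDens (b + 1)) (gDens b ξ - gDens (b + 1) ξ) ξ := by
  have h1 : HasDerivAt (fun ξ : ℝ => (Real.Gamma (b + 1))⁻¹ * (ξ ^ (b + 1 - 1) * Real.exp (-ξ)))
      ((Real.Gamma (b + 1))⁻¹ * ((b + 1 - 1) * ξ ^ (b + 1 - 1 - 1) * Real.exp (-ξ)
        + ξ ^ (b + 1 - 1) * (Real.exp (-ξ) * (-1)))) ξ :=
    (((Real.hasDerivAt_rpow_const (Or.inl hξ.ne')).mul ((hasDerivAt_neg ξ).exp)).const_mul _)
  have h2 : gDens (b + 1) =ᶠ[nhds ξ]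
      fun ξ : ℝ => (Real.Gamma (b + 1))⁻¹ * (ξ ^ (b + 1 - 1) * Real.exp (-ξ)) := by
    filter_upwards [lt_mem_nhds hξ] with η hη
    exact gDens_of_pos hη
  refine (h1.congr_of_eventuallyEq h2).congr_deriv ?_
  rw [gDens_of_pos hξ, gDens_of_pos hξ, Real.Gamma_add_one hb.ne']
  have := (Real.Gamma_pos_of_pos hb).ne'
  simp only [add_sub_cancel_right]
  field_simp
  ring

/-- Since g_{b+1}' = g_b - g_{b+1}, differentiation acts on the gamma densities as a difference
operator, and m derivatives give binomial sums. The offset `l` is free because the induction step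
uses the formula at l and at l + 1, which Pascal's rule then combines. -/
lemma iteratedDeriv_gDens {a : ℝ} (ha : 0 < a) (m l : ℕ) {ξ : ℝ} (hξ : 0 < ξ) :
    iteratedDeriv m (gDens (a + l + m)) ξ
      = ∑ k ∈ Finset.range (m + 1), (m.choose k : ℝ) * ((-1) ^ k * gDens (a + l + k) ξ) := by
  induction m generalizing l ξ with
  | zero => simp
  | succ m ih =>
    have h1 : iteratedDeriv (m + 1) (gDens (a + l + ((m + 1 : ℕ) : ℝ))) ξ
        = iteratedDeriv m (gDens (a + l + m)) ξ
          - iteratedDeriv m (gDens (a + (l + 1 : ℕ) + m)) ξ := by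
      rw [iteratedDeriv_succ]
      have e : a + l + ((m + 1 : ℕ) : ℝ) = a + (l + 1 : ℕ) + m := by push_cast; ring
      rw [e]
      have h2 : iteratedDeriv m (gDens (a + (l + 1 : ℕ) + m)) =ᶠ[nhds ξ]
          fun ξ => ∑ k ∈ Finset.range (m + 1), (m.choose k : ℝ) *
            ((-1) ^ k * gDens (a + (l + 1 : ℕ) + k) ξ) := by
        filter_upwards [lt_mem_nhds hξ] with η hη
        exact ih (l + 1) hη
      rw [h2.deriv_eq, ih l hξ, ih (l + 1) hξ, ← Finset.sum_sub_distrib]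
      refine HasDerivAt.deriv (HasDerivAt.fun_sum fun k _ => ?_)
      have h3 := hasDerivAt_gDens (b := a + l + k) (by positivity) hξ
      have e2 : a + l + k + 1 = a + (l + 1 : ℕ) + k := by push_cast; ring
      rw [e2] at h3
      rw [← mul_sub, ← mul_sub]
      exact (h3.const_mul _).const_mul _
    rw [h1, ih l hξ, ih (l + 1) hξ, Finset.sum_range_succ' _ (m + 1)]
    simp only [Nat.choose_succ_succ', Nat.cast_add, add_mul, Finset.sum_add_distrib]
    rw [Finset.sum_range_succ' _ m, Finset.sum_range_succ (fun k => ((m.choose (k + 1) : ℕ) : ℝ) * _) m]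
    simp only [Nat.choose_succ_self, Nat.cast_zero, zero_mul, add_zero, Nat.choose_zero_right]
    have e3 : ∑ k ∈ Finset.range (m + 1), (m.choose k : ℝ) * ((-1) ^ k * gDens (a + (l + 1 : ℕ) + k) ξ)
        = - ∑ k ∈ Finset.range (m + 1), (m.choose k : ℝ) *
          ((-1) ^ (k + 1) * gDens (a + l + ((k + 1 : ℕ) : ℝ)) ξ) := by
      rw [← Finset.sum_neg_distrib]
      refine Finset.sum_congr rfl fun k _ => ?_
      rw [show a + l + ((k + 1 : ℕ) : ℝ) = a + (l + 1 : ℕ) + k by push_cast; ring]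
      ring
    push_cast at e3 ⊢
    rw [e3]
    ring

lemma gDerivCdf_eq {a x : ℝ} (ha : 0 < a) (hx : 0 ≤ x) (m : ℕ) :
    gDerivCdf a m x
      = ∑ k ∈ Finset.range (m + 1), (m.choose k : ℝ) * ((-1) ^ k * gCdf (a + k) x) := by
  rw [gDerivCdf, intervalIntegral.integral_congr_ae (g := fun ξ =>
    ∑ k ∈ Finset.range (m + 1), (m.choose k : ℝ) * ((-1) ^ k * gDens (a + k) ξ))]
  · rw [intervalIntegral.integral_finsetSum fun k _ =>
      ((intervalIntegrable_gDens (by positivity) hx).const_mul _).const_mul _]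
    simp [gCdf]
  · refine ae_of_all _ fun ξ hξ => ?_
    rw [Set.uIoc_of_le hx] at hξ
    simpa using iteratedDeriv_gDens ha m 0 hξ.1

lemma ringChoose_eq_prod (b : ℝ) (n : ℕ) :
    Ring.choose b n = (n.factorial : ℝ)⁻¹ * ∏ j ∈ Finset.range n, (b - j) := by
  rw [Ring.choose_eq_smul, smul_eq_mul, ← descPochhammer_eval_eq_prod_range,
    ← Polynomial.aeval_eq_smeval, Polynomial.aeval_def, ← Polynomial.eval_map,
    descPochhammer_map]

lemma gDens_mul_pow {a : ℝ} (ha : 0 < a) (i : ℕ) (ξ : ℝ) :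
    ξ ^ i * gDens a ξ = (∏ j ∈ Finset.range i, (a + j)) * gDens (a + i) ξ := by
  induction i with
  | zero => simp
  | succ i ih =>
    rw [pow_succ', mul_assoc, ih, Finset.prod_range_succ,
      show a + ((i + 1 : ℕ) : ℝ) = a + i + 1 by push_cast; ring, gDens_add_one (by positivity)]
    have : a + i ≠ 0 := by positivity
    field_simp

/-- Each monomial of the Laguerre polynomial is absorbed by ξ^k g_a = a(a+1)⋯(a+k-1) g_{a+k}, and
the normalizing binomial coefficient cancels the rising factorials. What remains is the sum for the
derivatives with -1 replaced by -2, so the same Euler transformation applies, at -y. -/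
lemma hDens_eq {a : ℝ} (ha : 0 < a) (n : ℕ) (ξ : ℝ) :
    hDens a n ξ = (-1) ^ n * ∑ k ∈ Finset.range (n + 1),
      (n.choose k : ℝ) * ((-2) ^ k * gDens (a + k) ξ) := by
  have hprod : ∀ k, ∏ j ∈ Finset.range k, (a - 1 + k - j) = ∏ j ∈ Finset.range k, (a + j) := by
    intro k
    rw [← Finset.prod_range_reflect]
    refine Finset.prod_congr rfl fun j hj => ?_
    have : j + 1 ≤ k := Finset.mem_range.1 hj
    rw [Nat.cast_sub (by omega), Nat.cast_sub (by omega)]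
    push_cast
    ring
  have hpos : ∀ k, (∏ j ∈ Finset.range k, (a + j)) ≠ 0 := fun k =>
    Finset.prod_ne_zero_iff.2 fun j _ => by positivity
  rw [hDens, laguerre, mul_assoc, mul_assoc, Finset.sum_mul, Finset.mul_sum]
  congr 1
  refine Finset.sum_congr rfl fun k hk => ?_
  have hk : k ≤ n := Nat.lt_succ_iff.1 (Finset.mem_range.1 hk)
  have h1 : (∏ j ∈ Finset.range n, (a + j)) = (∏ j ∈ Finset.range (n - k), ((n : ℝ) + (a - 1) - j))
      * ∏ j ∈ Finset.range k, (a + j) := by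
    rw [← hprod k, ← hprod n]
    conv_lhs => rw [← Nat.sub_add_cancel hk, Finset.prod_range_add, Nat.sub_add_cancel hk]
    congr 1
    · refine Finset.prod_congr rfl fun j _ => by ring
    · refine Finset.prod_congr rfl fun j _ => ?_
      rw [Nat.cast_add, Nat.cast_sub hk]
      ring
  rw [ringChoose_eq_prod, ringChoose_eq_prod, hprod n, h1,
    Nat.choose_eq_factorial_div_factorial hk, Nat.cast_div (Nat.factorial_mul_factorial_dvd_factorial hk)
      (by positivity), mul_pow]
  have h2 := gDens_mul_pow ha k ξ
  have h3 : (∏ j ∈ Finset.range (n - k), ((n : ℝ) + (a - 1) - j)) ≠ 0 := by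
    intro h0
    rw [h0, zero_mul] at h1
    exact hpos n h1
  have h4 := hpos k
  have h5 : gDens (a + k) ξ = (∏ j ∈ Finset.range k, (a + j))⁻¹ * (ξ ^ k * gDens a ξ) := by
    rw [h2]; field_simp
  have h6 : ((n - k).factorial : ℝ) ≠ 0 := by positivity
  rw [h5, show (-2 : ℝ) = -1 * 2 by norm_num, mul_pow]
  push_cast
  field_simp

lemma hCdf_eq {a x : ℝ} (ha : 0 < a) (hx : 0 ≤ x) (n : ℕ) :
    hCdf a n x = (-1) ^ n * ∑ k ∈ Finset.range (n + 1),
      (n.choose k : ℝ) * ((-2) ^ k * gCdf (a + k) x) := by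
  rw [hCdf]
  simp_rw [hDens_eq ha]
  rw [intervalIntegral.integral_const_mul, intervalIntegral.integral_finsetSum fun k _ =>
      ((intervalIntegrable_gDens (by positivity) hx).const_mul _).const_mul _]
  simp [gCdf]

lemma summable_norm_mul_gCdf {a x : ℝ} (ha : 0 < a) (hx : 0 ≤ x) (s : ℝ) {ρ : ℝ} (hρ : 0 ≤ ρ) :
    Summable fun k : ℕ => ‖((s ^ k * gCdf (a + k) x : ℝ) : ℂ)‖ * ρ ^ k := by
  refine (summable_gCdf_mul_pow ha hx (mul_nonneg (abs_nonneg s) hρ)).congr fun k => ?_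
  rw [Complex.norm_real, Real.norm_eq_abs, abs_mul, abs_pow,
    abs_of_nonneg (gCdf_nonneg (by positivity) hx), mul_pow]
  ring

lemma hasSum_genA {a x : ℝ} (ha : 0 < a) (hx : 0 ≤ x) {y : ℂ} (hy : ‖y‖ < 1) :
    HasSum (fun m : ℕ => (gDerivCdf a m x : ℂ) * y ^ m)
      (1 / (1 - y) * genB a x (y / (y - 1))) := by
  have h := hasSum_sum_choose (c := fun k => (((-1) ^ k * gCdf (a + k) x : ℝ) : ℂ)) hy
    (summable_norm_mul_gCdf ha hx (-1) (div_nonneg (norm_nonneg y) (by linarith)))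
  convert h using 1
  · funext m
    rw [gDerivCdf_eq ha hx]
    push_cast
    rfl
  · rw [genB]
    congr 2
    funext k
    rw [← neg_sub 1 y, div_neg, neg_pow]
    push_cast
    ring

lemma hasSum_genC {a x : ℝ} (ha : 0 < a) (hx : 0 ≤ x) {y : ℂ} (hy : ‖y‖ < 1) :
    HasSum (fun m : ℕ => (hCdf a m x : ℂ) * y ^ m)
      (1 / (1 + y) * genB a x (2 * y / (y + 1))) := by
  have hy' : ‖-y‖ < 1 := by rwa [norm_neg]
  have h := hasSum_sum_choose (c := fun k => (((-2) ^ k * gCdf (a + k) x : ℝ) : ℂ)) hy'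
    (summable_norm_mul_gCdf ha hx (-2) (div_nonneg (norm_nonneg _) (by linarith)))
  convert h using 1
  · funext m
    rw [hCdf_eq ha hx, neg_pow y]
    push_cast
    ring
  · rw [genB, sub_neg_eq_add]
    congr 2
    funext k
    rw [add_comm y 1, show 2 * y / (1 + y) = (-2) * (-y / (1 + y)) by ring, mul_pow]
    push_cast
    ring


/-! ### Cauchy's integral formula on the torus -/

lemma norm_circ {p : ℕ} {r : ℝ} (hr : 0 < r) (φ : Fin p → ℝ) (j : Fin p) : ‖circ r φ j‖ = r := by
  rw [circ, norm_mul, mul_comm Complex.I, Complex.norm_exp_ofReal_mul_I, mul_one,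
    Complex.norm_of_nonneg hr.le]

lemma circ_ne_zero {p : ℕ} {r : ℝ} (hr : 0 < r) (φ : Fin p → ℝ) (j : Fin p) : circ r φ j ≠ 0 := by
  rw [← norm_pos_iff, norm_circ hr]
  exact hr

lemma continuous_circ {p : ℕ} (r : ℝ) : Continuous fun φ : Fin p → ℝ => circ r φ := by
  unfold circ
  fun_prop

/-- With w = 1/y one has (1 - u y)⁻¹ = w / (w - u), and the factor w is absorbed by dw = i w dθ.
This is Cauchy's formula on |w| = 1/r, traversed with θ = -φ. -/
lemma integral_circle_inv {r : ℝ} (hr : 0 < r) {g : ℂ → ℂ}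
    (hg : DiffContOnCl ℂ g (Metric.ball 0 r⁻¹)) {u : ℂ} (hu : ‖u‖ < r⁻¹) :
    ∫ φ in Set.Ioc (-Real.pi) Real.pi, g (r * Complex.exp (Complex.I * (φ : ℂ)))⁻¹ *
      (1 - u * (r * Complex.exp (Complex.I * (φ : ℂ))))⁻¹ = (2 * Real.pi : ℝ) * g u := by
  have hr' : (r : ℂ) ≠ 0 := by exact_mod_cast hr.ne'
  have h := hg.circleIntegral_sub_inv_smul (w := u) (by simpa using hu)
  rw [circleIntegral] at h
  set Q : ℝ → ℂ := fun θ => g (circleMap 0 r⁻¹ θ) * (1 - u * (circleMap 0 r⁻¹ θ)⁻¹)⁻¹ with hQ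
  have h1 : ∀ θ : ℝ, deriv (circleMap 0 r⁻¹) θ • (circleMap 0 r⁻¹ θ - u)⁻¹ • g (circleMap 0 r⁻¹ θ)
      = Complex.I * Q θ := fun θ => by
    have h0 : circleMap 0 r⁻¹ θ ≠ 0 := circleMap_ne_center (inv_ne_zero hr.ne')
    have h2 : (circleMap 0 r⁻¹ θ) * (circleMap 0 r⁻¹ θ - u)⁻¹
        = (1 - u * (circleMap 0 r⁻¹ θ)⁻¹)⁻¹ := by
      generalize circleMap 0 r⁻¹ θ = w at h0
      rw [show 1 - u * w⁻¹ = (w - u) * w⁻¹ by field_simp, mul_inv, inv_inv, mul_comm]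
    simp only [deriv_circleMap, smul_eq_mul, hQ, ← h2]
    ring
  simp_rw [h1] at h
  rw [intervalIntegral.integral_const_mul] at h
  -- Periodicity moves the interval from [0, 2π], used for circle integrals, to [-π, π].
  have hper : Function.Periodic Q (2 * Real.pi) := fun θ => by
    simp only [hQ, periodic_circleMap 0 r⁻¹ θ]
  have h3 : ∫ θ in (-Real.pi)..Real.pi, Q θ = ∫ θ in (0 : ℝ)..(2 * Real.pi), Q θ := by
    have := hper.intervalIntegral_add_eq (-Real.pi) 0
    rw [zero_add] at this
    rw [← this]
    congr 1
    ring
  have h4 : ∀ φ : ℝ, (r * Complex.exp (Complex.I * (φ : ℂ)))⁻¹ = circleMap 0 r⁻¹ (-φ) := fun φ => by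
    rw [circleMap, mul_inv, ← Complex.exp_neg]
    push_cast
    rw [zero_add]
    congr 2
    ring
  have h5 : ∀ φ : ℝ, g (r * Complex.exp (Complex.I * (φ : ℂ)))⁻¹ *
      (1 - u * (r * Complex.exp (Complex.I * (φ : ℂ))))⁻¹ = Q (-φ) := fun φ => by
    change _ = g (circleMap 0 r⁻¹ (-φ)) * (1 - u * (circleMap 0 r⁻¹ (-φ))⁻¹)⁻¹
    rw [← h4, inv_inv]
  simp_rw [h5]
  rw [← intervalIntegral.integral_of_le (by linarith [Real.pi_pos]),
    intervalIntegral.integral_comp_neg, neg_neg, h3]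
  have h6 : Complex.I * ∫ θ in (0 : ℝ)..(2 * Real.pi), Q θ
      = Complex.I * ((2 * Real.pi : ℝ) * g u) := by
    rw [h, smul_eq_mul]
    push_cast
    ring
  exact mul_left_cancel₀ Complex.I_ne_zero h6

lemma restrict_cube (p : ℕ) : (volume : Measure (Fin p → ℝ)).restrict (cube p)
    = Measure.pi fun _ => volume.restrict (Set.Ioc (-Real.pi) Real.pi) := by
  rw [cube, volume_pi, Measure.restrict_pi_pi]

instance (p : ℕ) : IsFiniteMeasure ((volume : Measure (Fin p → ℝ)).restrict (cube p)) := by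
  rw [restrict_cube]
  infer_instance

lemma integrableOn_cube {p : ℕ} {f : (Fin p → ℝ) → ℂ} (hf : Continuous f) :
    IntegrableOn f (cube p) :=
  (hf.continuousOn.integrableOn_compact (isCompact_univ_pi fun _ => isCompact_Icc)).mono_set
    (Set.pi_mono fun _ _ => Set.Ioc_subset_Icc_self)

/-- A function which is continuous on the closed polydisc of radius `R` and holomorphic in each
variable on the open polydisc. -/
structure PolydiscHolo {p : ℕ} (R : ℝ) (K : (Fin p → ℂ) → ℂ) : Prop where
  continuousOn : ContinuousOn K {w | ∀ j, ‖w j‖ ≤ R}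
  differentiableOn : ∀ w : Fin p → ℂ, (∀ j, ‖w j‖ ≤ R) → ∀ j,
    DifferentiableOn ℂ (fun z => K (Function.update w j z)) (Metric.ball 0 R)

lemma PolydiscHolo.continuous_circ {p : ℕ} {r : ℝ} (hr : 0 < r) {K : (Fin p → ℂ) → ℂ}
    (hK : PolydiscHolo r⁻¹ K) : Continuous fun φ : Fin p → ℝ => K fun j => (circ r φ j)⁻¹ := by
  refine hK.continuousOn.comp_continuous ?_ fun φ j => by rw [norm_inv, norm_circ hr]
  exact continuous_pi fun j => ((continuous_apply j).comp (GammaConv.continuous_circ r)).inv₀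
    fun φ => circ_ne_zero hr φ j

/-- Cauchy's integral formula on the torus, in the variable `y = 1 / w`. -/
lemma PolydiscHolo.integral_cube {p : ℕ} {r : ℝ} (hr : 0 < r) {K : (Fin p → ℂ) → ℂ}
    (hK : PolydiscHolo r⁻¹ K) {u : Fin p → ℂ} (hu : ∀ j, ‖u j‖ < r⁻¹) :
    ∫ φ in cube p, K (fun j => (circ r φ j)⁻¹) * ∏ j, (1 - u j * circ r φ j)⁻¹
      = ((2 * Real.pi : ℝ) : ℂ) ^ p * K u := by
  have hne : ∀ {q : ℕ} {u : Fin q → ℂ}, (∀ j, ‖u j‖ < r⁻¹) → ∀ (φ : Fin q → ℝ) (j : Fin q),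
      1 - u j * circ r φ j ≠ 0 := by
    intro q u hu φ j h
    have : ‖u j * circ r φ j‖ < 1 := by
      rw [norm_mul, norm_circ hr, ← lt_inv_mul_iff₀' hr, mul_one]
      exact hu j
    rw [← sub_eq_zero.1 h, norm_one] at this
    exact lt_irrefl _ this
  -- Induction on the number of variables: the first coordinate is split off, the remaining p are
  -- integrated by the induction hypothesis, and the one-variable formula finishes.
  induction p with
  | zero =>
    rw [restrict_cube, Measure.pi_of_empty]
    simp only [integral_dirac, Finset.univ_eq_empty, Finset.prod_empty, mul_one, pow_zero, one_mul]
    congr 1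
    exact Subsingleton.elim _ _
  | succ p ih =>
    set f : (Fin (p + 1) → ℝ) → ℂ := fun φ =>
      K (fun j => (circ r φ j)⁻¹) * ∏ j, (1 - u j * circ r φ j)⁻¹ with hf
    have hfc : Continuous f := by
      refine (hK.continuous_circ hr).mul (continuous_finsetProd _ fun j _ => ?_)
      exact (continuous_const.sub (continuous_const.mul ((continuous_apply j).comp
        (GammaConv.continuous_circ r)))).inv₀ fun φ => hne hu φ j
    have hfi := integrableOn_cube hfc
    rw [IntegrableOn, restrict_cube] at hfi
    set μ : Measure ℝ := volume.restrict (Set.Ioc (-Real.pi) Real.pi)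
    have hmp := (measurePreserving_piFinSuccAbove (fun _ : Fin (p + 1) => μ) 0).symm
    rw [restrict_cube, ← hmp.integral_comp']
    have hfi' : Integrable (fun z => f ((MeasurableEquiv.piFinSuccAbove (fun _ => ℝ) 0).symm z))
        (μ.prod (Measure.pi fun _ => μ)) := (hmp.integrable_comp_emb (MeasurableEquiv.measurableEmbedding _)).2 hfi
    change ∫ z, f ((MeasurableEquiv.piFinSuccAbove (fun _ => ℝ) 0).symm z)
      ∂(μ.prod (Measure.pi fun _ => μ)) = _
    rw [integral_prod _ hfi']
    have hcons : ∀ (a : ℝ) (b : Fin p → ℝ),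
        f ((MeasurableEquiv.piFinSuccAbove (fun _ => ℝ) 0).symm (a, b))
        = (1 - u 0 * (r * Complex.exp (Complex.I * (a : ℂ))))⁻¹ *
          (K (Fin.cons (r * Complex.exp (Complex.I * (a : ℂ)))⁻¹ fun j => (circ r b j)⁻¹)
            * ∏ j, (1 - u (Fin.succ j) * circ r b j)⁻¹) := by
      intro a b
      have e : (MeasurableEquiv.piFinSuccAbove (fun _ => ℝ) 0).symm (a, b)
          = (Fin.cons a b : Fin (p + 1) → ℝ) := by
        simp [MeasurableEquiv.piFinSuccAbove_symm_apply, Fin.insertNthEquiv]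
      have e2 : (fun j => (circ r (Fin.cons a b : Fin (p + 1) → ℝ) j)⁻¹)
          = Fin.cons (r * Complex.exp (Complex.I * (a : ℂ)))⁻¹ fun j => (circ r b j)⁻¹ := by
        funext j
        refine Fin.cases ?_ (fun j => ?_) j <;> simp [circ]
      change f _ = _
      rw [e, hf]
      simp only [e2]
      rw [Fin.prod_univ_succ]
      simp only [circ, Fin.cons_zero, Fin.cons_succ]
      ring
    simp_rw [hcons, integral_const_mul]
    have hmem : ∀ a : ℝ, ‖((r : ℂ) * Complex.exp (Complex.I * (a : ℂ)))⁻¹‖ ≤ r⁻¹ := fun a => by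
      have := norm_circ hr (fun _ : Fin 1 => a) 0
      rw [circ] at this
      rw [norm_inv, this]
    -- Here the first variable stays on the boundary circle |w₀| = 1/r. This is why `PolydiscHolo`
    -- requires holomorphy in each variable with the others anywhere in the closed polydisc.
    have hinner : ∀ a : ℝ, ∫ b, K (Fin.cons (r * Complex.exp (Complex.I * (a : ℂ)))⁻¹
          fun j => (circ r b j)⁻¹) * ∏ j, (1 - u (Fin.succ j) * circ r b j)⁻¹
          ∂(Measure.pi fun _ : Fin p => μ)
        = ((2 * Real.pi : ℝ) : ℂ) ^ p *
          K (Fin.cons (r * Complex.exp (Complex.I * (a : ℂ)))⁻¹ fun j => u (Fin.succ j)) := by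
      intro a
      have hK' : PolydiscHolo r⁻¹ fun w : Fin p → ℂ =>
          K (Fin.cons (r * Complex.exp (Complex.I * (a : ℂ)))⁻¹ w) := by
        refine ⟨?_, fun w hw j => ?_⟩
        · refine hK.continuousOn.comp (Continuous.continuousOn ?_) fun w hw j => ?_
          · exact continuous_const.finCons continuous_id
          · refine Fin.cases ?_ (fun j => ?_) j
            · exact hmem a
            · exact hw j
        · have := hK.differentiableOn
            (Fin.cons (r * Complex.exp (Complex.I * (a : ℂ)))⁻¹ w) (fun j => by
              refine Fin.cases ?_ (fun j => ?_) j
              · exact hmem a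
              · exact hw j) j.succ
          simpa only [← Fin.cons_update] using this
      have := ih hK' (u := fun j => u j.succ) (fun j => hu _)
      rwa [restrict_cube] at this
    have hlast := integral_circle_inv hr
      (g := fun z => K (Fin.cons z fun j => u (Fin.succ j))) (u := u 0) ?_ (hu 0)
    · have e3 : (Fin.cons (u 0) fun j => u (Fin.succ j) : Fin (p + 1) → ℂ) = u := Fin.cons_self_tail u
      rw [e3] at hlast
      calc _ = ∫ a, ((2 * Real.pi : ℝ) : ℂ) ^ p *
          (K (Fin.cons (r * Complex.exp (Complex.I * (a : ℂ)))⁻¹ fun j => u (Fin.succ j)) *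
            (1 - u 0 * (r * Complex.exp (Complex.I * (a : ℂ))))⁻¹) ∂μ := by
            refine integral_congr_ae (ae_of_all _ fun a => ?_)
            simp only []
            rw [hinner a]
            ring
        _ = _ := by
            rw [integral_const_mul, hlast, pow_succ]
            ring
    · have hb : ∀ z : ℂ, ‖z‖ ≤ r⁻¹ → ∀ j,
          ‖(Fin.cons z fun j => u (Fin.succ j) : Fin (p + 1) → ℂ) j‖ ≤ r⁻¹ := by
        intro z hz j
        refine Fin.cases ?_ (fun j => ?_) j
        · exact hz
        · exact (hu _).le
      refine ⟨?_, ?_⟩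
      · have := hK.differentiableOn (Fin.cons 0 fun j => u (Fin.succ j))
          (hb 0 (by simpa using hr.le)) 0
        simpa only [Fin.update_cons_zero] using this
      · refine hK.continuousOn.comp (Continuous.continuousOn ?_) fun z hz => hb z ?_
        · refine continuous_pi fun j => ?_
          refine Fin.cases ?_ (fun j => ?_) j
          · exact continuous_id
          · exact continuous_const
        · simpa using Metric.closure_ball_subset_closedBall hz


/-! ### Powers of the determinant -/

section CharpolyRoots
open Polynomial

variable {p : ℕ} (M : Matrix (Fin p) (Fin p) ℂ)

lemma card_roots_charpoly : Multiset.card M.charpoly.roots = p := by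
  rw [← (IsAlgClosed.splits M.charpoly).natDegree_eq_card_roots, M.charpoly_natDegree_eq_dim,
    Fintype.card_fin]

/-- Both sides are multiplicative in q, and q splits over ℂ, so constants and linear factors
suffice. For a linear factor the claim is the factorization of the characteristic polynomial. -/
lemma det_aeval (q : ℂ[X]) :
    (aeval M q).det = (M.charpoly.roots.map fun z => q.eval z).prod := by
  have hmul : ∀ q₁ q₂ : ℂ[X], (aeval M q₁).det = (M.charpoly.roots.map fun z => q₁.eval z).prod →
      (aeval M q₂).det = (M.charpoly.roots.map fun z => q₂.eval z).prod →
      (aeval M (q₁ * q₂)).det = (M.charpoly.roots.map fun z => (q₁ * q₂).eval z).prod := by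
    intro q₁ q₂ h₁ h₂
    simp only [map_mul, Matrix.det_mul, h₁, h₂, eval_mul, Multiset.prod_map_mul]
  have hC : ∀ c : ℂ, (aeval M (C c)).det = (M.charpoly.roots.map fun z => (C c).eval z).prod := by
    intro c
    simp [card_roots_charpoly, Algebra.algebraMap_eq_smul_one]
  have hlin : ∀ a : ℂ, (aeval M (C a - X)).det
      = (M.charpoly.roots.map fun z => (C a - X).eval z).prod := by
    intro a
    have h := M.eval_charpoly a
    rw [(IsAlgClosed.splits M.charpoly).eq_prod_roots, M.charpoly_monic.leadingCoeff, C_1,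
      one_mul, eval_multiset_prod, Multiset.map_map] at h
    simp only [Function.comp_def, eval_sub, eval_X, eval_C] at h
    simp only [eval_sub, eval_X, eval_C, map_sub, aeval_C, aeval_X]
    exact h.symm
  rw [(IsAlgClosed.splits q).eq_prod_roots]
  refine hmul _ _ (hC _) ?_
  induction q.roots using Multiset.induction with
  | empty => simp
  | cons a s ih =>
    rw [Multiset.map_cons, Multiset.prod_cons]
    refine hmul _ _ ?_ ih
    rw [show (X - C a : ℂ[X]) = C (-1) * (C a - X) by simp]
    exact hmul _ _ (hC _) (hlin a)

/-- The spectral mapping theorem with multiplicities: the characteristic polynomial of q(M) at t is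
the determinant of the polynomial t - q at M. -/
lemma roots_charpoly_aeval (q : ℂ[X]) :
    (aeval M q).charpoly.roots = M.charpoly.roots.map fun z => q.eval z := by
  have h : (aeval M q).charpoly = ((M.charpoly.roots.map fun z => q.eval z).map
      fun a => X - C a).prod := by
    refine Polynomial.funext fun t => ?_
    have h1 : (Matrix.scalar (Fin p)) t - aeval M q = aeval M (C t - q) := by
      rw [map_sub, aeval_C]; rfl
    rw [Matrix.eval_charpoly, h1, det_aeval, eval_multiset_prod, Multiset.map_map, Multiset.map_map]
    simp [Function.comp_def]
  rw [h, roots_multiset_prod_X_sub_C]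

lemma trace_pow_eq_sum_roots (m : ℕ) :
    (M ^ m).trace = (M.charpoly.roots.map fun z => z ^ m).sum := by
  have := roots_charpoly_aeval M (X ^ m)
  rw [map_pow, aeval_X] at this
  rw [Matrix.trace_eq_sum_roots_charpoly, this]
  simp

lemma roots_charpoly_one_add :
    (1 + M).charpoly.roots = M.charpoly.roots.map fun z => 1 + z := by
  have := roots_charpoly_aeval M (1 + X)
  simpa using this

end CharpolyRoots

/-- The trace of the logarithm of `1 + N`. -/
def traceLog {p : ℕ} (N : Matrix (Fin p) (Fin p) ℂ) : ℂ :=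
  ∑' m : ℕ, (-1) ^ (m + 1) * (N ^ m).trace / m

/-! ### Logarithm of the determinant in the spectral norm, and holomorphy of the kernel -/

section L2
open scoped Matrix.Norms.L2Operator

variable {p : ℕ}

lemma norm_le_of_mem_roots_charpoly {N : Matrix (Fin p) (Fin p) ℂ} {z : ℂ}
    (hz : z ∈ N.charpoly.roots) : ‖z‖ ≤ ‖N‖ := by
  have h : z ∈ spectrum ℂ N :=
    Matrix.mem_spectrum_iff_isRoot_charpoly.2 (Polynomial.isRoot_of_mem_roots hz)
  rcases subsingleton_or_nontrivial (Matrix (Fin p) (Fin p) ℂ) with _ | _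
  · simp [spectrum.of_subsingleton] at h
  · exact spectrum.norm_le_norm_of_mem h

/-- The eigenvalues lie in the unit disc, so the Taylor series of log(1 + z) can be summed over
them; the power sums are the traces of Nᵐ. -/
lemma hasSum_traceLog {N : Matrix (Fin p) (Fin p) ℂ} (hN : ‖N‖ < 1) :
    HasSum (fun m : ℕ => (-1) ^ (m + 1) * (N ^ m).trace / (m : ℂ))
      (N.charpoly.roots.map fun z => Complex.log (1 + z)).sum := by
  simp_rw [trace_pow_eq_sum_roots]
  have hs : ∀ z ∈ N.charpoly.roots, ‖z‖ < 1 := fun z hz =>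
    (norm_le_of_mem_roots_charpoly hz).trans_lt hN
  generalize N.charpoly.roots = S at hs
  induction S using Multiset.induction with
  | empty => simp
  | cons a s ih =>
    simp only [Multiset.map_cons, Multiset.sum_cons]
    convert (Complex.hasSum_taylorSeries_log (hs a (Multiset.mem_cons_self a s))).add
      (ih fun z hz => hs z (Multiset.mem_cons_of_mem hz)) using 1
    funext m
    ring

lemma one_add_ne_zero_of_norm_lt {z : ℂ} (hz : ‖z‖ < 1) : 1 + z ≠ 0 := by
  intro h
  rw [← neg_eq_of_add_eq_zero_right h, norm_neg, norm_one] at hz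
  exact lt_irrefl _ hz

/-- `detPow` is defined through eigenvalues, whose dependence on the matrix is not visibly analytic.
This form is, because `traceLog` is a power series in the entries. -/
lemma detPow_one_add {N : Matrix (Fin p) (Fin p) ℂ} (hN : ‖N‖ < 1) (a : ℝ) :
    detPow (1 + N) a = Complex.exp (a * traceLog N) := by
  rw [detPow, roots_charpoly_one_add, Multiset.map_map, traceLog, (hasSum_traceLog hN).tsum_eq,
    ← Multiset.sum_map_mul_left, Complex.exp_multiset_sum, Multiset.map_map]
  congr 1
  refine Multiset.map_congr rfl fun z hz => ?_
  have := one_add_ne_zero_of_norm_lt ((norm_le_of_mem_roots_charpoly hz).trans_lt hN)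
  simp only [Function.comp_apply]
  rw [Complex.cpow_def_of_ne_zero this, mul_comm]

lemma det_one_add {N : Matrix (Fin p) (Fin p) ℂ} (hN : ‖N‖ < 1) :
    (1 + N).det = Complex.exp (traceLog N) := by
  have := detPow_one_add hN 1
  simp only [detPow, Complex.ofReal_one, Complex.cpow_one, Multiset.map_id', one_mul] at this
  rw [← this, Matrix.det_eq_prod_roots_charpoly]

lemma traceLog_ofReal (N : Matrix (Fin p) (Fin p) ℝ) :
    traceLog (N.map Complex.ofReal)
      = ((∑' m : ℕ, (-1) ^ (m + 1) * (N ^ m).trace / m : ℝ) : ℂ) := by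
  rw [traceLog, Complex.ofReal_tsum]
  congr 1 with m
  have : (N.map Complex.ofReal) ^ m = (N ^ m).map Complex.ofReal :=
    (Matrix.map_pow N Complex.ofRealHom m).symm
  rw [this]
  push_cast
  simp [Matrix.trace]

/-- For a real matrix `traceLog` is a real number l, so the determinant is e^l > 0 and the analytic
branch is the ordinary real power. -/
lemma detPow_one_add_ofReal {N : Matrix (Fin p) (Fin p) ℝ} (hN : ‖N.map Complex.ofReal‖ < 1)
    (a : ℝ) : 0 < (1 + N).det ∧
      detPow (1 + N.map Complex.ofReal) a = (((1 + N).det ^ a : ℝ) : ℂ) := by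
  obtain ⟨l, hl⟩ : ∃ l : ℝ, traceLog (N.map Complex.ofReal) = l := ⟨_, traceLog_ofReal N⟩
  have hmap : (1 + N.map Complex.ofReal) = (1 + N).map Complex.ofReal := by
    rw [Matrix.map_add _ Complex.ofReal_add, Matrix.map_one _ Complex.ofReal_zero Complex.ofReal_one]
  have hdet : (1 + N).det = Real.exp l := by
    have h := det_one_add hN
    rw [hl, hmap, show (1 + N).map Complex.ofReal = Complex.ofRealHom.mapMatrix (1 + N) from rfl,
      ← RingHom.map_det] at h
    exact Complex.ofReal_injective (h.trans (Complex.ofReal_exp l).symm)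
  refine ⟨hdet ▸ Real.exp_pos _, ?_⟩
  rw [detPow_one_add hN, hl, hdet, ← Real.exp_mul]
  push_cast
  rw [mul_comm]

/-- A real matrix acts separately on the real and imaginary parts a, b of a complex vector, and ‖a +
ib‖² = ‖a‖² + ‖b‖². -/
lemma norm_map_ofReal_le (B : Matrix (Fin p) (Fin p) ℝ) : ‖B.map Complex.ofReal‖ ≤ specNorm B := by
  rw [Matrix.cstar_norm_def]
  refine ContinuousLinearMap.opNorm_le_bound _ (norm_nonneg _) fun x => ?_
  set a : EuclideanSpace ℝ (Fin p) := WithLp.toLp 2 fun i => (x i).re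
  set b : EuclideanSpace ℝ (Fin p) := WithLp.toLp 2 fun i => (x i).im
  have hx : ‖x‖ ^ 2 = ‖a‖ ^ 2 + ‖b‖ ^ 2 := by
    rw [EuclideanSpace.norm_sq_eq, EuclideanSpace.norm_sq_eq, EuclideanSpace.norm_sq_eq,
      ← Finset.sum_add_distrib]
    refine Finset.sum_congr rfl fun i _ => ?_
    rw [← Complex.normSq_eq_norm_sq, Complex.normSq_apply]
    simp [a, b]
    ring
  have hBx : ‖Matrix.toEuclideanCLM (𝕜 := ℂ) (B.map Complex.ofReal) x‖ ^ 2
      = ‖Matrix.toEuclideanCLM (𝕜 := ℝ) B a‖ ^ 2 + ‖Matrix.toEuclideanCLM (𝕜 := ℝ) B b‖ ^ 2 := by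
    rw [EuclideanSpace.norm_sq_eq, EuclideanSpace.norm_sq_eq, EuclideanSpace.norm_sq_eq,
      ← Finset.sum_add_distrib]
    refine Finset.sum_congr rfl fun i _ => ?_
    rw [← Complex.normSq_eq_norm_sq, Complex.normSq_apply]
    simp [a, b, Matrix.ofLp_toEuclideanCLM, Matrix.mulVec, dotProduct]
    ring
  have ha := (Matrix.toEuclideanCLM (𝕜 := ℝ) B).le_opNorm a
  have hb := (Matrix.toEuclideanCLM (𝕜 := ℝ) B).le_opNorm b
  change _ ≤ specNorm B * ‖a‖ at ha
  change _ ≤ specNorm B * ‖b‖ at hb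
  have hs : 0 ≤ specNorm B := norm_nonneg _
  refine (pow_le_pow_iff_left₀ (norm_nonneg _) (by positivity) two_ne_zero).1 ?_
  rw [hBx, mul_pow, hx]
  nlinarith [mul_self_le_mul_self (norm_nonneg _) ha, mul_self_le_mul_self (norm_nonneg _) hb]

/-- `K` as a function of `w = 1 / y`. -/
def kernelW {n : ℕ} (s : ℂ) (α : Fin n → ℝ) (B D : Fin n → Matrix (Fin p) (Fin p) ℝ)
    (w : Fin p → ℂ) : ℂ :=
  ∏ k, Complex.exp (s * (Matrix.diagonal w * (1 + (B k).map Complex.ofReal * Matrix.diagonal w)⁻¹ *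
      (D k).map Complex.ofReal).trace) *
    detPow (1 + (B k).map Complex.ofReal * Matrix.diagonal w) (-α k)

/-- Y + B = (I + B Y⁻¹) Y, hence (Y + B)⁻¹ = W (I + B W)⁻¹ with W = Y⁻¹. This form has no
singularity at w = 0. -/
lemma kernelK_eq_kernelW {n : ℕ} (s : ℂ) (α : Fin n → ℝ) (B D : Fin n → Matrix (Fin p) (Fin p) ℝ)
    {y : Fin p → ℂ} (hy : ∀ j, y j ≠ 0) :
    kernelK s α B D y = kernelW s α B D fun j => (y j)⁻¹ := by
  have h1 : (Matrix.diagonal y)⁻¹ = Matrix.diagonal fun j => (y j)⁻¹ := by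
    refine Matrix.inv_eq_left_inv ?_
    rw [Matrix.diagonal_mul_diagonal, ← Matrix.diagonal_one]
    congr 1
    funext j
    exact inv_mul_cancel₀ (hy j)
  unfold kernelK kernelW
  refine Finset.prod_congr rfl fun k _ => ?_
  have h2 : Matrix.diagonal y + (B k).map Complex.ofReal
      = (1 + (B k).map Complex.ofReal * (Matrix.diagonal y)⁻¹) * Matrix.diagonal y := by
    rw [add_mul, one_mul, mul_assoc, h1, Matrix.diagonal_mul_diagonal]
    simp [inv_mul_cancel₀ (hy _)]
  rw [h2, Matrix.mul_inv_rev, h1]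

lemma norm_mul_diagonal_le {r : ℝ} (hr : 0 < r) (B : Matrix (Fin p) (Fin p) ℝ) {w : Fin p → ℂ}
    (hw : ∀ j, ‖w j‖ ≤ r⁻¹) :
    ‖B.map Complex.ofReal * Matrix.diagonal w‖ ≤ specNorm B * r⁻¹ := by
  refine (norm_mul_le _ _).trans (mul_le_mul (norm_map_ofReal_le B) ?_ (norm_nonneg _)
    (norm_nonneg _))
  rw [Matrix.l2_opNorm_diagonal]
  exact (pi_norm_le_iff_of_nonneg (by positivity)).2 hw

lemma differentiable_mul_diagonal (A : Matrix (Fin p) (Fin p) ℂ) :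
    Differentiable ℂ fun w : Fin p → ℂ => A * Matrix.diagonal w := by
  have h : Differentiable ℂ (Matrix.diagonalLinearMap (Fin p) ℂ ℂ) :=
    (LinearMap.toContinuousLinearMap (Matrix.diagonalLinearMap (Fin p) ℂ ℂ)).differentiable
  exact (differentiable_const A).mul h

lemma differentiable_trace :
    Differentiable ℂ fun A : Matrix (Fin p) (Fin p) ℂ => A.trace :=
  (LinearMap.toContinuousLinearMap (Matrix.traceLinearMap (Fin p) ℂ ℂ)).differentiable

lemma exists_norm_trace_le : ∃ c : ℝ, 0 ≤ c ∧ ∀ A : Matrix (Fin p) (Fin p) ℂ, ‖A.trace‖ ≤ c * ‖A‖ :=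
  ⟨_, norm_nonneg _, (LinearMap.toContinuousLinearMap (Matrix.traceLinearMap (Fin p) ℂ ℂ)).le_opNorm⟩

lemma differentiable_update (w : Fin p → ℂ) (j : Fin p) :
    Differentiable ℂ fun z : ℂ => Function.update w j z := by
  refine differentiable_pi.2 fun i => ?_
  rcases eq_or_ne i j with rfl | h
  · simp
  · simp [Function.update_of_ne h]

lemma norm_update_le {R : ℝ} {w : Fin p → ℂ} (hw : ∀ j, ‖w j‖ ≤ R) (j : Fin p) {z : ℂ}
    (hz : ‖z‖ ≤ R) (i : Fin p) : ‖Function.update w j z i‖ ≤ R := by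
  rcases eq_or_ne i j with rfl | h
  · simpa using hz
  · simpa [Function.update_of_ne h] using hw i

lemma PolydiscHolo.of_differentiableAt {R : ℝ} {K : (Fin p → ℂ) → ℂ}
    (h : ∀ w : Fin p → ℂ, (∀ j, ‖w j‖ ≤ R) → DifferentiableAt ℂ K w) : PolydiscHolo R K := by
  refine ⟨fun w hw => (h w hw).continuousAt.continuousWithinAt, fun w hw j z hz => ?_⟩
  have hz' : ‖z‖ ≤ R := (mem_ball_zero_iff.1 hz).le
  exact ((h _ (norm_update_le hw j hz')).comp z
    (differentiable_update w j z)).differentiableWithinAt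

lemma PolydiscHolo.mul {R : ℝ} {K L : (Fin p → ℂ) → ℂ} (hK : PolydiscHolo R K)
    (hL : PolydiscHolo R L) : PolydiscHolo R fun w => K w * L w :=
  ⟨hK.1.mul hL.1, fun w hw j => (hK.2 w hw j).mul (hL.2 w hw j)⟩

lemma PolydiscHolo.cexp {R : ℝ} {K : (Fin p → ℂ) → ℂ} (hK : PolydiscHolo R K) :
    PolydiscHolo R fun w => Complex.exp (K w) :=
  ⟨hK.1.cexp, fun w hw j => (hK.2 w hw j).cexp⟩

lemma PolydiscHolo.const_mul {R : ℝ} {K : (Fin p → ℂ) → ℂ} (hK : PolydiscHolo R K) (c : ℂ) :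
    PolydiscHolo R fun w => c * K w :=
  ⟨continuousOn_const.mul hK.1, fun w hw j => (hK.2 w hw j).const_mul c⟩

lemma PolydiscHolo.prod {ι : Type*} (s : Finset ι) {R : ℝ} {K : ι → (Fin p → ℂ) → ℂ}
    (hK : ∀ i ∈ s, PolydiscHolo R (K i)) : PolydiscHolo R fun w => ∏ i ∈ s, K i w :=
  ⟨continuousOn_finsetProd _ fun i hi => (hK i hi).1,
    fun w hw j => DifferentiableOn.fun_finsetProd fun i hi => (hK i hi).2 w hw j⟩

lemma PolydiscHolo.congr {R : ℝ} {K L : (Fin p → ℂ) → ℂ} (hK : PolydiscHolo R K)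
    (h : ∀ w : Fin p → ℂ, (∀ j, ‖w j‖ ≤ R) → L w = K w) : PolydiscHolo R L :=
  ⟨hK.1.congr h, fun w hw j => (hK.2 w hw j).congr fun _ hz =>
    h _ (norm_update_le hw j (mem_ball_zero_iff.1 hz).le)⟩

/-- Weierstrass' M-test: the terms are polynomials in w, dominated by a geometric series of ratio
‖B‖ / r. -/
lemma polydiscHolo_traceLog {r : ℝ} (hr : 0 < r) {B : Matrix (Fin p) (Fin p) ℝ}
    (hB : specNorm B < r) :
    PolydiscHolo r⁻¹ fun w => traceLog (B.map Complex.ofReal * Matrix.diagonal w) := by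
  obtain ⟨c, hc, hct⟩ := exists_norm_trace_le (p := p)
  have hB0 : 0 ≤ specNorm B := norm_nonneg _
  have hq : specNorm B * r⁻¹ < 1 := by rwa [← div_eq_mul_inv, div_lt_one hr]
  have hd : ∀ m : ℕ, Differentiable ℂ fun w : Fin p → ℂ =>
      (-1) ^ (m + 1) * ((B.map Complex.ofReal * Matrix.diagonal w) ^ m).trace / (m : ℂ) := fun m => by
    have h : Differentiable ℂ fun w : Fin p → ℂ =>
        ((B.map Complex.ofReal * Matrix.diagonal w) ^ m).trace :=
      differentiable_trace.comp ((differentiable_mul_diagonal (B.map Complex.ofReal)).pow m)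
    simp_rw [div_eq_mul_inv]
    exact (h.const_mul _).mul_const _
  have hsum : Summable fun m : ℕ => c * ‖(1 : Matrix (Fin p) (Fin p) ℂ)‖ * (specNorm B * r⁻¹) ^ m
      + c * (specNorm B * r⁻¹) ^ m :=
    ((summable_geometric_of_lt_one (by positivity) hq).mul_left _).add
      ((summable_geometric_of_lt_one (by positivity) hq).mul_left _)
  have hbd : ∀ (m : ℕ) (w : Fin p → ℂ), (∀ j, ‖w j‖ ≤ r⁻¹) →
      ‖(-1) ^ (m + 1) * ((B.map Complex.ofReal * Matrix.diagonal w) ^ m).trace / (m : ℂ)‖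
        ≤ c * ‖(1 : Matrix (Fin p) (Fin p) ℂ)‖ * (specNorm B * r⁻¹) ^ m
      + c * (specNorm B * r⁻¹) ^ m := by
    intro m w hw
    -- The term m = 0 of `traceLog` is a division by zero and so has the value 0.
    rcases m.eq_zero_or_pos with rfl | hm
    · simp only [Nat.cast_zero, div_zero, norm_zero]
      positivity
    · rw [norm_div, norm_mul, norm_pow, norm_neg, norm_one, one_pow, one_mul, Complex.norm_natCast]
      have h1 : (1 : ℝ) ≤ m := by exact_mod_cast hm
      calc _ ≤ ‖((B.map Complex.ofReal * Matrix.diagonal w) ^ m).trace‖ :=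
            div_le_self (norm_nonneg _) h1
        _ ≤ c * ‖(B.map Complex.ofReal * Matrix.diagonal w) ^ m‖ := hct _
        _ ≤ c * (specNorm B * r⁻¹) ^ m := by
            gcongr
            exact (norm_pow_le' _ hm).trans
              (pow_le_pow_left₀ (norm_nonneg _) (norm_mul_diagonal_le hr B hw) m)
        _ ≤ _ := le_add_of_nonneg_left (by positivity)
  refine ⟨continuousOn_tsum (fun m => (hd m).continuous.continuousOn) hsum hbd, fun w hw j => ?_⟩
  refine Complex.differentiableOn_tsum_of_summable_norm hsum (fun m => ?_) Metric.isOpen_ball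
    fun m z hz => hbd m _ (norm_update_le hw j (mem_ball_zero_iff.1 hz).le)
  exact ((hd m).comp (differentiable_update w j)).differentiableOn

lemma isUnit_one_add {N : Matrix (Fin p) (Fin p) ℂ} (hN : ‖N‖ < 1) : IsUnit (1 + N) := by
  rw [← sub_neg_eq_add]
  exact isUnit_one_sub_of_norm_lt_one (by rwa [norm_neg])

/-- On the closed polydisc ‖B W‖ ≤ ‖B‖ / r < 1. So I + B W is invertible there, inversion is
differentiable at it, and the power of its determinant is exp(-α `traceLog`). -/
lemma polydiscHolo_kernelW {n : ℕ} {r : ℝ} (hr : 0 < r) (s : ℂ) (α : Fin n → ℝ)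
    (B D : Fin n → Matrix (Fin p) (Fin p) ℝ) (hB : ∀ k, specNorm (B k) < r) :
    PolydiscHolo r⁻¹ (kernelW s α B D) := by
  have hlt : ∀ k (w : Fin p → ℂ), (∀ j, ‖w j‖ ≤ r⁻¹) →
      ‖(B k).map Complex.ofReal * Matrix.diagonal w‖ < 1 := fun k w hw =>
    (norm_mul_diagonal_le hr (B k) hw).trans_lt (by rw [← div_eq_mul_inv, div_lt_one hr]; exact hB k)
  refine PolydiscHolo.prod _ fun k _ => PolydiscHolo.mul ?_ ?_
  · refine PolydiscHolo.cexp (PolydiscHolo.const_mul (PolydiscHolo.of_differentiableAt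
      fun w hw => ?_) s)
    have h1 : DifferentiableAt ℂ (fun w : Fin p → ℂ =>
        Ring.inverse (1 + (B k).map Complex.ofReal * Matrix.diagonal w)) w :=
      DifferentiableAt.comp (f := fun w : Fin p → ℂ =>
        1 + (B k).map Complex.ofReal * Matrix.diagonal w) (g := Ring.inverse) w
        (differentiableAt_inverse (isUnit_one_add (hlt k w hw)))
        ((differentiable_mul_diagonal _ w).const_add 1)
    have h2 : DifferentiableAt ℂ (fun w : Fin p → ℂ =>
        (1 : Matrix (Fin p) (Fin p) ℂ) * Matrix.diagonal w) w := differentiable_mul_diagonal 1 w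
    simp_rw [one_mul] at h2
    simp_rw [Matrix.nonsing_inv_eq_ringInverse]
    exact (differentiable_trace _).comp w ((h2.mul h1).mul (differentiableAt_const _))
  · refine ((polydiscHolo_traceLog hr (hB k)).const_mul ((-α k : ℝ) : ℂ)).cexp.congr fun w hw => ?_
    exact detPow_one_add (hlt k w hw) (-α k)

/-- The values of `kernelW` at real points. -/
lemma kernelW_ofReal {n : ℕ} {r : ℝ} (hr : 0 < r) (s : ℝ) (α : Fin n → ℝ)
    (B D : Fin n → Matrix (Fin p) (Fin p) ℝ) (hB : ∀ k, specNorm (B k) < r) {u : Fin p → ℝ}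
    (hu : ∀ j, |u j| ≤ r⁻¹) :
    (∀ k, 0 < (1 + B k * Matrix.diagonal u).det) ∧
    kernelW s α B D (fun j => (u j : ℂ)) = ((∏ k, Real.exp (s * (Matrix.diagonal u *
      (1 + B k * Matrix.diagonal u)⁻¹ * D k).trace) *
        (1 + B k * Matrix.diagonal u).det ^ (-α k) : ℝ) : ℂ) := by
  have hdiag : Matrix.diagonal (fun j => (u j : ℂ)) = (Matrix.diagonal u).map Complex.ofReal := by
    rw [Matrix.diagonal_map Complex.ofReal_zero]
  have hmul : ∀ A C : Matrix (Fin p) (Fin p) ℝ, A.map Complex.ofReal * C.map Complex.ofReal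
      = (A * C).map Complex.ofReal := fun A C => (Matrix.map_mul (f := Complex.ofRealHom)).symm
  have hadd : ∀ A : Matrix (Fin p) (Fin p) ℝ, 1 + A.map Complex.ofReal
      = (1 + A).map Complex.ofReal := fun A => by
    rw [Matrix.map_add _ Complex.ofReal_add,
      Matrix.map_one _ Complex.ofReal_zero Complex.ofReal_one]
  have hlt : ∀ k, ‖(B k * Matrix.diagonal u).map Complex.ofReal‖ < 1 := fun k => by
    rw [← hmul, ← hdiag]
    refine (norm_mul_diagonal_le hr (B k) fun j => ?_).trans_lt
      (by rw [← div_eq_mul_inv, div_lt_one hr]; exact hB k)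
    rw [Complex.norm_real]
    exact hu j
  refine ⟨fun k => (detPow_one_add_ofReal (hlt k) 1).1, ?_⟩
  unfold kernelW
  push_cast
  refine Finset.prod_congr rfl fun k _ => ?_
  obtain ⟨hpos, hpow⟩ := detPow_one_add_ofReal (hlt k) (-α k)
  have hinv : ((1 + B k * Matrix.diagonal u).map Complex.ofReal)⁻¹
      = ((1 + B k * Matrix.diagonal u)⁻¹).map Complex.ofReal := by
    refine Matrix.inv_eq_left_inv ?_
    rw [hmul, Matrix.nonsing_inv_mul _ (isUnit_iff_ne_zero.2 hpos.ne'),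
      Matrix.map_one _ Complex.ofReal_zero Complex.ofReal_one]
  have htr : ∀ A : Matrix (Fin p) (Fin p) ℝ, (A.map Complex.ofReal).trace = (A.trace : ℂ) :=
    fun A => by simp [Matrix.trace]
  rw [hdiag, hmul, hpow, hadd, hinv, hmul, hmul, htr]

end L2


/-! ### Uniqueness of the Laplace transform on the orthant -/

section Uniqueness
open BoundedContinuousFunction
open scoped NNReal

variable {p : ℕ}

/-- The exponential `x ↦ exp (-⟨t, x⟩)` as a bounded continuous function on `[0, ∞)^p`. -/
def expBCF (t : Fin p → ℝ≥0) : (Fin p → ℝ≥0) →ᵇ ℝ :=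
  BoundedContinuousFunction.ofNormedAddCommGroup
    (fun x => Real.exp (-∑ j, (t j : ℝ) * (x j : ℝ))) (by fun_prop) 1 fun x => by
      rw [Real.norm_of_nonneg (Real.exp_pos _).le, Real.exp_le_one_iff, neg_nonpos]
      exact Finset.sum_nonneg fun j _ => mul_nonneg (t j).2 (x j).2

lemma expBCF_apply (t x : Fin p → ℝ≥0) :
    expBCF t x = Real.exp (-∑ j, (t j : ℝ) * (x j : ℝ)) := rfl

variable (p) in
/-- The submonoid of the exponentials. -/
def expSubmonoid : Submonoid ((Fin p → ℝ≥0) →ᵇ ℝ) where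
  carrier := Set.range expBCF
  one_mem' := ⟨0, by ext x; simp [expBCF_apply]⟩
  mul_mem' := by
    rintro _ _ ⟨s, rfl⟩ ⟨t, rfl⟩
    refine ⟨s + t, ?_⟩
    ext x
    rw [BoundedContinuousFunction.mul_apply, expBCF_apply, expBCF_apply, expBCF_apply,
      ← Real.exp_add, ← neg_add, ← Finset.sum_add_distrib]
    simp [add_mul]

variable (p) in
/-- The star algebra generated by the exponentials. -/
def expAlgebra : StarSubalgebra ℝ ((Fin p → ℝ≥0) →ᵇ ℝ) :=
  { Algebra.adjoin ℝ (expSubmonoid p : Set ((Fin p → ℝ≥0) →ᵇ ℝ)) with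
    star_mem' := fun {a} ha => by
      have : star a = a := by ext x; simp
      rw [this]
      exact ha }

/-- Stone–Weierstrass for finite measures on a Polish space. The exponentials are closed under
multiplication, so the algebra they generate is their linear span, and equality of integrals extends
to it. The functions exp(-x_j) separate points. -/
lemma measure_ext_of_laplace_nnreal {μ ν : Measure (Fin p → ℝ≥0)} [IsFiniteMeasure μ]
    [IsFiniteMeasure ν] (h : ∀ t, ∫ x, expBCF t x ∂μ = ∫ x, expBCF t x ∂ν) : μ = ν := by
  refine ext_of_forall_mem_subalgebra_integral_eq_of_polish (𝕜 := ℝ) (A := expAlgebra p) ?_ ?_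
  · intro x y hxy
    obtain ⟨j, hj⟩ := Function.ne_iff.1 hxy
    refine ⟨expBCF (Pi.single j 1), ⟨(expBCF (Pi.single j 1)).toContinuousMap,
      ⟨expBCF (Pi.single j 1), Algebra.subset_adjoin ⟨_, rfl⟩, rfl⟩, rfl⟩, ?_⟩
    rw [expBCF_apply, expBCF_apply]
    intro he
    have := neg_injective (Real.exp_injective he)
    simp [Pi.single_apply, apply_ite (NNReal.toReal)] at this
    exact hj this
  · intro g hg
    have hg' : g ∈ Submodule.span ℝ (expSubmonoid p : Set ((Fin p → ℝ≥0) →ᵇ ℝ)) := by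
      have h1 : g ∈ Subalgebra.toSubmodule
        (Algebra.adjoin ℝ (expSubmonoid p : Set ((Fin p → ℝ≥0) →ᵇ ℝ))) := hg
      rwa [Algebra.adjoin_eq_span, Submonoid.closure_eq] at h1
    clear hg
    induction hg' using Submodule.span_induction with
    | mem g hg =>
      obtain ⟨t, rfl⟩ := hg
      exact h t
    | zero => simp
    | add g₁ g₂ h₁ h₂ ih₁ ih₂ =>
      simp only [BoundedContinuousFunction.add_apply]
      rw [integral_add (g₁.integrable μ) (g₂.integrable μ),
        integral_add (g₁.integrable ν) (g₂.integrable ν), ih₁, ih₂]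
    | smul c g h₁ ih =>
      simp only [BoundedContinuousFunction.smul_apply, smul_eq_mul]
      rw [integral_const_mul, integral_const_mul, ih]

/-- The exponentials are bounded only on [0, ∞)^p, so both measures are transported to that space
and back. -/
lemma measure_ext_of_laplace {μ ν : Measure (Fin p → ℝ)} [IsFiniteMeasure μ] [IsFiniteMeasure ν]
    (hμ : ∀ᵐ x ∂μ, ∀ j, 0 ≤ x j) (hν : ∀ᵐ x ∂ν, ∀ j, 0 ≤ x j)
    (h : ∀ t : Fin p → ℝ, (∀ j, 0 ≤ t j) →
      ∫ x, Real.exp (-∑ j, t j * x j) ∂μ = ∫ x, Real.exp (-∑ j, t j * x j) ∂ν) : μ = ν := by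
  set T : (Fin p → ℝ) → (Fin p → ℝ≥0) := fun x j => (x j).toNNReal with hT
  have hTm : Measurable T := by fun_prop
  have hback : ∀ {ρ : Measure (Fin p → ℝ)}, (∀ᵐ x ∂ρ, ∀ j, 0 ≤ x j) →
      (ρ.map T).map (fun (x : Fin p → ℝ≥0) (j : Fin p) => (x j : ℝ)) = ρ := by
    intro ρ hρ
    rw [Measure.map_map (by fun_prop) hTm]
    conv_rhs => rw [← Measure.map_id (μ := ρ)]
    refine Measure.map_congr ?_
    filter_upwards [hρ] with x hx
    funext j
    exact Real.coe_toNNReal _ (hx j)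
  have hint : ∀ {ρ : Measure (Fin p → ℝ)}, (∀ᵐ x ∂ρ, ∀ j, 0 ≤ x j) → ∀ t : Fin p → ℝ≥0,
      ∫ x, expBCF t x ∂(ρ.map T) = ∫ x, Real.exp (-∑ j, (t j : ℝ) * x j) ∂ρ := by
    intro ρ hρ t
    rw [integral_map hTm.aemeasurable (expBCF t).continuous.aestronglyMeasurable]
    refine integral_congr_ae ?_
    filter_upwards [hρ] with x hx
    simp only [expBCF_apply, hT]
    congr 2
    exact Finset.sum_congr rfl fun j _ => by rw [Real.coe_toNNReal _ (hx j)]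
  have : μ.map T = ν.map T := measure_ext_of_laplace_nnreal fun t => by
    rw [hint hμ, hint hν]
    exact h _ fun j => (t j).2
  rw [← hback hμ, ← hback hν, this]

lemma measurableSet_orthant : MeasurableSet (orthant p) :=
  MeasurableSet.univ_pi fun _ => measurableSet_Ioi

lemma ae_restrict_orthant : ∀ᵐ x ∂(volume : Measure (Fin p → ℝ)).restrict (orthant p), ∀ j, 0 < x j :=
  (ae_restrict_mem measurableSet_orthant).mono fun _ hx j => hx j trivial

lemma exp_neg_sum_le_one {t x : Fin p → ℝ} (ht : ∀ j, 0 ≤ t j) (hx : ∀ j, 0 ≤ x j) :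
    Real.exp (-∑ j, t j * x j) ≤ 1 := by
  rw [Real.exp_le_one_iff, neg_nonpos]
  exact Finset.sum_nonneg fun j _ => mul_nonneg (ht j) (hx j)

/-- A finite measure on `[0, ∞)^p` and an integrable function on `(0, ∞)^p` with the same Laplace
transform agree. -/
lemma measureReal_eq_setIntegral_of_laplace {μ : Measure (Fin p → ℝ)} [IsFiniteMeasure μ]
    (hμ : ∀ᵐ x ∂μ, ∀ j, 0 ≤ x j) {f : (Fin p → ℝ) → ℝ} (hf : IntegrableOn f (orthant p))
    (h : ∀ t : Fin p → ℝ, (∀ j, 0 ≤ t j) →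
      ∫ x, Real.exp (-∑ j, t j * x j) ∂μ = ∫ x in orthant p, Real.exp (-∑ j, t j * x j) * f x)
    {s : Set (Fin p → ℝ)} (hs : MeasurableSet s) :
    μ.real s = ∫ x in s ∩ orthant p, f x := by
  set vol := (volume : Measure (Fin p → ℝ)).restrict (orthant p) with hvol
  set ν₁ := vol.withDensity fun x => ENNReal.ofReal (f x) with hν₁
  set ν₂ := vol.withDensity fun x => ENNReal.ofReal (-f x) with hν₂
  have : IsFiniteMeasure ν₁ := isFiniteMeasure_withDensity_ofReal hf.2
  have : IsFiniteMeasure ν₂ := isFiniteMeasure_withDensity_ofReal hf.neg.2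
  have ha₁ : ∀ᵐ x ∂ν₁, ∀ j, 0 ≤ x j := (withDensity_absolutelyContinuous _ _).ae_le
    (ae_restrict_orthant.mono fun x hx j => (hx j).le)
  have ha₂ : ∀ᵐ x ∂ν₂, ∀ j, 0 ≤ x j := (withDensity_absolutelyContinuous _ _).ae_le
    (ae_restrict_orthant.mono fun x hx j => (hx j).le)
  have hfm : AEMeasurable f vol := hf.1.aemeasurable
  have hi₁ : ∀ g : (Fin p → ℝ) → ℝ, ∫ x, g x ∂ν₁ = ∫ x, (max (f x) 0) * g x ∂vol := fun g => by
    rw [hν₁, integral_withDensity_eq_integral_toReal_smul₀ hfm.ennreal_ofReal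
      (ae_of_all _ fun x => ENNReal.ofReal_lt_top)]
    simp [ENNReal.toReal_ofReal']
  have hi₂ : ∀ g : (Fin p → ℝ) → ℝ, ∫ x, g x ∂ν₂ = ∫ x, (max (-f x) 0) * g x ∂vol := fun g => by
    rw [hν₂, integral_withDensity_eq_integral_toReal_smul₀ 
      (show AEMeasurable (fun x => -f x) vol from hfm.neg).ennreal_ofReal
      (ae_of_all _ fun x => ENNReal.ofReal_lt_top)]
    simp [ENNReal.toReal_ofReal']
  have hp₁ : Integrable (fun x => max (f x) 0) vol := hf.pos_part
  have hp₂ : Integrable (fun x => max (-f x) 0) vol := hf.neg_part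
  have hexp : ∀ (ρ : Measure (Fin p → ℝ)), (∀ᵐ x ∂ρ, ∀ j, 0 ≤ x j) → ∀ t : Fin p → ℝ,
      (∀ j, 0 ≤ t j) → ∀ g, Integrable g ρ →
      Integrable (fun x => g x * Real.exp (-∑ j, t j * x j)) ρ := by
    intro ρ hρ t ht g hg
    refine hg.mono (hg.1.mul (Continuous.aestronglyMeasurable (by fun_prop))) ?_
    filter_upwards [hρ] with x hx
    rw [norm_mul, Real.norm_of_nonneg (Real.exp_pos _).le]
    exact mul_le_of_le_one_right (norm_nonneg _) (exp_neg_sum_le_one ht hx)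
  have hvol0 : ∀ᵐ x ∂vol, ∀ j, 0 ≤ x j := ae_restrict_orthant.mono fun x hx j => (hx j).le
  -- f may change sign. Moving its negative part to the side of μ leaves two finite positive
  -- measures to compare.
  have key : μ + ν₂ = ν₁ := by
    refine measure_ext_of_laplace (ae_add_measure_iff.2 ⟨hμ, ha₂⟩) ha₁ fun t ht => ?_
    have e₁ : Integrable (fun x : Fin p → ℝ => Real.exp (-∑ j, t j * x j)) μ := by
      simpa using hexp μ hμ t ht (fun _ => 1) (integrable_const _)
    have e₂ : Integrable (fun x : Fin p → ℝ => Real.exp (-∑ j, t j * x j)) ν₂ := by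
      simpa using hexp ν₂ ha₂ t ht (fun _ => 1) (integrable_const _)
    rw [integral_add_measure e₁ e₂, hi₁, hi₂, h t ht,
      ← integral_add ?_ (hexp vol hvol0 t ht _ hp₂)]
    · refine integral_congr_ae (ae_of_all _ fun x => ?_)
      have : f x = max (f x) 0 - max (-f x) 0 := by
        rcases le_total 0 (f x) with h0 | h0
        · rw [max_eq_left h0, max_eq_right (by linarith)]; ring
        · rw [max_eq_right h0, max_eq_left (by linarith)]; ring
      simp only []
      nth_rewrite 1 [this]
      ring
    · simp_rw [mul_comm (Real.exp _)]
      exact hexp vol hvol0 t ht _ hf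
  have h2 : (μ + ν₂).real s = ν₁.real s := by rw [key]
  rw [measureReal_add_apply] at h2
  have h3 : ν₁.real s = ∫ x in s, max (f x) 0 ∂vol := by
    have := hi₁ (s.indicator fun _ => 1)
    rw [integral_indicator_const _ hs, smul_eq_mul, mul_one] at this
    rw [this, ← integral_indicator hs]
    congr 1 with x
    by_cases hx : x ∈ s <;> simp [hx]
  have h4 : ν₂.real s = ∫ x in s, max (-f x) 0 ∂vol := by
    have := hi₂ (s.indicator fun _ => 1)
    rw [integral_indicator_const _ hs, smul_eq_mul, mul_one] at this
    rw [this, ← integral_indicator hs]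
    congr 1 with x
    by_cases hx : x ∈ s <;> simp [hx]
  have h5 : μ.real s = ν₁.real s - ν₂.real s := by linarith
  rw [h5, h3, h4, ← integral_sub hp₁.integrableOn hp₂.integrableOn, ← Measure.restrict_restrict hs]
  refine integral_congr_ae (ae_of_all _ fun x => ?_)
  rcases le_total 0 (f x) with h0 | h0
  · simp only [max_eq_left h0, max_eq_right (neg_nonpos.2 h0)]; ring
  · simp only [max_eq_right h0, max_eq_left (neg_nonneg.2 h0)]; ring

lemma ae_eq_zero_of_laplace {f : (Fin p → ℝ) → ℝ} (hf : IntegrableOn f (orthant p))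
    (h : ∀ t : Fin p → ℝ, (∀ j, 0 ≤ t j) →
      ∫ x in orthant p, Real.exp (-∑ j, t j * x j) * f x = 0) :
    f =ᵐ[volume.restrict (orthant p)] 0 := by
  refine Integrable.ae_eq_zero_of_forall_setIntegral_eq_zero hf fun s hs _ => ?_
  have := measureReal_eq_setIntegral_of_laplace (μ := 0) (by simp) hf
    (fun t ht => by rw [h t ht]; simp) hs
  rw [Measure.restrict_restrict hs, ← this]
  simp

/-- Uniqueness of the Laplace transform near infinity, for complex functions. -/
lemma ae_eq_of_laplace_of_ge {f g : (Fin p → ℝ) → ℂ} {τ : ℝ}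
    (hf : IntegrableOn (fun x => (Real.exp (-∑ j, τ * x j) : ℂ) * f x) (orthant p))
    (hg : IntegrableOn (fun x => (Real.exp (-∑ j, τ * x j) : ℂ) * g x) (orthant p))
    (h : ∀ t : Fin p → ℝ, (∀ j, τ ≤ t j) →
      ∫ x in orthant p, (Real.exp (-∑ j, t j * x j) : ℂ) * f x
        = ∫ x in orthant p, (Real.exp (-∑ j, t j * x j) : ℂ) * g x) :
    f =ᵐ[volume.restrict (orthant p)] g := by
  -- The factor exp(-τ ∑ x_j) makes the difference integrable and turns the range t_j ≥ τ into t_j ≥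
  -- 0.
  set F : (Fin p → ℝ) → ℂ := fun x => (Real.exp (-∑ j, τ * x j) : ℂ) * (f x - g x) with hF
  have hFi : IntegrableOn F (orthant p) := by
    refine (hf.sub hg).congr (ae_of_all _ fun x => ?_)
    simp only [hF, Pi.sub_apply]
    ring
  have hmul : ∀ (t : Fin p → ℝ), (∀ j, 0 ≤ t j) → ∀ {G : (Fin p → ℝ) → ℂ},
      IntegrableOn G (orthant p) →
      IntegrableOn (fun x => (Real.exp (-∑ j, t j * x j) : ℂ) * G x) (orthant p) := by
    intro t ht G hG
    refine Integrable.mono hG (AEStronglyMeasurable.mul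
      (Continuous.aestronglyMeasurable (by fun_prop)) hG.1) ?_
    filter_upwards [ae_restrict_orthant] with x hx
    rw [norm_mul, Complex.norm_of_nonneg (Real.exp_pos _).le]
    exact mul_le_of_le_one_left (norm_nonneg _) (exp_neg_sum_le_one ht fun j => (hx j).le)
  have hadd : ∀ (t x : Fin p → ℝ) (c : ℂ), (Real.exp (-∑ j, t j * x j) : ℂ) *
      ((Real.exp (-∑ j, τ * x j) : ℂ) * c) = (Real.exp (-∑ j, (t j + τ) * x j) : ℂ) * c := by
    intro t x c
    rw [← mul_assoc, ← Complex.ofReal_mul, ← Real.exp_add, ← neg_add, ← Finset.sum_add_distrib]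
    simp_rw [add_mul]
  have h0 : ∀ t : Fin p → ℝ, (∀ j, 0 ≤ t j) →
      ∫ x in orthant p, (Real.exp (-∑ j, t j * x j) : ℂ) * F x = 0 := by
    intro t ht
    have e := h (fun j => t j + τ) fun j => by linarith [ht j]
    have i₁ := hmul t ht hf
    have i₂ := hmul t ht hg
    simp_rw [hadd] at i₁ i₂
    rw [← sub_eq_zero, ← integral_sub i₁ i₂] at e
    rw [← e]
    refine integral_congr_ae (ae_of_all _ fun x => ?_)
    simp only [hF, hadd]
    ring
  have hre := ae_eq_zero_of_laplace hFi.re fun t ht => by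
    have := congrArg Complex.re (h0 t ht)
    rw [Complex.zero_re, ← RCLike.re_eq_complex_re, ← integral_re (hmul t ht hFi)] at this
    simp only [RCLike.re_eq_complex_re, Complex.re_ofReal_mul] at this
    exact this
  have him := ae_eq_zero_of_laplace hFi.im fun t ht => by
    have := congrArg Complex.im (h0 t ht)
    rw [Complex.zero_im, ← RCLike.im_eq_complex_im, ← integral_im (hmul t ht hFi)] at this
    simp only [RCLike.im_eq_complex_im, Complex.im_ofReal_mul] at this
    exact this
  filter_upwards [hre, him] with x h1 h2
  have hFx : F x = 0 := Complex.ext h1 h2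
  have : (Real.exp (-∑ j, τ * x j) : ℂ) ≠ 0 := by exact_mod_cast (Real.exp_pos _).ne'
  exact sub_eq_zero.1 ((mul_eq_zero.1 hFx).resolve_left this)

end Uniqueness


/-! ### Mixtures of products of generating series -/

lemma setIntegral_exp_mul_gSeries {a v t : ℝ} (ha : 0 < a) (hv : 0 < v) (ht : 0 ≤ t) {y : ℂ}
    (hy : ‖y‖ < 1 + t / v) :
    ∫ ξ in Set.Ioi (0 : ℝ), (Real.exp (-(t * ξ)) : ℂ) * (v * gSeries a (v * ξ) y)
      = (((1 + t / v)⁻¹ ^ a : ℝ) : ℂ) * (1 - ((1 + t / v)⁻¹ : ℝ) * y)⁻¹ := by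
  have h := integral_exp_mul_gSeries ha (div_nonneg ht hv.le) hy
  rw [← h]
  have h2 := integral_comp_mul_left_Ioi
    (fun ξ : ℝ => Complex.exp (-((t / v * ξ : ℝ) : ℂ)) * gSeries a ξ y) 0 hv
  rw [mul_zero] at h2
  have h3 : ∀ ξ : ℝ, (Real.exp (-(t * ξ)) : ℂ) * (v * gSeries a (v * ξ) y)
      = v * (Complex.exp (-((t / v * (v * ξ) : ℝ) : ℂ)) * gSeries a (v * ξ) y) := fun ξ => by
    rw [show t / v * (v * ξ) = t * ξ by field_simp]
    push_cast
    ring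
  simp_rw [h3]
  rw [integral_const_mul, h2, Complex.real_smul]
  have : (v : ℂ) ≠ 0 := by exact_mod_cast hv.ne'
  push_cast
  field_simp

lemma integrableOn_exp_mul_gSeriesReal_scaled {a v t ρ : ℝ} (ha : 0 < a) (hv : 0 < v)
    (ht : 0 ≤ t) (hρ : 0 ≤ ρ) (hρt : ρ < 1 + t / v) :
    IntegrableOn (fun ξ => Real.exp (-(t * ξ)) * gSeriesReal a (v * ξ) ρ) (Set.Ioi 0) := by
  have h := integrableOn_exp_mul_gSeriesReal ha (div_nonneg ht hv.le) hρ hρt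
  have h2 := (integrableOn_Ioi_comp_mul_left_iff
    (fun ξ : ℝ => Real.exp (-(t / v * ξ)) * gSeriesReal a ξ ρ) 0 hv).2 (by rwa [mul_zero])
  refine h2.congr_fun (fun ξ _ => ?_) measurableSet_Ioi
  simp only []
  rw [show t / v * (v * ξ) = t * ξ by field_simp]

lemma setIntegral_indicator_mul_gSeries {a v x : ℝ} (ha : 0 < a) (hv : 0 < v) (hx : 0 ≤ x)
    (y : ℂ) :
    ∫ ξ in Set.Ioi (0 : ℝ), (((Set.Ioc 0 x).indicator 1 ξ : ℝ) : ℂ) * (v * gSeries a (v * ξ) y)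
      = genB a (v * x) y := by
  have h1 : ∀ ξ : ℝ, (((Set.Ioc 0 x).indicator 1 ξ : ℝ) : ℂ) * (v * gSeries a (v * ξ) y)
      = (Set.Ioc 0 x).indicator (fun ξ => v * gSeries a (v * ξ) y) ξ := fun ξ => by
    by_cases h : ξ ∈ Set.Ioc 0 x <;> simp [h]
  simp_rw [h1]
  rw [setIntegral_indicator measurableSet_Ioc,
    Set.inter_eq_self_of_subset_right Set.Ioc_subset_Ioi_self, integral_const_mul,
    ← intervalIntegral.integral_of_le hx,
    intervalIntegral.integral_comp_mul_left (fun ξ => gSeries a ξ y) hv.ne', mul_zero,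
    intervalIntegral.integral_of_le (by positivity), integral_gSeries_Ioc ha (by positivity),
    Complex.real_smul]
  have : (v : ℂ) ≠ 0 := by exact_mod_cast hv.ne'
  push_cast
  field_simp

/-- A mixture of products of generating series over a torus. -/
def mixDensity {p : ℕ} (a v r : ℝ) (c h : ℂ → ℂ) (K : (Fin p → ℂ) → ℂ) (x : Fin p → ℝ) : ℂ :=
  ∫ φ in cube p, K (circ r φ) *
    ∏ j, (c (circ r φ j) * (v * gSeries a (v * x j) (h (circ r φ j))))

lemma restrict_orthant (p : ℕ) : (volume : Measure (Fin p → ℝ)).restrict (orthant p)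
    = Measure.pi fun _ => volume.restrict (Set.Ioi 0) := by
  rw [orthant, volume_pi, Measure.restrict_pi_pi]

lemma continuous_comp_circ {p : ℕ} {r : ℝ} (hr : 0 < r) {c : ℂ → ℂ}
    (hc : ContinuousOn c (Metric.sphere 0 r)) (j : Fin p) :
    Continuous fun φ : Fin p → ℝ => c (circ r φ j) :=
  hc.comp_continuous ((continuous_apply j).comp (continuous_circ r)) fun φ => by
    rw [mem_sphere_zero_iff_norm, norm_circ hr]

section Mixture

variable {p : ℕ} {a v r ρ : ℝ} {c h : ℂ → ℂ} {K : (Fin p → ℂ) → ℂ}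

/-- The continuous factors c and K are bounded on compact sets, and the series at h(y) is dominated
by its value at ρ. The majorant is a product of integrable one-variable functions, constant in φ. -/
lemma integrable_mixture (ha : 0 < a) (hv : 0 < v) (hr : 0 < r)
    (hc : ContinuousOn c (Metric.sphere 0 r)) (hh : ContinuousOn h (Metric.sphere 0 r))
    (hρ : ∀ y, ‖y‖ = r → ‖h y‖ ≤ ρ) (hK : Continuous fun φ : Fin p → ℝ => K (circ r φ))
    {ω : Fin p → ℝ → ℝ} (hω : ∀ j, Measurable (ω j)) (hω0 : ∀ j ξ, 0 ≤ ω j ξ)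
    (hωi : ∀ j, IntegrableOn (fun ξ => ω j ξ * gSeriesReal a (v * ξ) ρ) (Set.Ioi 0)) :
    Integrable (fun q : (Fin p → ℝ) × (Fin p → ℝ) => (∏ j, (ω j (q.1 j) : ℂ)) *
        (K (circ r q.2) *
          ∏ j, (c (circ r q.2 j) * (v * gSeries a (v * q.1 j) (h (circ r q.2 j))))))
      ((volume.restrict (orthant p)).prod (volume.restrict (cube p))) := by
  have hρ0 : 0 ≤ ρ := (norm_nonneg _).trans (hρ r (by simp [hr.le]))
  obtain ⟨C, hC⟩ := (isCompact_sphere (0 : ℂ) r).exists_bound_of_continuousOn hc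
  have hC0 : 0 ≤ C := (norm_nonneg _).trans (hC r (by simp [hr.le]))
  obtain ⟨L, hL⟩ := (isCompact_univ_pi fun _ : Fin p =>
    (isCompact_Icc : IsCompact (Set.Icc (-Real.pi) Real.pi))).exists_bound_of_continuousOn
      hK.continuousOn
  have hdom : Integrable (fun q : (Fin p → ℝ) × (Fin p → ℝ) =>
      (∏ j, (ω j (q.1 j) * gSeriesReal a (v * q.1 j) ρ)) * (L * (C * v) ^ p))
      ((volume.restrict (orthant p)).prod (volume.restrict (cube p))) := by
    refine Integrable.mul_prod (f := fun x : Fin p → ℝ =>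
      ∏ j, (ω j (x j) * gSeriesReal a (v * x j) ρ)) (g := fun _ => L * (C * v) ^ p) ?_
      (integrable_const _)
    rw [restrict_orthant]
    exact Integrable.fintype_prod (f := fun j ξ => ω j ξ * gSeriesReal a (v * ξ) ρ) hωi
  refine hdom.mono' (Measurable.aestronglyMeasurable ?_) ?_
  · refine Measurable.mul (Finset.measurable_fun_prod _ fun j _ => ?_) (Measurable.mul
      (hK.measurable.comp measurable_snd) (Finset.measurable_fun_prod _ fun j _ => ?_))
    · exact Complex.measurable_ofReal.comp
        ((hω j).comp ((measurable_pi_apply j).comp measurable_fst))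
    · refine Measurable.mul ((continuous_comp_circ hr hc j).measurable.comp measurable_snd)
        (measurable_const.mul (measurable_gSeries_comp ha ?_
          ((continuous_comp_circ hr hh j).measurable.comp measurable_snd)))
      exact measurable_const.mul ((measurable_pi_apply j).comp measurable_fst)
  · have : ∀ᵐ q ∂((volume : Measure (Fin p → ℝ)).restrict (orthant p)).prod
        ((volume : Measure (Fin p → ℝ)).restrict (cube p)), q.2 ∈ cube p :=
      Measure.quasiMeasurePreserving_snd.ae
        (ae_restrict_mem (MeasurableSet.univ_pi fun _ => measurableSet_Ioc))
    filter_upwards [this] with q hq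
    have hq' : ‖K (circ r q.2)‖ ≤ L :=
      hL _ (Set.pi_mono (fun _ _ => Set.Ioc_subset_Icc_self) hq)
    have hL0 : 0 ≤ L := (norm_nonneg _).trans hq'
    rw [norm_mul, norm_mul, norm_prod, norm_prod, Finset.prod_mul_distrib, mul_assoc]
    have e1 : ∏ j, ‖(ω j (q.1 j) : ℂ)‖ = ∏ j, ω j (q.1 j) :=
      Finset.prod_congr rfl fun j _ => Complex.norm_of_nonneg (hω0 j _)
    rw [e1]
    refine mul_le_mul_of_nonneg_left ?_ (Finset.prod_nonneg fun j _ => hω0 j _)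
    have e2 : ∏ j, ‖c (circ r q.2 j) * (v * gSeries a (v * q.1 j) (h (circ r q.2 j)))‖
        ≤ ∏ j : Fin p, ((C * v) * gSeriesReal a (v * q.1 j) ρ) := by
      refine Finset.prod_le_prod (fun j _ => norm_nonneg _) fun j _ => ?_
      rw [norm_mul, norm_mul, Complex.norm_of_nonneg hv.le, ← mul_assoc]
      have h1 := hC (circ r q.2 j) (by rw [mem_sphere_zero_iff_norm, norm_circ hr])
      have h2 := norm_gSeries_le ha (v * q.1 j) (hρ (circ r q.2 j) (norm_circ hr _ _))
      exact mul_le_mul (mul_le_mul_of_nonneg_right h1 hv.le) h2 (norm_nonneg _) (by positivity)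
    rw [Finset.prod_mul_distrib, Finset.prod_const, Finset.card_univ, Fintype.card_fin] at e2
    calc _ ≤ L * ((C * v) ^ p * ∏ j, gSeriesReal a (v * q.1 j) ρ) :=
          mul_le_mul hq' e2 (Finset.prod_nonneg fun _ _ => norm_nonneg _) hL0
      _ = _ := by ring

/-- Fubini's theorem for a mixture tested against a product of weights. -/
lemma mixture_fubini (ha : 0 < a) (hv : 0 < v) (hr : 0 < r)
    (hc : ContinuousOn c (Metric.sphere 0 r)) (hh : ContinuousOn h (Metric.sphere 0 r))
    (hρ : ∀ y, ‖y‖ = r → ‖h y‖ ≤ ρ) (hK : Continuous fun φ : Fin p → ℝ => K (circ r φ))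
    {ω : Fin p → ℝ → ℝ} (hω : ∀ j, Measurable (ω j)) (hω0 : ∀ j ξ, 0 ≤ ω j ξ)
    (hωi : ∀ j, IntegrableOn (fun ξ => ω j ξ * gSeriesReal a (v * ξ) ρ) (Set.Ioi 0))
    {I : Fin p → ℂ → ℂ} (hI : ∀ j y, ‖y‖ = r →
      ∫ ξ in Set.Ioi (0 : ℝ), (ω j ξ : ℂ) * (v * gSeries a (v * ξ) (h y)) = I j y) :
    IntegrableOn (fun x => (∏ j, (ω j (x j) : ℂ)) * mixDensity a v r c h K x) (orthant p) ∧
    IntegrableOn (fun φ => K (circ r φ) * ∏ j, (c (circ r φ j) * I j (circ r φ j))) (cube p) ∧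
    ∫ x in orthant p, (∏ j, (ω j (x j) : ℂ)) * mixDensity a v r c h K x
      = ∫ φ in cube p, K (circ r φ) * ∏ j, (c (circ r φ j) * I j (circ r φ j)) := by
  have hint := integrable_mixture ha hv hr hc hh hρ hK hω hω0 hωi
  have e1 : ∀ x : Fin p → ℝ, ∫ φ in cube p, (∏ j, (ω j (x j) : ℂ)) * (K (circ r φ) *
      ∏ j, (c (circ r φ j) * (v * gSeries a (v * x j) (h (circ r φ j)))))
      = (∏ j, (ω j (x j) : ℂ)) * mixDensity a v r c h K x := fun x => by
    rw [integral_const_mul, mixDensity]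
  have e2 : ∀ φ : Fin p → ℝ, ∫ x in orthant p, (∏ j, (ω j (x j) : ℂ)) * (K (circ r φ) *
      ∏ j, (c (circ r φ j) * (v * gSeries a (v * x j) (h (circ r φ j)))))
      = K (circ r φ) * ∏ j, (c (circ r φ j) * I j (circ r φ j)) := fun φ => by
    have : ∀ x : Fin p → ℝ, (∏ j, (ω j (x j) : ℂ)) * (K (circ r φ) *
        ∏ j, (c (circ r φ j) * (v * gSeries a (v * x j) (h (circ r φ j)))))
        = K (circ r φ) * ∏ j, (c (circ r φ j) *
          ((ω j (x j) : ℂ) * (v * gSeries a (v * x j) (h (circ r φ j))))) := fun x => by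
      simp only [Finset.prod_mul_distrib]
      ring
    simp_rw [this]
    rw [integral_const_mul, restrict_orthant, integral_fintype_prod_eq_prod
      (fun j ξ => c (circ r φ j) * ((ω j ξ : ℂ) * (v * gSeries a (v * ξ) (h (circ r φ j)))))]
    congr 1
    refine Finset.prod_congr rfl fun j _ => ?_
    rw [integral_const_mul, hI j _ (norm_circ hr φ j)]
  refine ⟨?_, ?_, ?_⟩
  · exact hint.integral_prod_left.congr (ae_of_all _ e1)
  · exact hint.integral_prod_right.congr (ae_of_all _ e2)
  · have := integral_integral_swap (f := fun x φ : Fin p → ℝ => (∏ j, (ω j (x j) : ℂ)) *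
      (K (circ r φ) * ∏ j, (c (circ r φ j) * (v * gSeries a (v * x j) (h (circ r φ j)))))) hint
    simp_rw [e1, e2] at this
    exact this

lemma ofReal_exp_neg_sum (t x : Fin p → ℝ) :
    (Real.exp (-∑ j, t j * x j) : ℂ) = ∏ j, (Real.exp (-(t j * x j)) : ℂ) := by
  rw [← Complex.ofReal_prod, ← Real.exp_sum, Finset.sum_neg_distrib]

/-- The Laplace transform of a mixture. -/
lemma mixture_laplace (ha : 0 < a) (hv : 0 < v) (hr : 0 < r)
    (hc : ContinuousOn c (Metric.sphere 0 r)) (hh : ContinuousOn h (Metric.sphere 0 r))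
    (hρ : ∀ y, ‖y‖ = r → ‖h y‖ ≤ ρ) (hK : Continuous fun φ : Fin p → ℝ => K (circ r φ))
    {t : Fin p → ℝ} (ht : ∀ j, 0 ≤ t j) (htρ : ∀ j, ρ < 1 + t j / v) :
    IntegrableOn (fun x => (Real.exp (-∑ j, t j * x j) : ℂ) * mixDensity a v r c h K x)
      (orthant p) ∧
    ∫ x in orthant p, (Real.exp (-∑ j, t j * x j) : ℂ) * mixDensity a v r c h K x
      = ∫ φ in cube p, K (circ r φ) * ∏ j, (c (circ r φ j) *
        ((((1 + t j / v)⁻¹ ^ a : ℝ) : ℂ) *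
          (1 - ((1 + t j / v)⁻¹ : ℝ) * h (circ r φ j))⁻¹)) := by
  have hρ0 : 0 ≤ ρ := (norm_nonneg _).trans (hρ r (by simp [hr.le]))
  obtain ⟨h1, -, h3⟩ := mixture_fubini ha hv hr hc hh hρ hK
    (ω := fun j ξ => Real.exp (-(t j * ξ))) (fun j => by fun_prop) (fun j ξ => (Real.exp_pos _).le)
    (fun j => integrableOn_exp_mul_gSeriesReal_scaled ha hv (ht j) hρ0 (htρ j))
    (I := fun j y => (((1 + t j / v)⁻¹ ^ a : ℝ) : ℂ) * (1 - ((1 + t j / v)⁻¹ : ℝ) * h y)⁻¹)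
    (fun j y hy => setIntegral_exp_mul_gSeries ha hv (ht j) ((hρ y hy).trans_lt (htρ j)))
  simp_rw [ofReal_exp_neg_sum]
  exact ⟨h1, h3⟩

/-- The integral of a mixture over a box. -/
lemma mixture_box (ha : 0 < a) (hv : 0 < v) (hr : 0 < r)
    (hc : ContinuousOn c (Metric.sphere 0 r)) (hh : ContinuousOn h (Metric.sphere 0 r))
    (hρ : ∀ y, ‖y‖ = r → ‖h y‖ ≤ ρ) (hK : Continuous fun φ : Fin p → ℝ => K (circ r φ))
    {x : Fin p → ℝ} (hx : ∀ j, 0 ≤ x j) :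
    IntegrableOn (fun φ => K (circ r φ) *
      ∏ j, (c (circ r φ j) * genB a (v * x j) (h (circ r φ j)))) (cube p) ∧
    ∫ ξ in Set.univ.pi (fun j => Set.Ioc 0 (x j)), mixDensity a v r c h K ξ
      = ∫ φ in cube p, K (circ r φ) *
        ∏ j, (c (circ r φ j) * genB a (v * x j) (h (circ r φ j))) := by
  have hρ0 : 0 ≤ ρ := (norm_nonneg _).trans (hρ r (by simp [hr.le]))
  have hωi : ∀ j, IntegrableOn (fun ξ => (Set.Ioc 0 (x j)).indicator (1 : ℝ → ℝ) ξ *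
      gSeriesReal a (v * ξ) ρ) (Set.Ioi 0) := by
    intro j
    have e : (fun ξ => (Set.Ioc 0 (x j)).indicator (1 : ℝ → ℝ) ξ * gSeriesReal a (v * ξ) ρ)
        -- On the bounded interval the factor exp(vρξ) is bounded. The tilt t = vρ is admissible,
        -- since ρ < 1 + t/v = 1 + ρ.
        = fun ξ => ((Set.Ioc 0 (x j)).indicator (1 : ℝ → ℝ) ξ * Real.exp (v * ρ * ξ)) *
          (Real.exp (-(v * ρ * ξ)) * gSeriesReal a (v * ξ) ρ) := by
      funext ξ
      rw [mul_assoc, ← mul_assoc (Real.exp _), ← Real.exp_add]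
      simp
    rw [e]
    refine Integrable.bdd_mul (c := Real.exp (v * ρ * x j))
      (integrableOn_exp_mul_gSeriesReal_scaled (t := v * ρ) ha hv (by positivity) hρ0
      (by rw [mul_div_cancel_left₀ _ hv.ne']; linarith))
      (Measurable.aestronglyMeasurable ((measurable_one.indicator measurableSet_Ioc).mul
        (by fun_prop))) (ae_of_all _ fun ξ => ?_)
    by_cases h : ξ ∈ Set.Ioc 0 (x j)
    · simp only [Set.indicator_of_mem h, Pi.one_apply, one_mul, Real.norm_eq_abs, Real.abs_exp]
      exact Real.exp_le_exp.2 (mul_le_mul_of_nonneg_left h.2 (by positivity))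
    · simp only [Set.indicator_of_notMem h, zero_mul, norm_zero]
      exact (Real.exp_pos _).le
  obtain ⟨-, h2, h3⟩ := mixture_fubini ha hv hr hc hh hρ hK
    (ω := fun j ξ => (Set.Ioc 0 (x j)).indicator (1 : ℝ → ℝ) ξ)
    (fun j => measurable_one.indicator measurableSet_Ioc)
    (fun j ξ => Set.indicator_nonneg (fun _ _ => zero_le_one) ξ) hωi
    (I := fun j y => genB a (v * x j) (h y))
    (fun j y _ => setIntegral_indicator_mul_gSeries ha hv (hx j) (h y))
  refine ⟨h2, h3 ▸ ?_⟩
  have hbox : MeasurableSet (Set.univ.pi fun j => Set.Ioc 0 (x j)) :=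
    MeasurableSet.univ_pi fun _ => measurableSet_Ioc
  have hsub : (Set.univ.pi fun j => Set.Ioc 0 (x j)) ⊆ orthant p :=
    Set.pi_mono fun _ _ => Set.Ioc_subset_Ioi_self
  have e : ∀ ξ : Fin p → ℝ, (∏ j, (((Set.Ioc 0 (x j)).indicator (1 : ℝ → ℝ) (ξ j) : ℝ) : ℂ)) *
      mixDensity a v r c h K ξ
      = (Set.univ.pi fun j => Set.Ioc 0 (x j)).indicator (mixDensity a v r c h K) ξ := by
    intro ξ
    by_cases hξ : ξ ∈ Set.univ.pi fun j => Set.Ioc 0 (x j)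
    · rw [Set.indicator_of_mem hξ, Finset.prod_eq_one, one_mul]
      intro j _
      rw [Set.indicator_of_mem (hξ j trivial)]
      simp
    · rw [Set.indicator_of_notMem hξ]
      have : ∃ j, ξ j ∉ Set.Ioc 0 (x j) := by
        by_contra! hcon
        exact hξ fun j _ => hcon j
      obtain ⟨j, hj⟩ := this
      rw [Finset.prod_eq_zero (Finset.mem_univ j) (by rw [Set.indicator_of_notMem hj]; simp),
        zero_mul]
  simp_rw [e]
  rw [setIntegral_indicator hbox, Set.inter_eq_self_of_subset_right hsub]

end Mixture


/-! ### The conditions on the scale factor -/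

section SpectralNorm

variable {p : ℕ}

lemma specNorm_nonneg (M : Matrix (Fin p) (Fin p) ℝ) : 0 ≤ specNorm M := norm_nonneg _

/-- The norm is attained on the compact unit sphere, so the strict pointwise inequality survives.
The sphere is empty when p = 0. -/
lemma specNorm_lt_one {M : Matrix (Fin p) (Fin p) ℝ}
    (h : ∀ x : EuclideanSpace ℝ (Fin p), x ≠ 0 → ‖Matrix.toEuclideanCLM (𝕜 := ℝ) M x‖ < ‖x‖) :
    specNorm M < 1 := by
  rcases (Metric.sphere (0 : EuclideanSpace ℝ (Fin p)) 1).eq_empty_or_nonempty with he | hne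
  · refine (ContinuousLinearMap.opNorm_le_of_unit_norm le_rfl fun x hx => ?_).trans_lt one_pos
    have : x ∈ Metric.sphere (0 : EuclideanSpace ℝ (Fin p)) 1 := by simpa using hx
    rw [he] at this
    exact this.elim
  · obtain ⟨x₀, hx₀, hmax⟩ := (isCompact_sphere (0 : EuclideanSpace ℝ (Fin p)) 1).exists_isMaxOn hne
      ((Matrix.toEuclideanCLM (𝕜 := ℝ) M).continuous.norm.continuousOn)
    have hx₀' : ‖x₀‖ = 1 := by simpa using hx₀
    refine (ContinuousLinearMap.opNorm_le_of_unit_norm (norm_nonneg _) fun x hx =>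
      hmax (show x ∈ Metric.sphere 0 1 by simpa using hx)).trans_lt ?_
    rw [← hx₀']
    refine h x₀ fun h0 => ?_
    rw [h0, norm_zero] at hx₀'
    exact zero_ne_one hx₀'

lemma inner_toEuclideanCLM (M : Matrix (Fin p) (Fin p) ℝ) (x y : EuclideanSpace ℝ (Fin p)) :
    inner ℝ x (Matrix.toEuclideanCLM (𝕜 := ℝ) M y) = x.ofLp ⬝ᵥ M.mulVec y.ofLp := by
  rw [EuclideanSpace.inner_eq_star_dotProduct, Matrix.ofLp_toEuclideanCLM, dotProduct_comm]
  rfl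

lemma inner_toEuclideanCLM_comm {M : Matrix (Fin p) (Fin p) ℝ} (hM : M.IsHermitian)
    (x y : EuclideanSpace ℝ (Fin p)) :
    inner ℝ x (Matrix.toEuclideanCLM (𝕜 := ℝ) M y)
      = inner ℝ (Matrix.toEuclideanCLM (𝕜 := ℝ) M x) y := by
  rw [real_inner_comm, real_inner_comm y, inner_toEuclideanCLM, real_inner_comm,
    inner_toEuclideanCLM, Matrix.dotProduct_mulVec, ← Matrix.mulVec_transpose]
  have h : M.IsSymm := by simpa using hM
  have : M.transpose = M := h
  rw [this, dotProduct_comm]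

lemma inner_toEuclideanCLM_pos {S : Matrix (Fin p) (Fin p) ℝ} (hS : S.PosDef)
    {x : EuclideanSpace ℝ (Fin p)} (hx : x ≠ 0) :
    0 < inner ℝ x (Matrix.toEuclideanCLM (𝕜 := ℝ) S x) := by
  rw [inner_toEuclideanCLM]
  have := hS.dotProduct_mulVec_pos (x := x.ofLp) (fun h => hx (by ext i; exact congrFun h i))
  simpa using this

/-- With A the operator of S, ‖vAx - x‖² < ‖x‖² amounts to v‖Ax‖² < 2⟨x, Ax⟩. Positivity of A at x -
(v/2)Ax, with ⟨Ax, A²x⟩ ≤ ‖A‖‖Ax‖², gives ⟨x, Ax⟩ ≥ v‖Ax‖²(1 - v‖A‖/4), which suffices as v‖A‖ < 2.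
-/
lemma specNorm_matBA_lt {S : Matrix (Fin p) (Fin p) ℝ} (hS : S.PosDef) {v : ℝ} (hv : 0 < v)
    (h : v * specNorm S < 2) : specNorm (matBA v S) < 1 := by
  refine specNorm_lt_one fun x hx => ?_
  set A := Matrix.toEuclideanCLM (𝕜 := ℝ) S with hA
  have e : Matrix.toEuclideanCLM (𝕜 := ℝ) (matBA v S) x = v • A x - x := by
    simp [matBA, hA, map_sub, map_smul, map_one]
  have hq := inner_toEuclideanCLM_pos hS hx
  rw [← hA] at hq
  have hAx : 0 < ‖A x‖ := by
    rw [norm_pos_iff]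
    intro h0
    rw [h0, inner_zero_right] at hq
    exact lt_irrefl _ hq
  have h1 : inner ℝ (A x) (A (A x)) ≤ specNorm S * ‖A x‖ ^ 2 := by
    calc _ ≤ ‖A x‖ * ‖A (A x)‖ := real_inner_le_norm _ _
      _ ≤ ‖A x‖ * (specNorm S * ‖A x‖) :=
        mul_le_mul_of_nonneg_left (A.le_opNorm (A x)) (norm_nonneg _)
      _ = _ := by ring
  have h2 : 0 ≤ inner ℝ (x - (v / 2) • A x) (A (x - (v / 2) • A x)) := by
    rcases eq_or_ne (x - (v / 2) • A x) 0 with h0 | h0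
    · simp [h0]
    · exact (inner_toEuclideanCLM_pos hS h0).le
  have h3 : inner ℝ (A x) (A x) = ‖A x‖ ^ 2 := real_inner_self_eq_norm_sq _
  have h4 : inner ℝ x (A (A x)) = ‖A x‖ ^ 2 := by
    rw [inner_toEuclideanCLM_comm hS.isHermitian, ← hA, h3]
  rw [map_sub, map_smul, inner_sub_left, inner_sub_right, inner_sub_right, inner_smul_left,
    inner_smul_right, inner_smul_right, inner_smul_left, h3, h4] at h2
  simp only [conj_trivial] at h2
  rw [e]
  refine lt_of_pow_lt_pow_left₀ 2 (norm_nonneg _) ?_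
  rw [norm_sub_sq_real, norm_smul, inner_smul_left, real_inner_comm]
  simp only [conj_trivial, Real.norm_eq_abs, abs_of_pos hv]
  have h5 : 0 < ‖A x‖ ^ 2 := by positivity
  nlinarith [mul_le_mul_of_nonneg_left h1 (by positivity : 0 ≤ v / 2 * (v / 2)),
    mul_lt_mul_of_pos_right h h5, mul_pos hv h5, mul_lt_mul_of_pos_left
      (mul_lt_mul_of_pos_right h h5) hv]

lemma matBB_eq {S : Matrix (Fin p) (Fin p) ℝ} (hS : S.PosDef) {v : ℝ} (hv : 0 < v) :
    matBB v S = matBA v⁻¹ S⁻¹ := by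
  have : Invertible v := invertibleOfNonzero hv.ne'
  rw [matBB, matBA, Matrix.inv_smul _ v (isUnit_iff_ne_zero.2 hS.det_pos.ne'), invOf_eq_inv]

lemma posDef_one_add_smul {S : Matrix (Fin p) (Fin p) ℝ} (hS : S.PosDef) {v : ℝ} (hv : 0 < v) :
    (1 + v • S).PosDef :=
  Matrix.PosDef.one.add (hS.smul hv)

/-- B is a Cayley transform: if x = y + vAy then Bx = y - vAy, and ⟨y, Ay⟩ > 0 makes the latter
strictly shorter. -/
lemma specNorm_matBC_lt {S : Matrix (Fin p) (Fin p) ℝ} (hS : S.PosDef) {v : ℝ} (hv : 0 < v) :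
    specNorm (matBC v S) < 1 := by
  refine specNorm_lt_one fun x hx => ?_
  set A := Matrix.toEuclideanCLM (𝕜 := ℝ) S with hA
  set y := Matrix.toEuclideanCLM (𝕜 := ℝ) (1 + v • S)⁻¹ x with hy
  have hxy : x = y + v • A y := by
    have h1 : (1 + v • S) * (1 + v • S)⁻¹ = 1 :=
      Matrix.mul_nonsing_inv _ (isUnit_iff_ne_zero.2 (posDef_one_add_smul hS hv).det_pos.ne')
    have h2 : Matrix.toEuclideanCLM (𝕜 := ℝ) ((1 + v • S) * (1 + v • S)⁻¹) x = x := by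
      rw [h1, map_one]; rfl
    rw [map_mul, map_add, map_one, map_smul] at h2
    exact h2.symm
  have hy0 : y ≠ 0 := by
    intro h0
    rw [h0, map_zero, smul_zero, add_zero] at hxy
    exact hx hxy
  have hq := inner_toEuclideanCLM_pos hS hy0
  rw [← hA] at hq
  have e : Matrix.toEuclideanCLM (𝕜 := ℝ) (matBC v S) x = y - v • A y := by
    rw [matBC, map_sub, map_smul, map_one]
    change (2 : ℝ) • y - x = _
    conv_lhs => rw [hxy]
    rw [two_smul]
    abel
  rw [e]
  conv_rhs => rw [hxy]
  refine lt_of_pow_lt_pow_left₀ 2 (norm_nonneg _) ?_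
  rw [norm_sub_sq_real, norm_add_sq_real, inner_smul_right]
  nlinarith [mul_pos hv hq]

lemma specNorm_conditions {n : ℕ} {S : Fin n → Matrix (Fin p) (Fin p) ℝ} (hS : ∀ k, (S k).PosDef)
    {v : ℝ} (hv : 0 < v) :
    (v < 2 * (⨆ k, specNorm (S k))⁻¹ → ∀ k, specNorm (matBA v (S k)) < 1) ∧
    (1 / 2 * (⨆ k, specNorm ((S k)⁻¹)) < v → ∀ k, specNorm (matBB v (S k)) < 1) ∧
    (∀ k, specNorm (matBC v (S k)) < 1) := by
  refine ⟨fun h k => ?_, fun h k => ?_, fun k => specNorm_matBC_lt (hS k) hv⟩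
  · have h1 : specNorm (S k) ≤ ⨆ k, specNorm (S k) :=
      le_ciSup (Set.finite_range fun k => specNorm (S k)).bddAbove k
    -- If the supremum were 0, its inverse would be 0 by convention, contradicting 0 < v.
    have h2 : 0 < ⨆ k, specNorm (S k) := by
      have : 0 < (⨆ k, specNorm (S k))⁻¹ := by linarith
      exact inv_pos.1 this
    refine specNorm_matBA_lt (hS k) hv ?_
    rw [← div_eq_mul_inv, lt_div_iff₀ h2] at h
    nlinarith
  · have h1 : specNorm ((S k)⁻¹) ≤ ⨆ k, specNorm ((S k)⁻¹) :=
      le_ciSup (Set.finite_range fun k => specNorm ((S k)⁻¹)).bddAbove k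
    rw [matBB_eq (hS k) hv]
    refine specNorm_matBA_lt (hS k).inv (inv_pos.2 hv) ?_
    rw [inv_mul_lt_iff₀ hv]
    linarith

end SpectralNorm


/-! ### The Laplace transform in the new variables -/

section Target

variable {p : ℕ}

/-- I + ΣT = Σ(Σ⁻¹ + T), a product of two positive definite matrices. -/
lemma det_one_add_mul_diagonal_pos {S : Matrix (Fin p) (Fin p) ℝ} (hS : S.PosDef)
    {t : Fin p → ℝ} (ht : ∀ j, 0 ≤ t j) : 0 < (1 + S * Matrix.diagonal t).det := by
  have h1 : 1 + S * Matrix.diagonal t = S * (S⁻¹ + Matrix.diagonal t) := by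
    rw [mul_add, Matrix.mul_nonsing_inv _ (isUnit_iff_ne_zero.2 hS.det_pos.ne')]
  rw [h1, Matrix.det_mul]
  exact mul_pos hS.det_pos (hS.inv.add_posSemidef (Matrix.PosSemidef.diagonal ht)).det_pos

/-- If `H (1 + A) Z = M`, the factor of the Laplace transform belonging to `A` is expressed by `H`,
`Z` and `M`. -/
lemma det_trace_of_factorization {A H Z M : Matrix (Fin p) (Fin p) ℝ} (h : H * (1 + A) * Z = M)
    (hA : 0 < (1 + A).det) (hH : 0 < H.det) (hZ : 0 < Z.det) :
    0 < M.det ∧ (∀ α : ℝ, (1 + A).det ^ (-α) = H.det ^ α * Z.det ^ α * M.det ^ (-α)) ∧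
    ∀ D : Matrix (Fin p) (Fin p) ℝ,
      (A * (1 + A)⁻¹ * D).trace = D.trace - (Z * M⁻¹ * H * D).trace := by
  have hdet : M.det = H.det * (1 + A).det * Z.det := by rw [← h, Matrix.det_mul, Matrix.det_mul]
  refine ⟨by rw [hdet]; positivity, fun α => ?_, fun D => ?_⟩
  · rw [hdet, Real.mul_rpow (by positivity) hZ.le, Real.mul_rpow hH.le hA.le,
      Real.rpow_neg hH.le, Real.rpow_neg hZ.le]
    have h1 : H.det ^ α ≠ 0 := by positivity
    have h2 : Z.det ^ α ≠ 0 := by positivity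
    field_simp
  · have hAu := isUnit_iff_ne_zero.2 hA.ne'
    have h1 : Z * M⁻¹ * H = (1 + A)⁻¹ := by
      rw [← h, Matrix.mul_inv_rev, Matrix.mul_inv_rev, ← mul_assoc, ← mul_assoc,
        Matrix.mul_nonsing_inv _ (isUnit_iff_ne_zero.2 hZ.ne'), one_mul, mul_assoc,
        Matrix.nonsing_inv_mul _ (isUnit_iff_ne_zero.2 hH.ne'), mul_one]
    have h2 : A * (1 + A)⁻¹ = 1 - (1 + A)⁻¹ := by
      rw [eq_sub_iff_add_eq]
      nth_rewrite 2 [← one_mul (1 + A)⁻¹]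
      rw [← add_mul, add_comm A, Matrix.mul_nonsing_inv _ hAu]
    rw [h1, h2, sub_mul, one_mul, Matrix.trace_sub]

/-- This eliminates T in favour of Z in all three factorizations: z = v / (v + t), hence t z = v(1 -
z). -/
lemma diagonal_mul_scale {v : ℝ} (hv : 0 < v) {t z : Fin p → ℝ} (ht : ∀ j, 0 ≤ t j)
    (hz : ∀ j, z j = (1 + t j / v)⁻¹) :
    Matrix.diagonal t * Matrix.diagonal z = v • (1 - Matrix.diagonal z) := by
  rw [Matrix.diagonal_mul_diagonal, ← Matrix.diagonal_one, Matrix.diagonal_sub,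
    ← Matrix.diagonal_smul]
  congr 1
  funext j
  have h : v + t j ≠ 0 := by have := ht j; positivity
  simp only [hz, Pi.smul_apply, smul_eq_mul]
  rw [show 1 + t j / v = (v + t j) / v by field_simp, inv_div]
  field_simp
  ring

lemma factorization_A {v : ℝ} {S T Z : Matrix (Fin p) (Fin p) ℝ} (hTZ : T * Z = v • (1 - Z)) :
    1 * (1 + S * T) * Z = 1 + matBA v S * (1 - Z) := by
  rw [one_mul, add_mul, one_mul, mul_assoc, hTZ, matBA, sub_mul, one_mul, Matrix.mul_smul,
    Matrix.smul_mul]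
  abel

lemma trace_A {B Z M D : Matrix (Fin p) (Fin p) ℝ} (hM : M = 1 + B * (1 - Z))
    (hdet : 0 < M.det) :
    -(D.trace - (Z * M⁻¹ * 1 * D).trace)
      = 0 + (-1) * ((1 - Z) * M⁻¹ * (D * (1 + B))).trace := by
  have h1 : (1 + B) * ((1 - Z) * M⁻¹) = 1 - Z * M⁻¹ := by
    rw [← mul_assoc, show (1 + B) * (1 - Z) = M - Z by rw [hM, add_mul, one_mul]; abel, sub_mul,
      Matrix.mul_nonsing_inv _ (isUnit_iff_ne_zero.2 hdet.ne')]
  have h2 : ((1 - Z) * M⁻¹ * (D * (1 + B))).trace = D.trace - (Z * M⁻¹ * D).trace := by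
    rw [← mul_assoc, Matrix.trace_mul_comm, ← mul_assoc, h1, sub_mul, one_mul, Matrix.trace_sub]
  rw [h2, mul_one]
  ring

/-- With H = I + B = (vΣ)⁻¹ the term H Σ T Z = H(vΣ)(I - Z) collapses to I - Z. -/
lemma factorization_B {v : ℝ} (hv : 0 < v) {S T Z : Matrix (Fin p) (Fin p) ℝ} (hS : S.PosDef)
    (hTZ : T * Z = v • (1 - Z)) :
    (1 + matBB v S) * (1 + S * T) * Z = 1 + matBB v S * Z := by
  have h1 : 1 + matBB v S = (v • S)⁻¹ := by rw [matBB]; abel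
  have h2 : (v • S)⁻¹ * (v • S) = 1 :=
    Matrix.nonsing_inv_mul _ (isUnit_iff_ne_zero.2 (hS.smul hv).det_pos.ne')
  rw [h1, mul_add, mul_one, add_mul, ← mul_assoc, mul_assoc _ T Z, hTZ, Matrix.mul_smul,
    ← Matrix.smul_mul, ← Matrix.mul_smul, h2, one_mul, matBB, sub_mul, one_mul]
  abel

lemma trace_B {B Z M D : Matrix (Fin p) (Fin p) ℝ} :
    -(D.trace - (Z * M⁻¹ * (1 + B) * D).trace)
      = -D.trace + 1 * (Z * M⁻¹ * ((1 + B) * D)).trace := by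
  rw [mul_assoc _ (1 + B) D]
  ring

/-- With H = I + B = 2(I + vΣ)⁻¹ one has H(vΣ) = 2I - H, so the left-hand side is HZ + (2I - H)(I -
Z). -/
lemma factorization_C {v : ℝ} (hv : 0 < v) {S T Z : Matrix (Fin p) (Fin p) ℝ} (hS : S.PosDef)
    (hTZ : T * Z = v • (1 - Z)) :
    (1 + matBC v S) * (1 + S * T) * Z = 1 + matBC v S * ((2 : ℝ) • Z - 1) := by
  set H := 1 + matBC v S with hH
  have h1 : H = (2 : ℝ) • (1 + v • S)⁻¹ := by rw [hH, matBC]; abel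
  have h2 : H + H * (v • S) = (2 : ℝ) • (1 : Matrix (Fin p) (Fin p) ℝ) := by
    nth_rewrite 1 [← mul_one H]
    rw [← mul_add, h1, Matrix.smul_mul,
      Matrix.nonsing_inv_mul _ (isUnit_iff_ne_zero.2 (posDef_one_add_smul hS hv).det_pos.ne')]
  have h3 : H * (v • S) = (2 : ℝ) • (1 : Matrix (Fin p) (Fin p) ℝ) - H := eq_sub_of_add_eq' h2
  have h4 : matBC v S = H - 1 := by rw [hH]; abel
  rw [mul_add, mul_one, add_mul, ← mul_assoc, mul_assoc _ T Z, hTZ, Matrix.mul_smul,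
    ← Matrix.smul_mul, ← Matrix.mul_smul, h3, h4, two_smul, two_smul]
  noncomm_ring

/-- The identity behind it is (I + U) - (I - B)U = I + BU = M, multiplied by M⁻¹ on the right. The
rest is cyclic invariance of the trace. -/
lemma trace_C {B U Z M D : Matrix (Fin p) (Fin p) ℝ} (hU : U = (2 : ℝ) • Z - 1)
    (hM : M = 1 + B * U) (hdet : 0 < M.det) :
    -(D.trace - (Z * M⁻¹ * (1 + B) * D).trace)
      = -(1 / 2) * (D * (1 - B)).trace +
        1 * (U * M⁻¹ * ((1 / 2 : ℝ) • ((1 + B) * D * (1 - B)))).trace := by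
  have hZ : Z = (1 / 2 : ℝ) • (1 + U) := by
    rw [hU, add_sub_cancel, smul_smul]
    norm_num
  have h1 : (1 + U) * M⁻¹ - (1 - B) * (U * M⁻¹) = 1 := by
    rw [← mul_assoc, ← sub_mul, show (1 + U) - (1 - B) * U = M by rw [hM]; noncomm_ring,
      Matrix.mul_nonsing_inv _ (isUnit_iff_ne_zero.2 hdet.ne')]
  have h2 : (U * M⁻¹ * ((1 + B) * D * (1 - B))).trace
      = ((1 - B) * (U * M⁻¹) * ((1 + B) * D)).trace := by
    rw [← mul_assoc, Matrix.trace_mul_comm, ← mul_assoc]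
  have h3 := congrArg (fun N => (N * ((1 + B) * D)).trace) h1
  simp only [sub_mul _ _ ((1 + B) * D), Matrix.trace_sub, one_mul] at h3
  have h4 : ((1 + B) * D).trace = D.trace + (B * D).trace := by
    rw [add_mul, one_mul, Matrix.trace_add]
  have h5 : (D * (1 - B)).trace = D.trace - (B * D).trace := by
    rw [mul_sub, mul_one, Matrix.trace_sub, Matrix.trace_mul_comm D B]
  rw [hZ, Matrix.smul_mul, Matrix.smul_mul, Matrix.smul_mul, Matrix.trace_smul, Matrix.mul_smul,
    Matrix.trace_smul, h2, h5, smul_eq_mul, smul_eq_mul, mul_assoc _ (1 + B) D]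
  linarith

/-- The Laplace transform, rewritten by means of a factorization of `1 + Σ T`. -/
lemma laplaceTarget_eq_of_factorization {n : ℕ} {α : Fin n → ℝ}
    {S D B D' H : Fin n → Matrix (Fin p) (Fin p) ℝ} {t z u : Fin p → ℝ} {e : Fin n → ℝ} {s : ℝ}
    (hS : ∀ k, (S k).PosDef) (ht : ∀ j, 0 ≤ t j) (hz : ∀ j, 0 < z j)
    (hH : ∀ k, 0 < (H k).det)
    (hfac : ∀ k, H k * (1 + S k * Matrix.diagonal t) * Matrix.diagonal z
      = 1 + B k * Matrix.diagonal u)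
    (htr : ∀ k, 0 < (1 + B k * Matrix.diagonal u).det →
      -((D k).trace - (Matrix.diagonal z * (1 + B k * Matrix.diagonal u)⁻¹ * H k * D k).trace)
      = e k + s * (Matrix.diagonal u * (1 + B k * Matrix.diagonal u)⁻¹ * D' k).trace) :
    laplaceTarget α S D t = (∏ k, Real.exp (e k) * (H k).det ^ α k) * (∏ j, z j ^ (∑ k, α k)) *
      ∏ k, Real.exp (s * (Matrix.diagonal u * (1 + B k * Matrix.diagonal u)⁻¹ * D' k).trace) *
        (1 + B k * Matrix.diagonal u).det ^ (-α k) := by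
  have hZdet : (Matrix.diagonal z).det = ∏ j, z j := Matrix.det_diagonal
  have hZ : 0 < (Matrix.diagonal z).det := by
    rw [hZdet]
    exact Finset.prod_pos fun j _ => hz j
  -- Each k contributes det(Z)^{α_k}; together they give the shape α = ∑ α_k of the generators.
  have h1 : (∏ j, z j ^ (∑ k, α k)) = ∏ k, (Matrix.diagonal z).det ^ α k := by
    rw [Real.finsetProd_rpow _ _ fun j _ => (hz j).le, ← hZdet,
      ← Real.rpow_sum_of_pos hZ]
  rw [h1, ← Finset.prod_mul_distrib, ← Finset.prod_mul_distrib, laplaceTarget]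
  refine Finset.prod_congr rfl fun k _ => ?_
  obtain ⟨hM, hp, htrace⟩ := det_trace_of_factorization (hfac k)
    (det_one_add_mul_diagonal_pos (hS k) ht) (hH k) hZ
  rw [hp, htrace, htr k hM, Real.exp_add]
  ring

end Target

/-! ### The integral representation -/

/-- The data of a representation of the function with Laplace transform `laplaceTarget α S D` by an
integral over the torus of radius `r`: the generator is `c(y) G_a(x, h(y))`, and the Laplace
transform is a function of `u(z)`, `z = (1 + t / v)⁻¹`, via the real values of the kernel. -/
structure TorusRepresentation {p n : ℕ} (α : Fin n → ℝ) (S D : Fin n → Matrix (Fin p) (Fin p) ℝ)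
    (a v r ρ s C : ℝ) (c h : ℂ → ℂ) (u : ℝ → ℝ) (B D' : Fin n → Matrix (Fin p) (Fin p) ℝ) :
    Prop where
  shape_pos : 0 < a
  scale_pos : 0 < v
  radius_pos : 0 < r
  continuousOn_c : ContinuousOn c (Metric.sphere 0 r)
  continuousOn_h : ContinuousOn h (Metric.sphere 0 r)
  norm_h_le : ∀ y, ‖y‖ = r → ‖h y‖ ≤ ρ
  specNorm_lt : ∀ k, specNorm (B k) < r
  abs_u_lt : ∀ z, 0 < z → z ≤ 1 → z * ρ < 1 → |u z| < r⁻¹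
  kernel_eq : ∀ z : ℝ, 0 < z → z ≤ 1 → z * ρ < 1 → ∀ y : ℂ, ‖y‖ = r →
    c y * (1 - z * h y)⁻¹ = (1 - u z * y)⁻¹
  laplace_eq : ∀ t : Fin p → ℝ, (∀ j, 0 ≤ t j) → laplaceTarget α S D t
    = C * (∏ j, (1 + t j / v)⁻¹ ^ a) *
      ∏ k, Real.exp (s * (Matrix.diagonal (fun j => u (1 + t j / v)⁻¹) *
        (1 + B k * Matrix.diagonal (fun j => u (1 + t j / v)⁻¹))⁻¹ * D' k).trace) *
        (1 + B k * Matrix.diagonal (fun j => u (1 + t j / v)⁻¹)).det ^ (-α k)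

namespace TorusRepresentation

variable {p n : ℕ} {α : Fin n → ℝ} {S D : Fin n → Matrix (Fin p) (Fin p) ℝ}
  {a v r ρ s C : ℝ} {c h : ℂ → ℂ} {u : ℝ → ℝ} {B D' : Fin n → Matrix (Fin p) (Fin p) ℝ}

lemma rho_nonneg (R : TorusRepresentation α S D a v r ρ s C c h u B D') : 0 ≤ ρ :=
  (norm_nonneg _).trans (R.norm_h_le r (by simp [R.radius_pos.le]))

/-- The kernel with the normalizing constants. -/
def kernel (α : Fin n → ℝ) (s C : ℝ) (B D' : Fin n → Matrix (Fin p) (Fin p) ℝ)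
    (y : Fin p → ℂ) : ℂ :=
  (C : ℂ) * ((2 * Real.pi : ℝ) : ℂ)⁻¹ ^ p * kernelK s α B D' y

lemma continuous_kernel (R : TorusRepresentation α S D a v r ρ s C c h u B D') :
    Continuous fun φ : Fin p → ℝ => kernel α s C B D' (circ r φ) := by
  refine continuous_const.mul (((polydiscHolo_kernelW R.radius_pos s α B D'
    R.specNorm_lt).continuous_circ R.radius_pos).congr fun φ => ?_)
  exact (kernelK_eq_kernelW (s : ℂ) α B D' (circ_ne_zero R.radius_pos φ)).symm

/-- The central computation. `kernel_eq` turns the transformed generators into Cauchy kernels,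
Cauchy's formula evaluates K at w = u(z), and `laplace_eq` recognizes the result. The condition
`htρ` keeps the density series convergent under the Laplace integral. -/
lemma laplace_mixDensity (R : TorusRepresentation α S D a v r ρ s C c h u B D')
    {t : Fin p → ℝ} (ht : ∀ j, 0 ≤ t j) (htρ : ∀ j, ρ < 1 + t j / v) :
    IntegrableOn (fun x => (Real.exp (-∑ j, t j * x j) : ℂ) *
      mixDensity a v r c h (kernel α s C B D') x) (orthant p) ∧
    ∫ x in orthant p, (Real.exp (-∑ j, t j * x j) : ℂ) *
      mixDensity a v r c h (kernel α s C B D') x = (laplaceTarget α S D t : ℂ) := by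
  obtain ⟨h1, h2⟩ := mixture_laplace R.shape_pos R.scale_pos R.radius_pos R.continuousOn_c
    R.continuousOn_h R.norm_h_le R.continuous_kernel ht htρ
  refine ⟨h1, h2.trans ?_⟩
  have hv := R.scale_pos
  set z : Fin p → ℝ := fun j => (1 + t j / v)⁻¹ with hz
  have hden : ∀ j, 1 ≤ 1 + t j / v := fun j => by
    have := ht j
    have : 0 ≤ t j / v := by positivity
    linarith
  have hz0 : ∀ j, 0 < z j := fun j => inv_pos.2 (one_pos.trans_le (hden j))
  have hz1 : ∀ j, z j ≤ 1 := fun j => inv_le_one_of_one_le₀ (hden j)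
  have hzρ : ∀ j, z j * ρ < 1 := fun j => by
    rw [hz, inv_mul_lt_one₀ (one_pos.trans_le (hden j))]
    exact htρ j
  have hu : ∀ j, |u (z j)| < r⁻¹ := fun j => R.abs_u_lt _ (hz0 j) (hz1 j) (hzρ j)
  have e1 : ∀ φ : Fin p → ℝ, kernel α s C B D' (circ r φ) * ∏ j, (c (circ r φ j) *
      (((z j ^ a : ℝ) : ℂ) * (1 - (z j : ℂ) * h (circ r φ j))⁻¹))
      = ((C : ℂ) * ((2 * Real.pi : ℝ) : ℂ)⁻¹ ^ p * ∏ j, ((z j ^ a : ℝ) : ℂ)) *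
        (kernelW s α B D' (fun j => (circ r φ j)⁻¹) *
          ∏ j, (1 - (u (z j) : ℂ) * circ r φ j)⁻¹) := by
    intro φ
    have e2 : ∏ j, (c (circ r φ j) * (((z j ^ a : ℝ) : ℂ) *
        (1 - (z j : ℂ) * h (circ r φ j))⁻¹))
        = (∏ j, ((z j ^ a : ℝ) : ℂ)) * ∏ j, (1 - (u (z j) : ℂ) * circ r φ j)⁻¹ := by
      rw [← Finset.prod_mul_distrib]
      refine Finset.prod_congr rfl fun j _ => ?_
      rw [← R.kernel_eq (z j) (hz0 j) (hz1 j) (hzρ j) _ (norm_circ R.radius_pos φ j)]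
      ring
    rw [e2, kernel, kernelK_eq_kernelW _ _ _ _ (circ_ne_zero R.radius_pos φ)]
    ring
  have hlap : laplaceTarget α S D t = C * (∏ j, z j ^ a) *
      ∏ k, Real.exp (s * (Matrix.diagonal (fun j => u (z j)) *
        (1 + B k * Matrix.diagonal (fun j => u (z j)))⁻¹ * D' k).trace) *
        (1 + B k * Matrix.diagonal (fun j => u (z j))).det ^ (-α k) := R.laplace_eq t ht
  refine (integral_congr_ae (ae_of_all _ e1)).trans ?_
  rw [integral_const_mul, (polydiscHolo_kernelW R.radius_pos s α B D'
    R.specNorm_lt).integral_cube R.radius_pos (u := fun j => (u (z j) : ℂ))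
    (fun j => by rw [Complex.norm_real]; exact hu j),
    (kernelW_ofReal R.radius_pos s α B D' R.specNorm_lt (u := fun j => u (z j))
      fun j => (hu j).le).2, hlap]
  have hpi : ((2 * Real.pi : ℝ) : ℂ) ≠ 0 := by
    exact_mod_cast (by positivity : (2 * Real.pi : ℝ) ≠ 0)
  have hpi' : ((2 * Real.pi : ℝ) : ℂ)⁻¹ ^ p * ((2 * Real.pi : ℝ) : ℂ) ^ p = 1 := by
    rw [← mul_pow, inv_mul_cancel₀ hpi, one_pow]
  generalize (∏ k, Real.exp (s * (Matrix.diagonal (fun j => u (z j)) *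
    (1 + B k * Matrix.diagonal (fun j => u (z j)))⁻¹ * D' k).trace) *
    (1 + B k * Matrix.diagonal (fun j => u (z j))).det ^ (-α k)) = q
  calc _ = (((2 * Real.pi : ℝ) : ℂ)⁻¹ ^ p * ((2 * Real.pi : ℝ) : ℂ) ^ p) *
        (C * (∏ j, ((z j ^ a : ℝ) : ℂ)) * q) := by ring
    _ = _ := by
      rw [hpi', one_mul]
      push_cast
      ring

/-- If ρ < 1, the transform of the mixture is available for every t ≥ 0. The target is real, so the
real part of the mixture is a density. -/
lemma exists_density (R : TorusRepresentation α S D a v r ρ s C c h u B D') (hρ : ρ < 1) :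
    ∃ f : (Fin p → ℝ) → ℝ, IsConvolutionDensity α S D f := by
  have hl : ∀ t : Fin p → ℝ, (∀ j, 0 ≤ t j) → _ := fun t ht =>
    R.laplace_mixDensity ht fun j => hρ.trans_le (by
      have := ht j
      have := R.scale_pos
      have : 0 ≤ t j / v := by positivity
      linarith)
  refine ⟨fun x => (mixDensity a v r c h (kernel α s C B D') x).re, ?_, fun t ht => ?_⟩
  · have := (hl 0 fun _ => le_rfl).1
    simp only [Pi.zero_apply, zero_mul, Finset.sum_const_zero, neg_zero, Real.exp_zero,
      Complex.ofReal_one, one_mul] at this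
    exact this.re
  · have h2 := congrArg Complex.re (hl t ht).2
    rw [Complex.ofReal_re, ← RCLike.re_eq_complex_re, ← integral_re (hl t ht).1] at h2
    simp only [RCLike.re_eq_complex_re, Complex.re_ofReal_mul] at h2
    exact h2

/-- The integral representation of the box integrals of the density. -/
lemma boxIntegral_eq (R : TorusRepresentation α S D a v r ρ s C c h u B D')
    {f : (Fin p → ℝ) → ℝ} (hf : IsConvolutionDensity α S D f) {x : Fin p → ℝ}
    (hx : ∀ j, 0 ≤ x j) :
    IntegrableOn (fun φ => kernelK s α B D' (circ r φ) *
      ∏ j, (c (circ r φ j) * genB a (v * x j) (h (circ r φ j)))) (cube p) ∧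
    (boxIntegral f x : ℂ) = (C : ℂ) * ((2 * Real.pi : ℝ) : ℂ)⁻¹ ^ p *
      ∫ φ in cube p, kernelK s α B D' (circ r φ) *
        ∏ j, (c (circ r φ j) * genB a (v * x j) (h (circ r φ j))) := by
  have hv := R.scale_pos
  have hρ0 := R.rho_nonneg
  have hK : Continuous fun φ : Fin p → ℝ => kernelK s α B D' (circ r φ) := by
    refine ((polydiscHolo_kernelW R.radius_pos s α B D'
      R.specNorm_lt).continuous_circ R.radius_pos).congr fun φ => ?_
    exact (kernelK_eq_kernelW (s : ℂ) α B D' (circ_ne_zero R.radius_pos φ)).symm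
  refine ⟨(mixture_box R.shape_pos hv R.radius_pos R.continuousOn_c R.continuousOn_h
    R.norm_h_le hK hx).1, ?_⟩
  -- When ρ ≥ 1 the mixture itself need not be integrable; its transform is compared with that of f
  -- only for t_j ≥ vρ.
  have hbig : ∀ t : ℝ, v * ρ ≤ t → 0 ≤ t ∧ ρ < 1 + t / v := fun t ht => by
    refine ⟨(by positivity : 0 ≤ v * ρ).trans ht, ?_⟩
    have : ρ ≤ t / v := by rwa [le_div_iff₀' hv]
    linarith
  have hfτ : ∀ t : Fin p → ℝ, (∀ j, 0 ≤ t j) → IntegrableOn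
      (fun x => (Real.exp (-∑ j, t j * x j) : ℂ) * (f x : ℂ)) (orthant p) := by
    intro t ht
    have hf' : IntegrableOn (fun x => (f x : ℂ)) (orthant p) := hf.integrable.ofReal
    refine Integrable.mono hf' (AEStronglyMeasurable.mul
      (Continuous.aestronglyMeasurable (by fun_prop)) hf'.1) ?_
    filter_upwards [ae_restrict_orthant] with x hx
    rw [norm_mul, Complex.norm_of_nonneg (Real.exp_pos _).le]
    exact mul_le_of_le_one_left (norm_nonneg _) (exp_neg_sum_le_one ht fun j => (hx j).le)
  have hτ := hbig (v * ρ) le_rfl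
  have hae : (fun x => (f x : ℂ)) =ᵐ[volume.restrict (orthant p)]
      mixDensity a v r c h (kernel α s C B D') := by
    refine ae_eq_of_laplace_of_ge (τ := v * ρ) (hfτ _ fun _ => hτ.1)
      (R.laplace_mixDensity (fun _ => hτ.1) fun _ => hτ.2).1 fun t ht => ?_
    rw [(R.laplace_mixDensity (fun j => (hbig _ (ht j)).1) fun j => (hbig _ (ht j)).2).2,
      ← hf.laplace t fun j => (hbig _ (ht j)).1, ← integral_complex_ofReal]
    push_cast
    rfl
  have hsub : (Set.univ.pi fun j => Set.Ioc 0 (x j)) ⊆ orthant p :=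
    Set.pi_mono fun _ _ => Set.Ioc_subset_Ioi_self
  rw [boxIntegral, ← integral_complex_ofReal,
    integral_congr_ae (ae_restrict_of_ae_restrict_of_subset hsub hae),
    (mixture_box R.shape_pos hv R.radius_pos R.continuousOn_c R.continuousOn_h
      R.norm_h_le R.continuous_kernel hx).2, ← integral_const_mul]
  simp only [kernel, mul_assoc]

end TorusRepresentation


/-! ### The three representations -/

section Cases

variable {p n : ℕ} {α : Fin n → ℝ} {S D : Fin n → Matrix (Fin p) (Fin p) ℝ} {v r : ℝ}

lemma scale_pos_of_nonneg (hv : 0 < v) {t : Fin p → ℝ} (ht : ∀ j, 0 ≤ t j) (j : Fin p) :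
    0 < (1 + t j / v)⁻¹ := by
  have := ht j
  positivity

lemma det_one_add_matBB_pos {S : Matrix (Fin p) (Fin p) ℝ} (hS : S.PosDef) (hv : 0 < v) :
    0 < (1 + matBB v S).det := by
  rw [matBB, add_sub_cancel]
  exact (hS.smul hv).inv.det_pos

lemma det_one_add_matBC_pos {S : Matrix (Fin p) (Fin p) ℝ} (hS : S.PosDef) (hv : 0 < v) :
    0 < (1 + matBC v S).det := by
  rw [matBC, add_sub_cancel]
  exact ((posDef_one_add_smul hS hv).inv.smul two_pos).det_pos

lemma one_sub_le_norm_one_sub {y : ℂ} (hy : ‖y‖ = r) : 1 - r ≤ ‖1 - y‖ := by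
  have := norm_sub_norm_le (1 : ℂ) y
  rwa [norm_one, hy] at this

/-- On |y| = r one has |y / (y - 1)| ≤ r / (1 - r) = ρ. The kernel identity reads (1 - y)(1 - z y/(y
- 1)) = 1 - (1 - z)y. -/
lemma torusRepresentation_A (ha : 0 < ∑ k, α k) (hS : ∀ k, (S k).PosDef) (hv : 0 < v)
    (hr : 0 < r) (hB : ∀ k, specNorm (matBA v (S k)) < r) (hr1 : r < 1) :
    TorusRepresentation α S D (∑ k, α k) v r (r / (1 - r)) (-1) 1 (fun y => 1 / (1 - y))
      (fun y => y / (y - 1)) (fun z => 1 - z) (fun k => matBA v (S k))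
      (fun k => D k * (1 + matBA v (S k))) := by
  have hne : ∀ y : ℂ, ‖y‖ = r → 1 - y ≠ 0 := fun y hy h => by
    have := one_sub_le_norm_one_sub hy
    rw [h, norm_zero] at this
    linarith
  have hne' : ∀ y : ℂ, ‖y‖ = r → y - 1 ≠ 0 := fun y hy h =>
    hne y hy (by rw [← neg_sub, h, neg_zero])
  have hrinv : 1 < r⁻¹ := (one_lt_inv₀ hr).2 hr1
  refine ⟨ha, hv, hr, ?_, ?_, fun y hy => ?_, hB, fun z hz hz1 _ => ?_, fun z hz hz1 _ y hy => ?_,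
    fun t ht => ?_⟩
  · exact continuousOn_const.div (by fun_prop) fun y hy => hne y (mem_sphere_zero_iff_norm.1 hy)
  · exact continuousOn_id.div (by fun_prop) fun y hy => hne' y (mem_sphere_zero_iff_norm.1 hy)
  · rw [norm_div, hy, norm_sub_rev]
    exact div_le_div_of_nonneg_left hr.le (by linarith) (one_sub_le_norm_one_sub hy)
  · rw [abs_of_nonneg (by linarith)]
    linarith
  · have h1 := hne y hy
    have h2 := hne' y hy
    rw [one_div, ← mul_inv]
    congr 1
    push_cast
    field_simp
    ring
  · set z : Fin p → ℝ := fun j => (1 + t j / v)⁻¹ with hz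
    have hTZ := diagonal_mul_scale hv (z := z) ht fun _ => rfl
    have hU : Matrix.diagonal (fun j => 1 - z j) = 1 - Matrix.diagonal z := by
      rw [← Matrix.diagonal_one, Matrix.diagonal_sub]
    rw [laplaceTarget_eq_of_factorization (H := fun _ => 1) (e := fun _ => 0) (s := -1)
      (B := fun k => matBA v (S k)) (D' := fun k => D k * (1 + matBA v (S k))) (z := z)
      (u := fun j => 1 - z j) hS ht (scale_pos_of_nonneg hv ht) (fun _ => by simp)
      (fun k => by rw [hU]; exact factorization_A hTZ)
      (fun k hk => by rw [hU] at hk ⊢; exact trace_A rfl hk)]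
    simp only [Real.exp_zero, Matrix.det_one, Real.one_rpow, mul_one, Finset.prod_const_one, hz]

/-- Here h is the identity and u(z) = z, so z ρ < 1 is the same as |u| < 1/r and r may exceed 1. -/
lemma torusRepresentation_B (ha : 0 < ∑ k, α k) (hS : ∀ k, (S k).PosDef) (hv : 0 < v)
    (hr : 0 < r) (hB : ∀ k, specNorm (matBB v (S k)) < r) :
    TorusRepresentation α S D (∑ k, α k) v r r 1
      (∏ k, Real.exp (-(D k).trace) * (1 + matBB v (S k)).det ^ α k) (fun _ => 1)
      (fun y => y) (fun z => z) (fun k => matBB v (S k))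
      (fun k => (1 + matBB v (S k)) * D k) := by
  refine ⟨ha, hv, hr, continuousOn_const, continuousOn_id, fun y hy => hy.le, hB,
    fun z hz hz1 hzr => ?_, fun z hz hz1 _ y hy => one_mul _, fun t ht => ?_⟩
  · rwa [abs_of_pos hz, ← one_div, lt_div_iff₀ hr]
  · set z : Fin p → ℝ := fun j => (1 + t j / v)⁻¹ with hz
    have hTZ := diagonal_mul_scale hv (z := z) ht fun _ => rfl
    exact laplaceTarget_eq_of_factorization (H := fun k => 1 + matBB v (S k))
      (e := fun k => -(D k).trace) hS ht (scale_pos_of_nonneg hv ht)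
      (fun k => det_one_add_matBB_pos (hS k) hv) (fun k => factorization_B hv (hS k) hTZ)
      (fun k _ => trace_B)

/-- On |y| = r one has |2y / (y + 1)| ≤ 2r / (1 - r) = ρ. The kernel identity reads (1 + y)(1 -
2zy/(y + 1)) = 1 - (2z - 1)y, and |2z - 1| ≤ 1 < 1/r. -/
lemma torusRepresentation_C (ha : 0 < ∑ k, α k) (hS : ∀ k, (S k).PosDef) (hv : 0 < v)
    (hr : 0 < r) (hB : ∀ k, specNorm (matBC v (S k)) < r) (hr1 : r < 1) :
    TorusRepresentation α S D (∑ k, α k) v r (2 * r / (1 - r)) 1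
      (∏ k, Real.exp (-(1 / 2) * (D k * (1 - matBC v (S k))).trace) *
        (1 + matBC v (S k)).det ^ α k) (fun y => 1 / (1 + y))
      (fun y => 2 * y / (y + 1)) (fun z => 2 * z - 1) (fun k => matBC v (S k))
      (fun k => (1 / 2 : ℝ) • ((1 + matBC v (S k)) * D k * (1 - matBC v (S k)))) := by
  have hle : ∀ y : ℂ, ‖y‖ = r → 1 - r ≤ ‖1 + y‖ := fun y hy => by
    rw [← sub_neg_eq_add]
    exact one_sub_le_norm_one_sub (by rwa [norm_neg])
  have hne : ∀ y : ℂ, ‖y‖ = r → 1 + y ≠ 0 := fun y hy h => by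
    have := hle y hy
    rw [h, norm_zero] at this
    linarith
  have hne' : ∀ y : ℂ, ‖y‖ = r → y + 1 ≠ 0 := fun y hy => by
    rw [add_comm]
    exact hne y hy
  have hrinv : 1 < r⁻¹ := (one_lt_inv₀ hr).2 hr1
  refine ⟨ha, hv, hr, ?_, ?_, fun y hy => ?_, hB, fun z hz hz1 _ => ?_, fun z hz hz1 _ y hy => ?_,
    fun t ht => ?_⟩
  · exact continuousOn_const.div (by fun_prop) fun y hy => hne y (mem_sphere_zero_iff_norm.1 hy)
  · exact ContinuousOn.div (by fun_prop) (by fun_prop)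
      fun y hy => hne' y (mem_sphere_zero_iff_norm.1 hy)
  · rw [norm_div, norm_mul, hy, add_comm, Complex.norm_ofNat]
    exact div_le_div_of_nonneg_left (by positivity) (by linarith) (hle y hy)
  · exact (abs_le.2 ⟨by linarith, by linarith⟩).trans_lt hrinv
  · have h1 := hne y hy
    have h2 := hne' y hy
    rw [one_div, ← mul_inv]
    congr 1
    push_cast
    field_simp
    ring
  · set z : Fin p → ℝ := fun j => (1 + t j / v)⁻¹ with hz
    have hTZ := diagonal_mul_scale hv (z := z) ht fun _ => rfl
    have hU : Matrix.diagonal (fun j => 2 * z j - 1) = (2 : ℝ) • Matrix.diagonal z - 1 := by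
      rw [← Matrix.diagonal_one, ← Matrix.diagonal_smul, Matrix.diagonal_sub]
      rfl
    exact laplaceTarget_eq_of_factorization (H := fun k => 1 + matBC v (S k))
      (e := fun k => -(1 / 2) * (D k * (1 - matBC v (S k))).trace) (u := fun j => 2 * z j - 1) hS ht
      (scale_pos_of_nonneg hv ht) (fun k => det_one_add_matBC_pos (hS k) hv)
      (fun k => by rw [hU]; exact factorization_C hv (hS k) hTZ)
      (fun k hk => by exact trace_C hU rfl hk)

lemma sum_shape_pos (hn : 0 < n) (hα : ∀ k, 0 < α k) : 0 < ∑ k, α k :=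
  Finset.sum_pos (fun k _ => hα k) ⟨⟨0, hn⟩, Finset.mem_univ _⟩

/-- In the second representation ρ = r, and for v large all ‖B_k‖ are below 1, so a radius r < 1
exists and the mixture is a density. -/
lemma exists_convolutionDensity (hn : 0 < n) (hα : ∀ k, 0 < α k) (hS : ∀ k, (S k).PosDef) :
    ∃ f : (Fin p → ℝ) → ℝ, IsConvolutionDensity α S D f := by
  have : Nonempty (Fin n) := ⟨⟨0, hn⟩⟩
  obtain ⟨v, hv, hvS⟩ : ∃ v : ℝ, 0 < v ∧ 1 / 2 * (⨆ k, specNorm ((S k)⁻¹)) < v := by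
    refine ⟨max 0 (1 / 2 * (⨆ k, specNorm ((S k)⁻¹))) + 1, by positivity, ?_⟩
    exact (le_max_right _ _).trans_lt (lt_add_one _)
  have hlt := (specNorm_conditions hS hv).2.1 hvS
  obtain ⟨k₀, hk₀⟩ := Finite.exists_max fun k => specNorm (matBB v (S k))
  obtain ⟨r, hr, hr1⟩ := exists_between (hlt k₀)
  exact (torusRepresentation_B (sum_shape_pos hn hα) hS hv ((specNorm_nonneg _).trans_lt hr)
    fun k => (hk₀ k).trans_lt hr).exists_density hr1

/-- The three integral representations. -/
lemma representations (hn : 0 < n) (hα : ∀ k, 0 < α k) (hS : ∀ k, (S k).PosDef)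
    {f : (Fin p → ℝ) → ℝ} (hf : IsConvolutionDensity α S D f) {x : Fin p → ℝ}
    (hx : ∀ j, 0 ≤ x j) (hv : 0 < v) :
    ((∀ k, specNorm (matBA v (S k)) < r) → r < 1 →
      IntegrableOn (integrand (genA (∑ k, α k)) (-1) α (fun k => matBA v (S k))
        (fun k => D k * (1 + matBA v (S k))) v r x) (cube p) ∧
      (boxIntegral f x : ℂ) =
        ((2 * Real.pi : ℝ) : ℂ)⁻¹ ^ p *
          ∫ φ in cube p, integrand (genA (∑ k, α k)) (-1) α (fun k => matBA v (S k))
            (fun k => D k * (1 + matBA v (S k))) v r x φ) ∧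
    ((∀ k, specNorm (matBB v (S k)) < r) →
      IntegrableOn (integrand (genB (∑ k, α k)) 1 α (fun k => matBB v (S k))
        (fun k => (1 + matBB v (S k)) * D k) v r x) (cube p) ∧
      (boxIntegral f x : ℂ) =
        ((∏ k, Real.exp (-(D k).trace) * (1 + matBB v (S k)).det ^ α k : ℝ) : ℂ) *
          ((2 * Real.pi : ℝ) : ℂ)⁻¹ ^ p *
          ∫ φ in cube p, integrand (genB (∑ k, α k)) 1 α (fun k => matBB v (S k))
            (fun k => (1 + matBB v (S k)) * D k) v r x φ) ∧
    ((∀ k, specNorm (matBC v (S k)) < r) → r < 1 →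
      IntegrableOn (integrand (genC (∑ k, α k)) 1 α (fun k => matBC v (S k))
        (fun k => (1 / 2 : ℝ) • ((1 + matBC v (S k)) * D k * (1 - matBC v (S k))))
        v r x) (cube p) ∧
      (boxIntegral f x : ℂ) =
        ((∏ k, Real.exp (-(1 / 2) * (D k * (1 - matBC v (S k))).trace) *
            (1 + matBC v (S k)).det ^ α k : ℝ) : ℂ) *
          ((2 * Real.pi : ℝ) : ℂ)⁻¹ ^ p *
          ∫ φ in cube p, integrand (genC (∑ k, α k)) 1 α (fun k => matBC v (S k))
            (fun k => (1 / 2 : ℝ) • ((1 + matBC v (S k)) * D k * (1 - matBC v (S k))))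
            v r x φ) := by
  have ha := sum_shape_pos hn hα
  have hvx : ∀ j, 0 ≤ v * x j := fun j => mul_nonneg hv.le (hx j)
  have hr0 : ∀ {B : Fin n → Matrix (Fin p) (Fin p) ℝ}, (∀ k, specNorm (B k) < r) → 0 < r :=
    fun h => (specNorm_nonneg _).trans_lt (h ⟨0, hn⟩)
  refine ⟨fun hB hr1 => ?_, fun hB => ?_, fun hB hr1 => ?_⟩
  · have hr := hr0 hB
    obtain ⟨h1, h2⟩ := (torusRepresentation_A ha hS hv hr hB hr1).boxIntegral_eq hf hx
    have e : integrand (genA (∑ k, α k)) (-1) α (fun k => matBA v (S k))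
        (fun k => D k * (1 + matBA v (S k))) v r x = fun φ =>
        kernelK ((-1 : ℝ) : ℂ) α (fun k => matBA v (S k)) (fun k => D k * (1 + matBA v (S k)))
          (circ r φ) * ∏ j, (1 / (1 - circ r φ j) *
            genB (∑ k, α k) (v * x j) (circ r φ j / (circ r φ j - 1))) := by
      funext φ
      rw [integrand, Complex.ofReal_neg, Complex.ofReal_one]
      congr 1
      refine Finset.prod_congr rfl fun j _ => ?_
      exact (hasSum_genA ha (hvx j) (by rwa [norm_circ hr])).tsum_eq
    rw [e]
    refine ⟨h1, ?_⟩
    rw [h2, Complex.ofReal_one, one_mul]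
  · have hr := hr0 hB
    obtain ⟨h1, h2⟩ := (torusRepresentation_B ha hS hv hr hB).boxIntegral_eq hf hx
    simp only [one_mul, Complex.ofReal_one] at h1 h2
    exact ⟨h1, h2⟩
  · have hr := hr0 hB
    obtain ⟨h1, h2⟩ := (torusRepresentation_C ha hS hv hr hB hr1).boxIntegral_eq hf hx
    have e : integrand (genC (∑ k, α k)) 1 α (fun k => matBC v (S k))
        (fun k => (1 / 2 : ℝ) • ((1 + matBC v (S k)) * D k * (1 - matBC v (S k)))) v r x = fun φ =>
        kernelK ((1 : ℝ) : ℂ) α (fun k => matBC v (S k))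
          (fun k => (1 / 2 : ℝ) • ((1 + matBC v (S k)) * D k * (1 - matBC v (S k))))
          (circ r φ) * ∏ j, (1 / (1 + circ r φ j) *
            genB (∑ k, α k) (v * x j) (2 * circ r φ j / (circ r φ j + 1))) := by
      funext φ
      rw [integrand, Complex.ofReal_one]
      congr 1
      refine Finset.prod_congr rfl fun j _ => ?_
      exact (hasSum_genC ha (hvx j) (by rwa [norm_circ hr])).tsum_eq
    rw [e]
    exact ⟨h1, h2⟩

end Cases


/-! ### Gaussian integrals of exponentials of quadratic forms -/

section GaussianQuadratic

open Matrix

lemma integral_exp_quadratic_gaussianReal {c : ℝ} (hc : 0 ≤ c) (β : ℝ) :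
    ∫ x, Real.exp (-(1 / 2) * (c * x ^ 2) + β * x) ∂gaussianReal 0 1 =
      (1 + c) ^ (-(1 / 2) : ℝ) * Real.exp (1 / 2 * ((1 + c)⁻¹ * β ^ 2)) := by
  have h0 : 0 < 1 + c := by linarith
  rw [integral_gaussianReal_eq_integral_smul one_ne_zero]
  -- Completing the square; the Gaussian integral is invariant under the shift by β / (1 + c).
  have h1 : ∀ x : ℝ, gaussianPDFReal 0 1 x • Real.exp (-(1 / 2) * (c * x ^ 2) + β * x) =
      ((√(2 * Real.pi))⁻¹ * Real.exp (1 / 2 * ((1 + c)⁻¹ * β ^ 2))) *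
        (fun y => Real.exp (-((1 + c) / 2) * y ^ 2)) (x - β / (1 + c)) := by
    intro x
    simp only [gaussianPDFReal, smul_eq_mul, NNReal.coe_one, mul_one, sub_zero]
    rw [mul_assoc, mul_assoc, ← Real.exp_add, ← Real.exp_add]
    congr 2
    field_simp
    ring
  simp_rw [h1]
  rw [integral_const_mul,
    integral_sub_right_eq_self (fun y => Real.exp (-((1 + c) / 2) * y ^ 2)) (β / (1 + c)),
    integral_gaussian]
  have h2 : Real.pi / ((1 + c) / 2) = 2 * Real.pi * (1 + c)⁻¹ := by field_simp
  have h3 : (1 + c) ^ (-(1 / 2) : ℝ) = √((1 + c)⁻¹) := by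
    rw [Real.sqrt_eq_rpow, Real.inv_rpow h0.le, Real.rpow_neg h0.le]
  rw [h2, Real.sqrt_mul (show (0 : ℝ) ≤ 2 * Real.pi by positivity), h3]
  have h4 : √(2 * Real.pi) ≠ 0 := by positivity
  rw [mul_right_comm, inv_mul_cancel_left₀ h4, mul_comm]

variable {p : ℕ}

lemma exists_orthogonal_diagonalization {C : Matrix (Fin p) (Fin p) ℝ} (hC : C.PosSemidef) :
    ∃ (b : OrthonormalBasis (Fin p) ℝ (EuclideanSpace ℝ (Fin p))) (U : Matrix (Fin p) (Fin p) ℝ)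
      (c : Fin p → ℝ), (∀ i, 0 ≤ c i) ∧ Uᵀ * U = 1 ∧ U * Uᵀ = 1 ∧
      C = U * diagonal c * Uᵀ ∧ ∀ x : Fin p → ℝ, (∑ i, x i • b i).ofLp = U *ᵥ x := by
  refine ⟨hC.1.eigenvectorBasis, hC.1.eigenvectorUnitary, hC.1.eigenvalues, hC.eigenvalues_nonneg,
    ?_, ?_, ?_, fun x => ?_⟩
  · simpa [star_eq_conjTranspose] using Unitary.coe_star_mul_self hC.1.eigenvectorUnitary
  · simpa [star_eq_conjTranspose] using Unitary.coe_mul_star_self hC.1.eigenvectorUnitary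
  · conv_lhs => rw [hC.1.spectral_theorem]
    rw [Unitary.conjStarAlgAut_apply]
    simp [star_eq_conjTranspose]
  · ext j
    simp [mulVec, dotProduct, mul_comm, Matrix.IsHermitian.eigenvectorUnitary_apply]

/-- The standard Gaussian has independent standard coordinates in any orthonormal basis. In an
eigenbasis of C the integral is a product of one-dimensional ones. -/
lemma integral_exp_quadratic_stdGaussian {C : Matrix (Fin p) (Fin p) ℝ} (hC : C.PosSemidef)
    (b : Fin p → ℝ) :
    ∫ g, Real.exp (-(1 / 2) * (g.ofLp ⬝ᵥ C *ᵥ g.ofLp) + b ⬝ᵥ g.ofLp)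
        ∂stdGaussian (EuclideanSpace ℝ (Fin p)) =
      (1 + C).det ^ (-(1 / 2) : ℝ) * Real.exp (1 / 2 * (b ⬝ᵥ (1 + C)⁻¹ *ᵥ b)) := by
  obtain ⟨e, U, c, hc, hU, hU', hCU, he⟩ := exists_orthogonal_diagonalization hC
  have hc' : ∀ i, 0 < 1 + c i := fun i => by have := hc i; linarith
  rw [stdGaussian_eq_map_pi_orthonormalBasis e,
    integral_map (Measurable.aemeasurable (by fun_prop)) (by fun_prop)]
  simp_rw [he]
  have h1 : ∀ x : Fin p → ℝ,
      -(1 / 2) * ((U *ᵥ x) ⬝ᵥ C *ᵥ (U *ᵥ x)) + b ⬝ᵥ (U *ᵥ x) =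
        ∑ i, (-(1 / 2) * (c i * x i ^ 2) + (Uᵀ *ᵥ b) i * x i) := by
    intro x
    have e1 : C *ᵥ (U *ᵥ x) = U *ᵥ (diagonal c *ᵥ x) := by
      rw [mulVec_mulVec, mulVec_mulVec, hCU, Matrix.mul_assoc, hU, Matrix.mul_one]
    have e2 : (U *ᵥ x) ⬝ᵥ (U *ᵥ (diagonal c *ᵥ x)) = x ⬝ᵥ (diagonal c *ᵥ x) := by
      rw [dotProduct_mulVec, vecMul_mulVec, ← dotProduct_mulVec, hU, one_mulVec] 
    have e3 : b ⬝ᵥ (U *ᵥ x) = (Uᵀ *ᵥ b) ⬝ᵥ x := by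
      rw [dotProduct_mulVec, mulVec_transpose]
    rw [e1, e2, e3, Finset.sum_add_distrib, ← Finset.mul_sum]
    simp only [dotProduct, mulVec_diagonal]
    congr 2
    exact Finset.sum_congr rfl fun i _ => by ring
  simp_rw [h1, Real.exp_sum]
  rw [integral_fintype_prod_eq_prod
    (f := fun i x => Real.exp (-(1 / 2) * (c i * x ^ 2) + (Uᵀ *ᵥ b) i * x))]
  simp_rw [integral_exp_quadratic_gaussianReal (hc _)]
  rw [Finset.prod_mul_distrib, ← Real.exp_sum, Real.finsetProd_rpow _ _ fun i _ => (hc' i).le]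
  have h2 : 1 + C = U * diagonal (fun i => 1 + c i) * Uᵀ := by
    have : diagonal (fun i => 1 + c i) = 1 + diagonal c := by
      rw [← diagonal_one, diagonal_add]
    rw [this, Matrix.mul_add, Matrix.add_mul, Matrix.mul_one, hU', ← hCU]
  have h3 : (1 + C)⁻¹ = U * diagonal (fun i => (1 + c i)⁻¹) * Uᵀ := by
    refine inv_eq_right_inv ?_
    calc (1 + C) * (U * diagonal (fun i => (1 + c i)⁻¹) * Uᵀ)
        = U * diagonal (fun i => 1 + c i) * (Uᵀ * U) * diagonal (fun i => (1 + c i)⁻¹) * Uᵀ := by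
          rw [h2]; simp only [Matrix.mul_assoc]
      _ = 1 := by
          rw [hU, Matrix.mul_one, Matrix.mul_assoc U, diagonal_mul_diagonal]
          simp [mul_inv_cancel₀ (hc' _).ne', hU']
  have hdet : (1 + C).det = ∏ i, (1 + c i) := by
    rw [h2, det_mul_right_comm, hU', Matrix.one_mul, det_diagonal]
  rw [hdet, h3, ← Finset.mul_sum]
  congr 3
  rw [Matrix.mul_assoc, ← mulVec_mulVec, ← mulVec_mulVec, dotProduct_mulVec b U,
    ← mulVec_transpose]
  simp only [dotProduct, mulVec_diagonal]
  exact Finset.sum_congr rfl fun i _ => by ring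

/-- The joint Laplace transform of the squared components of a Gaussian vector. -/
lemma integral_exp_neg_sq_multivariateGaussian {S : Matrix (Fin p) (Fin p) ℝ}
    (hS : S.PosSemidef) (m : Fin p → ℝ) {u : Fin p → ℝ} (hu : ∀ j, 0 ≤ u j) :
    ∫ z, Real.exp (-(1 / 2) * ∑ j, u j * z.ofLp j ^ 2)
        ∂multivariateGaussian (WithLp.toLp 2 m) S =
      (1 + S * diagonal u).det ^ (-(1 / 2) : ℝ) *
        Real.exp (-(1 / 2) * (m ⬝ᵥ (diagonal u * (1 + S * diagonal u)⁻¹) *ᵥ m)) := by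
  open scoped MatrixOrder in
  obtain ⟨R, hR, hRR, hRS⟩ : ∃ R : Matrix (Fin p) (Fin p) ℝ,
      R = CFC.sqrt S ∧ R * R = S ∧ Rᵀ = R := by
    refine ⟨_, rfl, CFC.sqrt_mul_sqrt_self S (Matrix.nonneg_iff_posSemidef.2 hS), ?_⟩
    have := (Matrix.nonneg_iff_posSemidef.1 (CFC.sqrt_nonneg S)).1
    simpa [Matrix.IsHermitian] using this
  rw [multivariateGaussian, ← hR, integral_map (by fun_prop) (by fun_prop)]
  set L := diagonal u with hL
  have hC : (R * L * R).PosSemidef := by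
    have := (PosSemidef.diagonal hu).mul_mul_conjTranspose_same R
    simpa [hRS, conjTranspose_eq_transpose_of_trivial] using this
  -- The Gaussian vector is m + R g with g standard and R the symmetric square root of S; expanding
  -- the quadratic form in g prepares for the standard case.
  have h1 : ∀ g : EuclideanSpace ℝ (Fin p),
      -(1 / 2) * ∑ j, u j *
        (WithLp.toLp 2 m + toEuclideanCLM (𝕜 := ℝ) R g).ofLp j ^ 2 =
      -(1 / 2) * (m ⬝ᵥ L *ᵥ m) + (-(1 / 2) * (g.ofLp ⬝ᵥ (R * L * R) *ᵥ g.ofLp) +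
        (-(R *ᵥ L *ᵥ m)) ⬝ᵥ g.ofLp) := by
    intro g
    have e0 : ∑ j, u j * (WithLp.toLp 2 m + toEuclideanCLM (𝕜 := ℝ) R g).ofLp j ^ 2 =
        (m + R *ᵥ g.ofLp) ⬝ᵥ L *ᵥ (m + R *ᵥ g.ofLp) := by
      simp only [dotProduct, hL, mulVec_diagonal]
      refine Finset.sum_congr rfl fun j _ => ?_
      have : (WithLp.toLp 2 m + toEuclideanCLM (𝕜 := ℝ) R g).ofLp j = (m + R *ᵥ g.ofLp) j := by
        simp
      rw [this]; ring
    have e1 : (R *ᵥ g.ofLp) ⬝ᵥ L *ᵥ m = (R *ᵥ L *ᵥ m) ⬝ᵥ g.ofLp := by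
      rw [dotProduct_comm, dotProduct_mulVec, ← mulVec_transpose, hRS]
    have e2 : m ⬝ᵥ L *ᵥ (R *ᵥ g.ofLp) = (R *ᵥ L *ᵥ m) ⬝ᵥ g.ofLp := by
      rw [dotProduct_mulVec, dotProduct_mulVec, ← mulVec_transpose, ← mulVec_transpose, hRS, hL,
        diagonal_transpose]
    have e3 : (R *ᵥ g.ofLp) ⬝ᵥ L *ᵥ (R *ᵥ g.ofLp) = g.ofLp ⬝ᵥ (R * L * R) *ᵥ g.ofLp := by
      rw [← mulVec_mulVec, ← mulVec_mulVec, dotProduct_mulVec g.ofLp R, ← mulVec_transpose, hRS]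
    rw [e0, mulVec_add, dotProduct_add, add_dotProduct, add_dotProduct, e1, e2, e3,
      neg_dotProduct]
    ring
  simp_rw [h1, Real.exp_add (-(1 / 2) * (m ⬝ᵥ L *ᵥ m))]
  rw [integral_const_mul, integral_exp_quadratic_stdGaussian hC]
  have hdet : (1 + R * L * R).det = (1 + S * L).det := by
    rw [det_one_add_mul_comm, ← Matrix.mul_assoc, hRR]
  have hpos : 0 < (1 + R * L * R).det := (PosDef.one.add_posSemidef hC).det_pos
  have hu1 : IsUnit (1 + R * L * R).det := hpos.ne'.isUnit
  have hu2 : IsUnit (1 + S * L).det := hdet ▸ hu1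
  -- The push-through identity removes the square root R again.
  have h4 : R * (1 + R * L * R)⁻¹ = (1 + S * L)⁻¹ * R := by
    have : (1 + S * L) * R = R * (1 + R * L * R) := by rw [← hRR]; noncomm_ring
    calc R * (1 + R * L * R)⁻¹ = (1 + S * L)⁻¹ * ((1 + S * L) * R) * (1 + R * L * R)⁻¹ := by
          rw [← Matrix.mul_assoc, nonsing_inv_mul _ hu2, Matrix.one_mul]
      _ = _ := by rw [this, Matrix.mul_assoc, Matrix.mul_assoc R, mul_nonsing_inv _ hu1,
          Matrix.mul_one]
  have h5 : (1 + S * L)⁻¹ = 1 - (1 + S * L)⁻¹ * S * L := by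
    have : (1 + S * L)⁻¹ * (1 + S * L) = 1 := nonsing_inv_mul _ hu2
    rw [Matrix.mul_add, Matrix.mul_one, ← Matrix.mul_assoc] at this
    exact eq_sub_of_add_eq this
  have h6 : (-(R *ᵥ L *ᵥ m)) ⬝ᵥ (1 + R * L * R)⁻¹ *ᵥ (-(R *ᵥ L *ᵥ m)) =
      m ⬝ᵥ (L * ((1 + S * L)⁻¹ * S * L)) *ᵥ m := by
    rw [mulVec_neg, neg_dotProduct_neg]
    have e1 : (R *ᵥ L *ᵥ m) = (L * R)ᵀ *ᵥ m := by
      rw [mulVec_mulVec, transpose_mul, hRS, hL, diagonal_transpose]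
    conv_lhs => rw [e1, mulVec_transpose, ← dotProduct_mulVec, ← mulVec_transpose, ← e1]
    rw [mulVec_mulVec, mulVec_mulVec, mulVec_mulVec]
    congr 2
    calc L * R * (1 + R * L * R)⁻¹ * R * L = L * (R * (1 + R * L * R)⁻¹) * R * L := by
          simp only [Matrix.mul_assoc]
      _ = _ := by rw [h4, ← hRR]; simp only [Matrix.mul_assoc]
  rw [h6, hdet, mul_left_comm, ← Real.exp_add]
  congr 2
  conv_rhs => rw [h5, Matrix.mul_sub, Matrix.mul_one, sub_mulVec, dotProduct_sub]
  ring

end GaussianQuadratic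


/-! ### Orthogonal mixtures of independent Gaussian vectors -/

section Rotation

open Matrix
open scoped RealInnerProductSpace

variable {p m : ℕ} {Ω : Type*} {_ : MeasurableSpace Ω} {P : Measure Ω}

lemma sum_quadratic_orthogonal {T : Matrix (Fin m) (Fin m) ℝ} (hT : Tᵀ * T = 1)
    (S : Matrix (Fin p) (Fin p) ℝ) (t : Fin m → Fin p → ℝ) :
    ∑ i, (∑ k, T i k • t k) ⬝ᵥ S *ᵥ (∑ k, T i k • t k) = ∑ k, t k ⬝ᵥ S *ᵥ t k := by
  have hT' : ∀ k l, ∑ i, T i k * T i l = if k = l then 1 else 0 := fun k l => by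
    rw [← Matrix.one_apply, ← hT, Matrix.mul_apply]; rfl
  calc ∑ i, (∑ k, T i k • t k) ⬝ᵥ S *ᵥ (∑ k, T i k • t k)
      = ∑ i, ∑ k, ∑ l, (T i k * T i l) * (t k ⬝ᵥ S *ᵥ t l) := by
        refine Finset.sum_congr rfl fun i _ => ?_
        rw [Matrix.mulVec_sum, sum_dotProduct]
        refine Finset.sum_congr rfl fun k _ => ?_
        rw [dotProduct_sum]
        refine Finset.sum_congr rfl fun l _ => ?_
        rw [mulVec_smul, smul_dotProduct, dotProduct_smul, smul_eq_mul, smul_eq_mul, mul_assoc]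
    _ = ∑ k, ∑ l, (∑ i, T i k * T i l) * (t k ⬝ᵥ S *ᵥ t l) := by
        rw [Finset.sum_comm]
        refine Finset.sum_congr rfl fun k _ => ?_
        rw [Finset.sum_comm]
        exact Finset.sum_congr rfl fun l _ => by rw [Finset.sum_mul]
    _ = _ := by simp [hT']

/-- The joint characteristic function of the mixed vectors at t is that of the X_i at the rotated
argument. Its logarithm is a linear plus a quadratic term with the same matrix S for every i, and
orthogonality of T splits it into one summand for each k. -/
lemma gaussian_orthogonal_mix [IsProbabilityMeasure P] {S : Matrix (Fin p) (Fin p) ℝ}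
    (hS : S.PosSemidef) {T : Matrix (Fin m) (Fin m) ℝ} (hT : Tᵀ * T = 1)
    {X : Fin m → Ω → EuclideanSpace ℝ (Fin p)} {μ : Fin m → EuclideanSpace ℝ (Fin p)}
    (hX : ∀ i, HasLaw (X i) (multivariateGaussian (μ i) S) P) (hind : iIndepFun X P) :
    iIndepFun (fun k ω => ∑ i, T i k • X i ω) P ∧
      ∀ k, HasLaw (fun ω => ∑ i, T i k • X i ω)
        (multivariateGaussian (∑ i, T i k • μ i) S) P := by
  have hXm : ∀ i, AEMeasurable (X i) P := fun i => (hX i).aemeasurable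
  have hZm : ∀ k, AEMeasurable (fun ω => ∑ i, T i k • X i ω) P := fun k => by fun_prop
  have hZm' : AEMeasurable (fun ω => WithLp.toLp 2 (fun k => ∑ i, T i k • X i ω)) P := by fun_prop
  have hXm' : AEMeasurable (fun ω => WithLp.toLp 2 (fun i => X i ω)) P := by fun_prop
  have joint : ∀ t : PiLp 2 (fun _ : Fin m => EuclideanSpace ℝ (Fin p)),
      charFun (P.map (fun ω => WithLp.toLp 2 (fun k => ∑ i, T i k • X i ω))) t =
        ∏ k, charFun (multivariateGaussian (∑ i, T i k • μ i) S) (t k) := by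
    intro t
    set t' : PiLp 2 (fun _ : Fin m => EuclideanSpace ℝ (Fin p)) :=
      WithLp.toLp 2 (fun i => ∑ k, T i k • t k) with ht'
    have h1 : charFun (P.map (fun ω => WithLp.toLp 2 (fun k => ∑ i, T i k • X i ω))) t =
        charFun (P.map (fun ω => WithLp.toLp 2 (fun i => X i ω))) t' := by
      rw [charFun_apply, charFun_apply, integral_map hZm' (by fun_prop),
        integral_map hXm' (by fun_prop)]
      congr 1
      ext ω
      congr 3
      simp only [PiLp.inner_apply, ht', sum_inner, inner_sum, inner_smul_left, inner_smul_right]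
      rw [Finset.sum_comm]
      rfl
    rw [h1, (iIndepFun_iff_charFun_pi hXm).1 hind t']
    simp_rw [fun i => (hX i).map_eq, charFun_multivariateGaussian hS]
    rw [← Complex.exp_sum, ← Complex.exp_sum, Finset.sum_sub_distrib, Finset.sum_sub_distrib,
      ← Finset.sum_mul, ← Finset.sum_mul, ← Finset.sum_div, ← Finset.sum_div]
    have h2 : ∑ i, ⟪t' i, μ i⟫ = ∑ k, ⟪t k, ∑ i, T i k • μ i⟫ := by
      simp only [ht', sum_inner, inner_sum, inner_smul_left, inner_smul_right]
      rw [Finset.sum_comm]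
      rfl
    have h3 : ∑ i, (t' i).ofLp ⬝ᵥ S *ᵥ (t' i).ofLp = ∑ k, (t k).ofLp ⬝ᵥ S *ᵥ (t k).ofLp := by
      rw [← sum_quadratic_orthogonal hT S (fun k => (t k).ofLp)]
      simp [ht']
    norm_cast
    rw [h2, h3]
  have marg : ∀ k, HasLaw (fun ω => ∑ i, T i k • X i ω)
      (multivariateGaussian (∑ i, T i k • μ i) S) P := by
    intro k
    refine ⟨hZm k, ?_⟩
    have := Measure.isProbabilityMeasure_map (hZm k)
    refine Measure.ext_of_charFun ?_
    ext s
    -- A marginal characteristic function is the joint one at an argument supported in the k-th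
    -- slot.
    have h1 : charFun (P.map (fun ω => ∑ i, T i k • X i ω)) s =
        charFun (P.map (fun ω => WithLp.toLp 2 (fun k => ∑ i, T i k • X i ω)))
          (WithLp.toLp 2 (Pi.single k s)) := by
      rw [charFun_apply, charFun_apply, integral_map hZm' (by fun_prop),
        integral_map (hZm k) (by fun_prop)]
      congr 1
      ext ω
      have hsingle : ∀ a : Fin m → EuclideanSpace ℝ (Fin p),
          ⟪a k, s⟫ = ⟪WithLp.toLp 2 a, WithLp.toLp 2 (Pi.single k s)⟫ := by
        intro a
        rw [PiLp.inner_apply (WithLp.toLp 2 a), Finset.sum_eq_single k]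
        · simp only [Pi.single_eq_same]
        · intro l _ hl
          simp only [Pi.single_eq_of_ne hl, inner_zero_right]
        · simp
      rw [hsingle fun k => ∑ i, T i k • X i ω]
    rw [h1, joint, Finset.prod_eq_single k]
    · simp
    · intro l _ hl
      simp [Pi.single_eq_of_ne hl]
    · simp
  refine ⟨(iIndepFun_iff_charFun_pi hZm).2 fun t => ?_, marg⟩
  rw [joint]
  exact Finset.prod_congr rfl fun k _ => by rw [(marg k).map_eq]

end Rotation


/-! ### Diagonals of generalized quadratic forms of Gaussian matrices -/

section QuadraticForm

open Matrix

variable {p m : ℕ}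

/-- The matrix has rank at most one and satisfies D² = τD with τ = ½ w'S⁻¹w ≥ 0, so every eigenvalue
is 0 or τ. -/
lemma nonnegEigenvalues_smul_vecMulVec_mul_inv {S : Matrix (Fin p) (Fin p) ℝ} (hS : S.PosDef)
    (w : Fin p → ℝ) : NonnegEigenvalues ((1 / 2 : ℝ) • (vecMulVec w w * S⁻¹)) := by
  intro z hz
  set D := (1 / 2 : ℝ) • (vecMulVec w w * S⁻¹) with hD
  set τ := (1 / 2 : ℝ) * (w ⬝ᵥ S⁻¹ *ᵥ w) with hτ
  have hτ0 : 0 ≤ τ := mul_nonneg (by norm_num) (by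
    simpa using hS.inv.posSemidef.dotProduct_mulVec_nonneg w)
  have hDD : D * D = τ • D := by
    have h1 : vecMulVec w w * S⁻¹ * (vecMulVec w w * S⁻¹) =
        (w ⬝ᵥ S⁻¹ *ᵥ w) • (vecMulVec w w * S⁻¹) := by
      rw [Matrix.mul_assoc, ← Matrix.mul_assoc S⁻¹, Matrix.mul_vecMulVec, ← Matrix.mul_assoc,
        vecMulVec_mul_vecMulVec, vecMulVec_smul, smul_mul_assoc]
    rw [hD, smul_mul_smul_comm, h1, smul_smul, smul_smul, hτ]
    congr 1
    ring
  have hCC : D.map Complex.ofReal * D.map Complex.ofReal =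
      (τ : ℂ) • D.map Complex.ofReal := by
    have h2 := congrArg (fun N : Matrix (Fin p) (Fin p) ℝ => N.map Complex.ofRealHom) hDD
    simp only [Matrix.map_mul] at h2
    refine h2.trans ?_
    ext i j
    simp
  -- For p = 0 the spectrum is empty, which contradicts `hz`.
  have hp : Nontrivial (Matrix (Fin p) (Fin p) ℂ) := by
    by_contra h
    rw [not_nontrivial_iff_subsingleton] at h
    simp [spectrum.of_subsingleton] at hz
  have h3 := spectrum.subset_polynomial_aeval (D.map Complex.ofReal)
    (Polynomial.X ^ 2 - Polynomial.C (τ : ℂ) * Polynomial.X) ⟨z, hz, rfl⟩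
  have h4 : Polynomial.aeval (D.map Complex.ofReal)
      (Polynomial.X ^ 2 - Polynomial.C (τ : ℂ) * Polynomial.X) = 0 := by
    simp only [map_sub, map_mul, map_pow, Polynomial.aeval_X, Polynomial.aeval_C]
    rw [pow_two, hCC, ← Algebra.smul_def, sub_self]
  rw [h4, spectrum.zero_eq] at h3
  have h5 : z * (z - τ) = 0 := by
    have : z ^ 2 - τ * z = 0 := by simpa using h3
    linear_combination this
  rcases mul_eq_zero.1 h5 with h | h
  · simp [h]
  · rw [sub_eq_zero.1 h]
    simpa using hτ0

/-- The rank counts the nonzero entries of l. As l is non-negative and decreasing, they occupy an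
initial segment of indices. -/
lemma eigenvalues_of_orthogonal_diagonalization {A T : Matrix (Fin m) (Fin m) ℝ} {l : Fin m → ℝ}
    (hA : A.PosSemidef) (hT : Tᵀ * T = 1) (hl : Antitone l) (h : Tᵀ * A * T = diagonal l)
    (i : Fin m) : 0 ≤ l i ∧ ((i : ℕ) < A.rank ↔ 0 < l i) := by
  have hnn : ∀ i, 0 ≤ l i := by
    rw [← posSemidef_diagonal_iff, ← h]
    simpa [conjTranspose_eq_transpose_of_trivial] using hA.conjTranspose_mul_mul_same T
  have hdet : IsUnit T.det := IsUnit.of_mul_eq_one (Tᵀ).det (by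
    rw [mul_comm, ← det_mul, hT, det_one])
  have hrank : A.rank = (Finset.univ.filter fun i => l i ≠ 0).card := by
    rw [← Fintype.card_subtype, ← rank_diagonal, ← h, rank_mul_eq_left_of_isUnit_det _ _ hdet,
      rank_mul_eq_right_of_isUnit_det _ _ (by rwa [det_transpose])]
  refine ⟨hnn i, fun hi => ?_, fun hi => ?_⟩
  · refine (hnn i).lt_of_ne' fun h0 => ?_
    have : (Finset.univ.filter fun i => l i ≠ 0) ⊆ Finset.Iio i := fun j hj => by
      rw [Finset.mem_Iio]
      by_contra hij
      exact (Finset.mem_filter.1 hj).2 (le_antisymm (h0 ▸ hl (not_lt.1 hij)) (hnn j))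
    have := Finset.card_le_card this
    rw [Fin.card_Iio] at this
    omega
  · have : Finset.Iic i ⊆ (Finset.univ.filter fun i => l i ≠ 0) := fun j hj => by
      simpa using (hi.trans_le (hl (Finset.mem_Iic.1 hj))).ne'
    have := Finset.card_le_card this
    rw [Fin.card_Iic] at this
    omega

lemma mul_diagonalizable_mul_transpose_apply {A T : Matrix (Fin m) (Fin m) ℝ} {l : Fin m → ℝ}
    (hT : T * Tᵀ = 1) (h : Tᵀ * A * T = diagonal l) (X : Matrix (Fin p) (Fin m) ℝ) (j : Fin p) :
    (X * A * Xᵀ) j j = ∑ k, l k * (X * T) j k ^ 2 := by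
  have hA : X * A * Xᵀ = X * T * diagonal l * (X * T)ᵀ := by
    calc X * A * Xᵀ = X * (T * Tᵀ) * A * (T * Tᵀ) * Xᵀ := by rw [hT, Matrix.mul_one, Matrix.mul_one]
      _ = _ := by rw [← h, transpose_mul]; simp only [Matrix.mul_assoc]
  rw [hA, Matrix.mul_apply]
  refine Finset.sum_congr rfl fun k _ => ?_
  rw [mul_diagonal, transpose_apply]
  ring

variable {Ω : Type*} {_ : MeasurableSpace Ω} {P : Measure Ω}

/-- The Laplace transform of the diagonal of `(1/2) Z diag(l) Z'` for independent Gaussian columns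
of `Z`. -/
lemma integral_exp_neg_sum_quadratic [IsProbabilityMeasure P] {S : Matrix (Fin p) (Fin p) ℝ}
    (hS : S.PosSemidef) {l : Fin m → ℝ} (hl : ∀ k, 0 ≤ l k)
    {Z : Fin m → Ω → EuclideanSpace ℝ (Fin p)} {w : Fin m → Fin p → ℝ}
    (hZ : ∀ k, HasLaw (Z k) (multivariateGaussian (WithLp.toLp 2 (w k)) S) P)
    (hind : iIndepFun Z P) {t : Fin p → ℝ} (ht : ∀ j, 0 ≤ t j) :
    ∫ ω, Real.exp (-∑ j, t j * (1 / 2 * ∑ k, l k * (Z k ω).ofLp j ^ 2)) ∂P =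
      ∏ k, (1 + l k • S * diagonal t).det ^ (-(1 / 2) : ℝ) *
        Real.exp (-(1 / 2) *
          (w k ⬝ᵥ (diagonal (l k • t) * (1 + l k • S * diagonal t)⁻¹) *ᵥ w k)) := by
  have h1 : ∀ ω, Real.exp (-∑ j, t j * (1 / 2 * ∑ k, l k * (Z k ω).ofLp j ^ 2)) =
      ∏ k, (fun z : EuclideanSpace ℝ (Fin p) =>
        Real.exp (-(1 / 2) * ∑ j, (l k • t) j * z.ofLp j ^ 2)) (Z k ω) := by
    intro ω
    rw [← Real.exp_sum]
    congr 1
    simp only [Finset.mul_sum, ← Finset.sum_neg_distrib]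
    rw [Finset.sum_comm]
    refine Finset.sum_congr rfl fun k _ => Finset.sum_congr rfl fun j _ => ?_
    simp only [Pi.smul_apply, smul_eq_mul]
    ring
  simp_rw [h1]
  rw [hind.integral_fun_prod_comp (f := fun k (z : EuclideanSpace ℝ (Fin p)) =>
    Real.exp (-(1 / 2) * ∑ j, (l k • t) j * z.ofLp j ^ 2)) (fun k => (hZ k).aemeasurable)
    (fun k => by fun_prop)]
  refine Finset.prod_congr rfl fun k _ => ?_
  have h2 : l k • S * diagonal t = S * diagonal (l k • t) := by
    rw [smul_mul_assoc, ← mul_smul_comm, diagonal_smul]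
  rw [← integral_map (φ := Z k) (hZ k).aemeasurable (f := fun z : EuclideanSpace ℝ (Fin p) =>
    Real.exp (-(1 / 2) * ∑ j, (l k • t) j * z.ofLp j ^ 2)) (by fun_prop), (hZ k).map_eq,
    integral_exp_neg_sq_multivariateGaussian hS _ (u := l k • t)
      fun j => mul_nonneg (hl k) (ht j), h2]

/-- Cyclic invariance of the trace brings S⁻¹ next to the leading S, leaving a quadratic form in w.
-/
lemma trace_mul_vecMulVec_mul_inv {S : Matrix (Fin p) (Fin p) ℝ} (hS : S.PosDef)
    (c : ℝ) (t w : Fin p → ℝ) :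
    (c • S * diagonal t * (1 + c • S * diagonal t)⁻¹ *
      ((1 / 2 : ℝ) • (vecMulVec w w * S⁻¹))).trace =
      1 / 2 * (w ⬝ᵥ (diagonal (c • t) * (1 + c • S * diagonal t)⁻¹) *ᵥ w) := by
  have h2 : c • S * diagonal t = S * diagonal (c • t) := by
    rw [smul_mul_assoc, ← mul_smul_comm, diagonal_smul]
  have hu : IsUnit S.det := hS.det_pos.ne'.isUnit
  rw [mul_smul_comm, trace_smul, smul_eq_mul]
  congr 1
  rw [← Matrix.mul_assoc, trace_mul_comm, ← Matrix.mul_assoc]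
  conv_lhs => rw [h2]
  rw [← Matrix.mul_assoc, ← Matrix.mul_assoc, nonsing_inv_mul _ hu, Matrix.one_mul,
    mul_vecMulVec, trace_vecMulVec, dotProduct_comm, ← h2]

/-- For an index k ≥ q the entry l k is 0 and the factor is 1, so the product over all m columns
reduces to the first q. -/
lemma laplaceTarget_eq_prod {q : ℕ} (hq : q ≤ m) {S : Matrix (Fin p) (Fin p) ℝ} (hS : S.PosDef)
    {l : Fin m → ℝ} (hl : ∀ i : Fin m, ¬ (i : ℕ) < q → l i = 0) (w : Fin m → Fin p → ℝ)
    (t : Fin p → ℝ) :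
    laplaceTarget (fun _ : Fin q => 1 / 2) (fun k => l (Fin.castLE hq k) • S)
      (fun k => (1 / 2 : ℝ) • (vecMulVec (w (Fin.castLE hq k)) (w (Fin.castLE hq k)) * S⁻¹)) t =
      ∏ k, (1 + l k • S * diagonal t).det ^ (-(1 / 2) : ℝ) *
        Real.exp (-(1 / 2) *
          (w k ⬝ᵥ (diagonal (l k • t) * (1 + l k • S * diagonal t)⁻¹) *ᵥ w k)) := by
  refine Fintype.prod_of_injective (Fin.castLE hq) (Fin.castLE_injective hq) _ _
    (fun i hi => ?_) fun k => ?_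
  · have h0 : l i = 0 := hl i fun h => hi ⟨⟨i, h⟩, rfl⟩
    simp [h0]
  · rw [trace_mul_vecMulVec_mul_inv hS, neg_mul]

/-- The law of the diagonal lives on [0, ∞)^p and has the same transform as f, so by uniqueness both
give every measurable set, here Iic x, the same mass. No prior knowledge of a density of the law is
needed. -/
theorem quadraticForm_diagonal_le_eq_boxIntegral [IsProbabilityMeasure P]
    {S : Matrix (Fin p) (Fin p) ℝ} (hS : S.PosDef) (M : Matrix (Fin p) (Fin m) ℝ)
    {A T : Matrix (Fin m) (Fin m) ℝ} {l : Fin m → ℝ} (hA : A.PosSemidef)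
    (hT : T ∈ orthogonalGroup (Fin m) ℝ) (hl : Antitone l) (hTA : Tᵀ * A * T = diagonal l)
    {X : Ω → Matrix (Fin p) (Fin m) ℝ}
    (hX : ∀ i, HasLaw (fun ω => WithLp.toLp 2 (fun j => X ω j i))
        (multivariateGaussian (WithLp.toLp 2 (fun j => M j i)) S) P)
    (hind : iIndepFun (fun (i : Fin m) (ω : Ω) (j : Fin p) => X ω j i) P)
    {f : (Fin p → ℝ) → ℝ}
    (hf : IsConvolutionDensity (fun _ : Fin A.rank => 1 / 2)
      (fun k => l (Fin.castLE A.rank_le_height k) • S)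
      (fun k => (1 / 2 : ℝ) •
        (vecMulVec (fun j => (M * T) j (Fin.castLE A.rank_le_height k))
          (fun j => (M * T) j (Fin.castLE A.rank_le_height k)) * S⁻¹)) f)
    (x : Fin p → ℝ) :
    P.real {ω | ∀ j, 1 / 2 * (X ω * A * (X ω)ᵀ) j j ≤ x j} = boxIntegral f x := by
  have hT1 : Tᵀ * T = 1 := (mem_orthogonalGroup_iff' _ _).1 hT
  have hT2 : T * Tᵀ = 1 := (mem_orthogonalGroup_iff _ _).1 hT
  have hev := eigenvalues_of_orthogonal_diagonalization hA hT1 hl hTA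
  obtain ⟨hZi, hZl⟩ := gaussian_orthogonal_mix hS.posSemidef hT1 hX
    (hind.comp (fun _ => WithLp.toLp 2) fun _ => by fun_prop)
  have hmean : ∀ k, ∑ i, T i k • (WithLp.toLp 2 (fun j => M j i) : EuclideanSpace ℝ (Fin p)) =
      WithLp.toLp 2 (fun j => (M * T) j k) := fun k => by
    ext j
    simp [Matrix.mul_apply, mul_comm]
  set Z : Fin m → Ω → EuclideanSpace ℝ (Fin p) :=
    fun k ω => ∑ i, T i k • WithLp.toLp 2 (fun j => X ω j i) with hZ
  have hZl' : ∀ k, HasLaw (Z k)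
      (multivariateGaussian (WithLp.toLp 2 (fun j => (M * T) j k)) S) P := fun k => by
    rw [← hmean]; exact hZl k
  have hZj : ∀ k ω j, (Z k ω).ofLp j = (X ω * T) j k := fun k ω j => by
    simp [hZ, Matrix.mul_apply, mul_comm]
  set Y : Ω → Fin p → ℝ := fun ω j => 1 / 2 * ∑ k, l k * (Z k ω).ofLp j ^ 2 with hY
  have hYX : ∀ ω j, 1 / 2 * (X ω * A * (X ω)ᵀ) j j = Y ω j := fun ω j => by
    simp only [hY, hZj, mul_diagonalizable_mul_transpose_apply hT2 hTA]
  have hYm : AEMeasurable Y P := by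
    have := fun k => (hZl' k).aemeasurable
    refine aemeasurable_pi_lambda _ fun j => ?_
    fun_prop
  have hYnn : ∀ ω j, 0 ≤ Y ω j := fun ω j =>
    mul_nonneg (by norm_num) (Finset.sum_nonneg fun k _ => mul_nonneg (hev k).1 (sq_nonneg _))
  have := Measure.isProbabilityMeasure_map hYm
  have key := measureReal_eq_setIntegral_of_laplace (μ := P.map Y) (f := f)
    ((ae_map_iff hYm (by measurability)).2 (ae_of_all _ hYnn)) hf.integrable (fun t ht => by
      rw [hf.laplace t ht, integral_map hYm (Measurable.aestronglyMeasurable (by fun_prop)),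
        integral_exp_neg_sum_quadratic hS.posSemidef (fun k => (hev k).1) hZl' hZi ht]
      exact (laplaceTarget_eq_prod A.rank_le_height hS
        (fun i hi => le_antisymm (not_lt.1 fun h => hi ((hev i).2.2 h)) (hev i).1)
        (fun k j => (M * T) j k) t).symm) (measurableSet_Iic (a := x))
  have hbox : Set.Iic x ∩ orthant p = Set.univ.pi fun j => Set.Ioc 0 (x j) := by
    ext y
    simp only [orthant, Set.mem_inter_iff, Set.mem_Iic, Set.mem_univ_pi, Set.mem_Ioi, Set.mem_Ioc,
      Pi.le_def]
    exact ⟨fun h j => ⟨h.2 j, h.1 j⟩, fun h => ⟨fun j => (h j).2, fun j => (h j).1⟩⟩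
  rw [hbox, measureReal_def, Measure.map_apply_of_aemeasurable hYm measurableSet_Iic] at key
  simp_rw [hYX]
  exact key

end QuadraticForm

end GammaConv

end

theorem theorem2 {p : ℕ} (hp : 0 < p) :
    -- the three integral representations
    (∀ (n : ℕ) (_ : 0 < n) (α : Fin n → ℝ) (S D : Fin n → Matrix (Fin p) (Fin p) ℝ)
      (_ : ∀ k, 0 < α k) (_ : ∀ k, (S k).PosDef) (_ : ∀ k, NonnegEigenvalues (D k)),
      -- the function with the given Laplace transform exists
      (∃ f : (Fin p → ℝ) → ℝ, IsConvolutionDensity α S D f) ∧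
      -- the series of the generators converge, with the given closed forms
      (∀ ξ : ℝ, 0 ≤ ξ →
        (∀ y : ℂ, ‖y‖ < 1 →
          HasSum (fun m : ℕ => (gDerivCdf (∑ k, α k) m ξ : ℂ) * y ^ m)
            (1 / (1 - y) * genB (∑ k, α k) ξ (y / (y - 1)))) ∧
        (∀ y : ℂ, Summable (fun m : ℕ => (gCdf ((∑ k, α k) + m) ξ : ℂ) * y ^ m)) ∧
        (∀ y : ℂ, ‖y‖ < 1 →
          HasSum (fun m : ℕ => (hCdf (∑ k, α k) m ξ : ℂ) * y ^ m)
            (1 / (1 + y) * genB (∑ k, α k) ξ (2 * y / (y + 1))))) ∧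
      -- the conditions on the scale factor
      (∀ v : ℝ, 0 < v →
        (v < 2 * (⨆ k, specNorm (S k))⁻¹ → ∀ k, specNorm (matBA v (S k)) < 1) ∧
        (1 / 2 * (⨆ k, specNorm ((S k)⁻¹)) < v → ∀ k, specNorm (matBB v (S k)) < 1) ∧
        (∀ k, specNorm (matBC v (S k)) < 1)) ∧
      -- the representations
      (∀ f : (Fin p → ℝ) → ℝ, IsConvolutionDensity α S D f →
        ∀ x : Fin p → ℝ, (∀ j, 0 ≤ x j) → ∀ v r : ℝ, 0 < v →
        ((∀ k, specNorm (matBA v (S k)) < r) → r < 1 →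
          IntegrableOn (integrand (genA (∑ k, α k)) (-1) α (fun k => matBA v (S k))
            (fun k => D k * (1 + matBA v (S k))) v r x) (cube p) ∧
          (boxIntegral f x : ℂ) =
            ((2 * Real.pi : ℝ) : ℂ)⁻¹ ^ p *
              ∫ φ in cube p, integrand (genA (∑ k, α k)) (-1) α (fun k => matBA v (S k))
                (fun k => D k * (1 + matBA v (S k))) v r x φ) ∧
        ((∀ k, specNorm (matBB v (S k)) < r) →
          IntegrableOn (integrand (genB (∑ k, α k)) 1 α (fun k => matBB v (S k))
            (fun k => (1 + matBB v (S k)) * D k) v r x) (cube p) ∧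
          (boxIntegral f x : ℂ) =
            ((∏ k, Real.exp (-(D k).trace) * (1 + matBB v (S k)).det ^ α k : ℝ) : ℂ) *
              ((2 * Real.pi : ℝ) : ℂ)⁻¹ ^ p *
              ∫ φ in cube p, integrand (genB (∑ k, α k)) 1 α (fun k => matBB v (S k))
                (fun k => (1 + matBB v (S k)) * D k) v r x φ) ∧
        ((∀ k, specNorm (matBC v (S k)) < r) → r < 1 →
          IntegrableOn (integrand (genC (∑ k, α k)) 1 α (fun k => matBC v (S k))
            (fun k => (1 / 2 : ℝ) • ((1 + matBC v (S k)) * D k * (1 - matBC v (S k))))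
            v r x) (cube p) ∧
          (boxIntegral f x : ℂ) =
            ((∏ k, Real.exp (-(1 / 2) * (D k * (1 - matBC v (S k))).trace) *
                (1 + matBC v (S k)).det ^ α k : ℝ) : ℂ) *
              ((2 * Real.pi : ℝ) : ℂ)⁻¹ ^ p *
              ∫ φ in cube p, integrand (genC (∑ k, α k)) 1 α (fun k => matBC v (S k))
                (fun k => (1 / 2 : ℝ) • ((1 + matBC v (S k)) * D k * (1 - matBC v (S k))))
                v r x φ))) ∧
    -- the special case: the diagonal of the generalized quadratic form `(1/2) X A X'`
    (∀ (m : ℕ) (S : Matrix (Fin p) (Fin p) ℝ) (_ : S.PosDef) (M : Matrix (Fin p) (Fin m) ℝ)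
      (A T : Matrix (Fin m) (Fin m) ℝ) (l : Fin m → ℝ) (_ : A.PosSemidef) (_ : 0 < A.rank)
      (_ : T ∈ Matrix.orthogonalGroup (Fin m) ℝ) (_ : Antitone l)
      (_ : T.transpose * A * T = Matrix.diagonal l)
      (Ω : Type*) (_ : MeasurableSpace Ω) (P : Measure Ω) (_ : IsProbabilityMeasure P)
      (X : Ω → Matrix (Fin p) (Fin m) ℝ)
      (_ : ∀ i, HasLaw (fun ω => WithLp.toLp 2 (fun j => X ω j i))
        (multivariateGaussian (WithLp.toLp 2 (fun j => M j i)) S) P)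
      (_ : iIndepFun (fun (i : Fin m) (ω : Ω) (j : Fin p) => X ω j i) P)
      (α : Fin A.rank → ℝ) (S' D : Fin A.rank → Matrix (Fin p) (Fin p) ℝ)
      (_ : α = fun _ => 1 / 2)
      (_ : S' = fun k => l (Fin.castLE A.rank_le_height k) • S)
      (_ : D = fun k => (1 / 2 : ℝ) •
        (Matrix.vecMulVec (fun j => (M * T) j (Fin.castLE A.rank_le_height k))
          (fun j => (M * T) j (Fin.castLE A.rank_le_height k)) * S⁻¹)),
      (∀ k, (S' k).PosDef) ∧ (∀ k, NonnegEigenvalues (D k)) ∧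
      ∀ f : (Fin p → ℝ) → ℝ, IsConvolutionDensity α S' D f →
        ∀ x : Fin p → ℝ, (∀ j, 0 ≤ x j) →
          P.real {ω | ∀ j, 1 / 2 * (X ω * A * (X ω).transpose) j j ≤ x j} = boxIntegral f x) := by
  refine ⟨fun n hn α S D hα hS hD => ⟨exists_convolutionDensity hn hα hS, fun ξ hξ => ?_,
    fun v hv => specNorm_conditions hS hv,
    fun f hf x hx v r hv => representations hn hα hS hf hx hv⟩, ?_⟩
  · have ha := sum_shape_pos hn hα
    exact ⟨fun y hy => hasSum_genA ha hξ hy, fun y => summable_genB ha hξ y,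
      fun y hy => hasSum_genC ha hξ hy⟩
  · rintro m S hS M A T l hA - hT hl hTA Ω _ P _ X hX hind α S' D rfl rfl rfl
    have hev := eigenvalues_of_orthogonal_diagonalization hA
      ((Matrix.mem_orthogonalGroup_iff' _ _).1 hT) hl hTA
    exact ⟨fun k => hS.smul ((hev _).2.1 k.2),
      fun k => nonnegEigenvalues_smul_vecMulVec_mul_inv hS _,
      fun f hf x _ => quadraticForm_diagonal_le_eq_boxIntegral hS M hA hT hl hTA hX hind hf x⟩
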